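/- **Notation.** $\sigma_3=\operatorname{diag}(1,-1)$. For $\nu\in\mathbb R$, $D_\nu$ is the parabolic cylinder function: the entire solution of $w''(\zeta)+(\nu+\tfrac12-\tfrac14\zeta^2)w(\zeta)=0$ with $D_\nu(\zeta)\sim \zeta^{\nu}e^{-\zeta^2/4}$ as $\zeta\to\infty$, $|\arg\zeta|<\tfrac{3\pi}{4}$. The Painlevé IV equation with parameters $\Theta,\Theta_\infty$ is $$u''=\frac{(u')^2}{2u}+\frac32u^3+4su^2+2(s^2+1-2\Theta_\infty)u-\frac{8\Theta^2}{u},$$ understood after multiplication by $2u$ (so that, for $\Theta=0$, $u\equiv0$ is admitted as a solution). **Riemann–Hilbert problem.** For $s\in\mathbb C$ we look for a $2\times2$ matrix function $\Psi(\lambda)=\Psi(\lambda,s)$ such that: (a) $\Psi$ is analytic in $\mathbb C\setminus(\mathbb R\cup i\mathbb R)$; (b) on the four open half-axes, oriented from $0$ to $\infty$ with the $+$ side on the left, $\Psi$ has boundary values with $\Psi_+=\Psi_-J$, where $J=S_1,\ S_2,\ S_3,\ S_4e^{2\pi i\Theta_\infty\sigma_3}$ on $\mathbb R_+,\ i\mathbb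 R_+,\ \mathbb R_-,\ i\mathbb R_-$ respectively, and $$S_1=\begin{pmatrix}1&0\\s_1&1\end{pmatrix},\quad S_2=\begin{pmatrix}1&s_2\\0&1\end{pmatrix},\quad S_3=\begin{pmatrix}1&0\\s_3&1\end{pmatrix},\quad S_4=\begin{pmatrix}1&s_4\\0&1\end{pmatrix};$$ (c) as $\lambda\to\infty$, $\Psi(\lambda)=\bigl(I+\Psi_{-1}\lambda^{-1}+\Psi_{-2}\lambda^{-2}+O(\lambda^{-3})\bigr)e^{(\lambda^2/2+s\lambda)\sigma_3}\lambda^{-\Theta_\infty\sigma_3}$, for some matrices $\Psi_{-1},\Psi_{-2}$ depending on $s$; (d) as $\lambda\to0$ in the fourth quadrant, $\Psi(\lambda)\,\mathcal C^{-1}\lambda^{-\Theta\sigma_3}=O(1)$, and the same bound holds as $\lambda\to 0$ in the first, second and third quadrants for the counterclockwise analytic continuation of $\Psi|_{\text{4th quadrant}}$, that is, with $\Psi$ replaced by $\Psi S_1^{-1}$, $\Psi(S_1S_2)^{-1}$, $\Psi(S_1S_2S_3)^{-1}$ respectively. Powers of $\lambda$ have their cut along $i\mathbb R_-$, with $-\tfrac\pi2<\arg\lambda<\tfrac{3\pi}2$.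 The special data are $$s_1=\bigl(e^{(\Theta_\infty-\Theta)\pi i}-e^{-(\Theta_\infty-\Theta)\pi i}\bigr)e^{\Theta_\infty\pi i},\qquad s_2=e^{-\Theta\pi i},$$ $$s_3=-\bigl(e^{(\Theta_\infty+\Theta)\pi i}-e^{-(\Theta_\infty+\Theta)\pi i}\bigr)e^{-\Theta_\infty\pi i},\qquad s_4=-e^{(2\Theta_\infty+\Theta)\pi i},$$ $$\mathcal C=\begin{pmatrix}1&0\\-e^{(2\Theta_\infty-\Theta)\pi i}&1\end{pmatrix}.$$ **Special solution.** A meromorphic function $u$ on $\mathbb C$ is called the special solution of Painlevé IV with parameters $(\Theta,\Theta_\infty)$ if it solves that equation wherever it is analytic and if, for all $s$ outside a closed discrete set, the Riemann–Hilbert problem with the special data has a solution, $(\Psi_{-1}(s))_{12}$ is differentiable and non-zero, and $$u(s)=-2s-\frac{d}{ds}\log\bigl(\Psi_{-1}(s)\bigr)_{12}.$$ **Statement.** Let $\nu\in\mathbb R\setminus\{0,1,2,\dots\}$, $b\in\mathbb R$, and put $\Theta=-b$, $\Theta_\infty=\nu+b$. 1. If $b\in\tfrac12\mathbb Z$, every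 special solution $u$ is expressed through parabolic cylinder functions: $u=P/Q$, where $P$ and $Q\not\equiv0$ are polynomials, with constant coefficients, in $s$, $D_\nu(\sqrt2s)$, $D_{\nu-1}(\sqrt2s)$, $D_\nu(-\sqrt2s)$, $D_{\nu-1}(-\sqrt2s)$. 2. If $b=0$, the special solution exists, is unique, and is $u\equiv0$. 3. If $b=\tfrac12$, the special solution exists and is unique, and $$u(s)=\frac{d}{ds}\log\frac{D_\nu(\sqrt2\,s)}{D_{\nu-1}(\sqrt2\,s)}.$$ Its poles are exactly the zeros of $D_\nu(\sqrt2\,s)$ and of $D_{\nu-1}(\sqrt2\,s)$. -/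

import Mathlib

open Filter Topology Asymptotics

noncomputable section

namespace PIV

/-! ### Parabolic cylinder functions -/

/-- Kummer's confluent hypergeometric function `M(a, c, z) = ∑ (a)ₙ / (c)ₙ * zⁿ / n!`. -/
def kummerM (a c z : ℂ) : ℂ :=
  Complex.Gamma c * Complex.regularizedHGFun {a} {c} z

/-- The parabolic cylinder function `D_ν(z)`, an entire function of `z`: the solution of
`w'' + (ν + 1/2 - z²/4) w = 0` with `w ∼ z^ν e^{-z²/4}` as `z → ∞`, `|arg z| < 3π/4`,
in its standard form as a combination of the even and the odd solution.
At the poles of `Γ` the value of `(Complex.Gamma _)⁻¹` is `0`, as it should be. -/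
def pcfD (ν z : ℂ) : ℂ :=
  (2 : ℂ) ^ (ν / 2) * Complex.exp (-z ^ 2 / 4) *
    ((√Real.pi : ℂ) * (Complex.Gamma ((1 - ν) / 2))⁻¹ * kummerM (-ν / 2) (1 / 2) (z ^ 2 / 2)
      - (√(2 * Real.pi) : ℂ) * z * (Complex.Gamma (-ν / 2))⁻¹ *
          kummerM ((1 - ν) / 2) (3 / 2) (z ^ 2 / 2))

/-! ### The Riemann-Hilbert problem -/

/-- Complex `2 × 2` matrices. -/
abbrev Mat := Matrix (Fin 2) (Fin 2) ℂ

/-- `e^{x σ₃}`. -/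
def expSigma (x : ℂ) : Mat := !![Complex.exp x, 0; 0, Complex.exp (-x)]

/-- The logarithm with `-π/2 < arg < 3π/2`, that is, with cut along the negative imaginary axis. -/
def cutLog (l : ℂ) : ℂ := Complex.log (-Complex.I * l) + Real.pi / 2 * Complex.I

/-- The open first quadrant. -/
def quad1 : Set ℂ := {l | 0 < l.re ∧ 0 < l.im}
/-- The open second quadrant. -/
def quad2 : Set ℂ := {l | l.re < 0 ∧ 0 < l.im}
/-- The open third quadrant. -/
def quad3 : Set ℂ := {l | l.re < 0 ∧ l.im < 0}
/-- The open fourth quadrant. -/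
def quad4 : Set ℂ := {l | 0 < l.re ∧ l.im < 0}
/-- The plane without the real and the imaginary axis. -/
def offAxes : Set ℂ := {l | l.re ≠ 0 ∧ l.im ≠ 0}

/-- At the point `p`, the function `Ψ` has boundary values `Ψ₊` from `plus` and `Ψ₋` from `minus`,
and `Ψ₊ = Ψ₋ J`. -/
def HasJump (Ψ : ℂ → Mat) (p : ℂ) (plus minus : Set ℂ) (J : Mat) : Prop :=
  ∃ A B : Mat, Tendsto Ψ (𝓝[plus] p) (𝓝 A) ∧ Tendsto Ψ (𝓝[minus] p) (𝓝 B) ∧ A = B * J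

/-- The matrix `1 + a σ₋`. -/
def lowerTri (a : ℂ) : Mat := !![1, 0; a, 1]
/-- The matrix `1 + a σ₊`. -/
def upperTri (a : ℂ) : Mat := !![1, a; 0, 1]

/-- `Ψ` solves, for the given `s`, the Riemann-Hilbert problem of Painlevé IV with parameters `Θ`
and `Θ∞` (written `Ti`), Stokes multipliers `s₁, …, s₄` and connection matrix `C`, and `Ψ₁` is the
coefficient of `1/λ` in its expansion at infinity. The four half-axes are oriented from `0` to `∞`,
with the `+` side on the left. -/
structure IsPsiSolution (Θ Ti s₁ s₂ s₃ s₄ : ℂ) (C : Mat) (s : ℂ) (Ψ : ℂ → Mat) (Ψ₁ : Mat) :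
    Prop where
  analytic : ∀ i j, DifferentiableOn ℂ (fun l => Ψ l i j) offAxes
  jump₁ : ∀ x : ℝ, 0 < x → HasJump Ψ x quad1 quad4 (lowerTri s₁)
  jump₂ : ∀ x : ℝ, 0 < x → HasJump Ψ (x * Complex.I) quad2 quad1 (upperTri s₂)
  jump₃ : ∀ x : ℝ, 0 < x → HasJump Ψ (-x) quad3 quad2 (lowerTri s₃)
  jump₄ : ∀ x : ℝ, 0 < x → HasJump Ψ (-x * Complex.I) quad4 quad3
    (upperTri s₄ * expSigma (2 * Real.pi * Complex.I * Ti))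
  /-- `Ψ = (1 + Ψ₁/λ + Ψ₂/λ² + O(λ⁻³)) e^{(λ²/2 + sλ)σ₃} λ^{-Θ∞ σ₃}` as `λ → ∞`. -/
  atInfinity : ∃ Ψ₂ : Mat, ∀ i j,
    (fun l : ℂ => (Ψ l * expSigma (-(l ^ 2 / 2 + s * l - Ti * cutLog l))
        - (1 + l⁻¹ • Ψ₁ + (l ^ 2)⁻¹ • Ψ₂)) i j)
      =O[Bornology.cobounded ℂ ⊓ 𝓟 offAxes] fun l : ℂ => (l ^ 3)⁻¹
  /-- `Ψ C⁻¹ λ^{-Θ σ₃} = O(1)` as `λ → 0` in the fourth quadrant. -/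
  atZero₄ : ∀ i j, (fun l : ℂ => (Ψ l * C⁻¹ * expSigma (-Θ * cutLog l)) i j)
    =O[𝓝[quad4] 0] fun _ => (1 : ℂ)
  /-- The same bound for the analytic continuation of `Ψ` from the fourth quadrant, through the
  positive real axis, into the first quadrant. -/
  atZero₁ : ∀ i j, (fun l : ℂ => (Ψ l * (lowerTri s₁)⁻¹ * C⁻¹ * expSigma (-Θ * cutLog l)) i j)
    =O[𝓝[quad1] 0] fun _ => (1 : ℂ)
  /-- The same bound for the continuation into the second quadrant. -/
  atZero₂ : ∀ i j, (fun l : ℂ =>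
      (Ψ l * (lowerTri s₁ * upperTri s₂)⁻¹ * C⁻¹ * expSigma (-Θ * cutLog l)) i j)
    =O[𝓝[quad2] 0] fun _ => (1 : ℂ)
  /-- The same bound for the continuation into the third quadrant. -/
  atZero₃ : ∀ i j, (fun l : ℂ =>
      (Ψ l * (lowerTri s₁ * upperTri s₂ * lowerTri s₃)⁻¹ * C⁻¹ * expSigma (-Θ * cutLog l)) i j)
    =O[𝓝[quad3] 0] fun _ => (1 : ℂ)

/-- The special Stokes multiplier `s₁`. -/
def stokes₁ (Θ Ti : ℂ) : ℂ :=
  (Complex.exp ((Ti - Θ) * Real.pi * Complex.I) - Complex.exp (-(Ti - Θ) * Real.pi * Complex.I)) *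
    Complex.exp (Ti * Real.pi * Complex.I)
/-- The special Stokes multiplier `s₂`. -/
def stokes₂ (Θ : ℂ) : ℂ := Complex.exp (-Θ * Real.pi * Complex.I)
/-- The special Stokes multiplier `s₃`. -/
def stokes₃ (Θ Ti : ℂ) : ℂ :=
  -(Complex.exp ((Ti + Θ) * Real.pi * Complex.I) - Complex.exp (-(Ti + Θ) * Real.pi * Complex.I)) *
    Complex.exp (-Ti * Real.pi * Complex.I)
/-- The special Stokes multiplier `s₄`. -/
def stokes₄ (Θ Ti : ℂ) : ℂ := -Complex.exp ((2 * Ti + Θ) * Real.pi * Complex.I)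
/-- The connection matrix that belongs to the special Stokes multipliers. -/
def connection (Θ Ti : ℂ) : Mat :=
  lowerTri (-Complex.exp ((2 * Ti - Θ) * Real.pi * Complex.I))

/-- The Riemann-Hilbert problem with the special Stokes multipliers. -/
def IsSpecialPsi (Θ Ti s : ℂ) (Ψ : ℂ → Mat) (Ψ₁ : Mat) : Prop :=
  IsPsiSolution Θ Ti (stokes₁ Θ Ti) (stokes₂ Θ) (stokes₃ Θ Ti) (stokes₄ Θ Ti)
    (connection Θ Ti) s Ψ Ψ₁

/-! ### Painlevé IV -/

/-- `u` satisfies Painlevé IV (multiplied by `2u`) wherever it is analytic. -/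
def SolvesPIV (Θ Ti : ℂ) (u : ℂ → ℂ) : Prop :=
  ∀ s, AnalyticAt ℂ u s →
    2 * u s * deriv (deriv u) s =
      deriv u s ^ 2 + 3 * u s ^ 4 + 8 * s * u s ^ 3 + 4 * (s ^ 2 + 1 - 2 * Ti) * u s ^ 2
        - 16 * Θ ^ 2

/-- `u` is the solution of Painlevé IV with parameters `Θ` and `Θ∞` that belongs to the special
Stokes multipliers: it is meromorphic in the plane (normalised to take the value `0` at its poles),
and, apart from a discrete closed set of `s`, the Riemann-Hilbert problem is solvable and
`u(s) = -2s - (d/ds) log (Ψ₁(s))₁₂`. -/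
structure IsSpecialSolution (Θ Ti : ℂ) (u : ℂ → ℂ) : Prop where
  meromorphic : MeromorphicNFOn u Set.univ
  solves : SolvesPIV Θ Ti u
  fromPsi : ∃ (Ψ : ℂ → ℂ → Mat) (Ψ₁ : ℂ → Mat), ∀ᶠ s in codiscrete ℂ,
    IsSpecialPsi Θ Ti s (Ψ s) (Ψ₁ s) ∧ Ψ₁ s 0 1 ≠ 0 ∧
      DifferentiableAt ℂ (fun t => Ψ₁ t 0 1) s ∧
      u s = -2 * s - logDeriv (fun t => Ψ₁ t 0 1) s

/-- `D_ν(√2 s)`. -/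
def pcfSqrtTwo (ν : ℝ) (s : ℂ) : ℂ := pcfD ν ((√2 : ℝ) * s)

/-- The functions `s`, `D_ν(√2 s)`, `D_{ν-1}(√2 s)`, `D_ν(-√2 s)`, `D_{ν-1}(-√2 s)`. -/
def pcfTuple (ν : ℝ) (s : ℂ) : Fin 5 → ℂ :=
  ![s, pcfSqrtTwo ν s, pcfSqrtTwo (ν - 1) s, pcfSqrtTwo ν (-s), pcfSqrtTwo (ν - 1) (-s)]

/-- `u` is expressed through parabolic cylinder functions: it is a quotient of two polynomials, with
constant coefficients, in `s`, `D_ν(±√2 s)` and `D_{ν-1}(±√2 s)`. -/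
def IsRationalInPcf (ν : ℝ) (u : ℂ → ℂ) : Prop :=
  ∃ P Q : MvPolynomial (Fin 5) ℂ,
    (∃ s, MvPolynomial.eval (pcfTuple ν s) Q ≠ 0) ∧
    ∀ s, MvPolynomial.eval (pcfTuple ν s) Q ≠ 0 →
      u s = MvPolynomial.eval (pcfTuple ν s) P / MvPolynomial.eval (pcfTuple ν s) Q

end PIV

end

noncomputable section

namespace PIV

/-! For Θ = -k/2 and Θ∞ = ν + k/2 with k an integer, the special jumps are, up to a constant
diagonal conjugation and the scalar factor λ^{k/2}, those of a model built from parabolic cylinder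
functions. In the model the second column in each half-plane Re λ > 0, Re λ < 0 is the solution
decaying there, and the first column in each half-plane Im λ > 0, Im λ < 0 is the one small in the
imaginary direction. The connection formula `pcfF_connection` gives the constant matrices `pcfK`
relating these choices, and the identities `pcfK₁_jump` to `pcfK₃_jump` together with `pcfK₄_jump`
identify their ratios with the special Stokes matrices. The connection matrix at 0 is conjugate to
`pcfK₄`, so the condition at the origin becomes a vanishing order for each column.

Dividing a solution Ψ by the model therefore leaves a function without jumps, bounded at 0 and of
growth |λ|^{|k|}: a matrix of polynomials (`exists_isPolyReduction`). Conversely every such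
polynomial matrix yields a solution (`IsPolyReduction.isSpecialPsi`). This needs the full asymptotic
expansion of the model, uniform up to the axes, `hasExpansion_pcfW`. It comes from the Laplace
integral on two rotated rays (`pcfF_eq_integral`), Watson's lemma with explicit constants
(`watson_bound`), and the three term recurrence to reach all indices (`exists_isPcfSeries`).

The polynomial problem is finite-dimensional linear algebra. Its homogeneous version has only the
zero solution as soon as the problem is solvable, because the 2 × 2 determinant of a homogeneous row
with a row of P is a polynomial with a zero of order |k| and growth below |λ|^{|k|}
(`IsPolyReduction.eq_zero`). The coefficients of the linear system lie in the algebra generated by s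
and the four cylinder functions, which is closed under d/ds, so Cramer's rule
(`exists_quotient_of_linear_system`) writes the upper right entry of the 1/λ coefficient as p/q over
that algebra. Undoing the row normalisation multiplies it by a constant times e^{-s²}, which cancels
the term -2s, and u = q'/q - p'/p.

For k = 0 the polynomial matrix is the identity and p/q is constant, so u = 0. For k = 1 the
polynomial matrix is explicit (`exists_isPolyReduction_one`) and p/q is a constant times D_{ν-1}(√2
s)/D_ν(√2 s). Here Painlevé IV follows from a first-order system for R = √2 D_ν/D_{ν-1} and T = 2ν/R
(`logDerivRatio_painleve`). The meromorphic normal form turns equalities off a discrete set into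
equalities of functions, which gives uniqueness. -/

/-! ### Asymptotic power series -/

/-- `f` has the asymptotic power series `c` in the gauge `x` along the filter `l`. -/
def HasExpansion {α : Type*} (l : Filter α) (x f : α → ℂ) (c : PowerSeries ℂ) : Prop :=
  ∀ N : ℕ, (fun t => f t - (c.trunc N).eval (x t)) =O[l] fun t => x t ^ N

theorem eval_trunc (c : PowerSeries ℂ) (N : ℕ) (z : ℂ) :
    (c.trunc N).eval z = ∑ k ∈ Finset.range N, PowerSeries.coeff k c * z ^ k := by
  simpa using PowerSeries.eval₂_trunc_eq_sum_range z (RingHom.id ℂ) N c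

namespace HasExpansion

variable {α β : Type*} {l l' : Filter α} {x f g : α → ℂ} {c d : PowerSeries ℂ}

theorem mono (h : HasExpansion l x f c) (hl : l' ≤ l) : HasExpansion l' x f c :=
  fun N => (h N).mono hl

theorem sup (h : HasExpansion l x f c) (h' : HasExpansion l' x f c) :
    HasExpansion (l ⊔ l') x f c :=
  fun N => (h N).sup (h' N)

theorem congr' (h : HasExpansion l x f c) (hfg : f =ᶠ[l] g) : HasExpansion l x g c :=
  fun N => (h N).congr' (hfg.mono fun t ht => by simp [ht]) EventuallyEq.rfl

theorem congr_gauge (h : HasExpansion l x f c) {y : α → ℂ} (hxy : x =ᶠ[l] y) :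
    HasExpansion l y f c :=
  fun N => (h N).congr' (hxy.mono fun t ht => by simp [ht]) (hxy.mono fun t ht => by simp [ht])

theorem comp_tendsto (h : HasExpansion l x f c) {φ : β → α} {k : Filter β} (hφ : Tendsto φ k l) :
    HasExpansion k (x ∘ φ) (f ∘ φ) c :=
  fun N => (h N).comp_tendsto hφ

theorem isBigO_polynomial_eval (hx : Tendsto x l (𝓝 0)) (p : Polynomial ℂ) :
    (fun t => p.eval (x t)) =O[l] fun _ => (1 : ℂ) :=
  ((p.continuous.tendsto 0).comp hx).isBigO_one ℂ

theorem isBigO_polynomial_eval_of_dvd (hx : Tendsto x l (𝓝 0)) {p : Polynomial ℂ} {N : ℕ}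
    (hp : ∀ k < N, p.coeff k = 0) :
    (fun t => p.eval (x t)) =O[l] fun t => x t ^ N := by
  obtain ⟨q, rfl⟩ := Polynomial.X_pow_dvd_iff.2 hp
  simpa using (isBigO_refl (fun t => x t ^ N) l).mul (isBigO_polynomial_eval hx q)

theorem isBigO_pow_of_le (hx : Tendsto x l (𝓝 0)) {M N : ℕ} (h : N ≤ M) :
    (fun t => x t ^ M) =O[l] fun t => x t ^ N := by
  obtain ⟨k, rfl⟩ := Nat.exists_eq_add_of_le h
  simpa [pow_add] using (isBigO_refl (fun t => x t ^ N) l).mul ((hx.pow k).isBigO_one ℂ)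

/-- Terms of degree between N and M are themselves O(x^N), so a longer truncation is as good. This
serves series whose natural truncations skip orders, as in `HasExpansion.sq_gauge`. -/
theorem of_le (hx : Tendsto x l (𝓝 0))
    (h : ∀ N : ℕ, ∃ M, N ≤ M ∧
      (fun t => f t - (c.trunc M).eval (x t)) =O[l] fun t => x t ^ N) :
    HasExpansion l x f c := fun N => by
  obtain ⟨M, hM, hf⟩ := h N
  have := isBigO_polynomial_eval_of_dvd hx (p := c.trunc M - c.trunc N) (N := N) (fun k hk => by
    simp [PowerSeries.coeff_trunc, hk, hk.trans_le hM])
  refine (hf.add this).congr_left fun t => ?_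
  simp

theorem polynomial (hx : Tendsto x l (𝓝 0)) (p : Polynomial ℂ) :
    HasExpansion l x (fun t => p.eval (x t)) p := fun N => by
  have := isBigO_polynomial_eval_of_dvd hx (p := p - (p : PowerSeries ℂ).trunc N) (N := N)
    (fun k hk => by simp [PowerSeries.coeff_trunc, hk])
  refine this.congr_left fun t => ?_
  simp

theorem const (hx : Tendsto x l (𝓝 0)) (a : ℂ) :
    HasExpansion l x (fun _ => a) (PowerSeries.C a) := by
  simpa using polynomial hx (Polynomial.C a)

theorem gauge (hx : Tendsto x l (𝓝 0)) : HasExpansion l x x PowerSeries.X := by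
  simpa using polynomial hx Polynomial.X

theorem isBigO_one (hf : HasExpansion l x f c) :
    f =O[l] fun _ => (1 : ℂ) := by
  simpa using hf 0

theorem add (hf : HasExpansion l x f c) (hg : HasExpansion l x g d) :
    HasExpansion l x (fun t => f t + g t) (c + d) := fun N => by
  refine ((hf N).add (hg N)).congr_left fun t => ?_
  simp; ring

theorem mul (hx : Tendsto x l (𝓝 0)) (hf : HasExpansion l x f c) (hg : HasExpansion l x g d) :
    HasExpansion l x (fun t => f t * g t) (c * d) := fun N => by
  have h1 := (hf N).mul (hg.isBigO_one)
  have h2 := (isBigO_polynomial_eval hx (c.trunc N)).mul (hg N)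
  -- The error splits as (f - c_N) g + c_N (g - d_N) + (c_N d_N - (cd)_N); the last polynomial has
  -- no coefficient below degree N.
  have h3 := isBigO_polynomial_eval_of_dvd hx
    (p := c.trunc N * d.trunc N - (c * d).trunc N) (N := N) (fun k hk => by
      rw [Polynomial.coeff_sub, PowerSeries.coeff_trunc, if_pos hk,
        PowerSeries.coeff_mul_eq_coeff_trunc_mul_trunc _ _ hk, ← Polynomial.coe_mul,
        Polynomial.coeff_coe, sub_self])
  simp only [mul_one, one_mul] at h1 h2
  refine ((h1.add h2).add h3).congr_left fun t => ?_
  simp; ring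

theorem const_mul (hx : Tendsto x l (𝓝 0)) (a : ℂ) (hf : HasExpansion l x f c) :
    HasExpansion l x (fun t => a * f t) (PowerSeries.C a * c) :=
  (const hx a).mul hx hf

theorem sub (hx : Tendsto x l (𝓝 0)) (hf : HasExpansion l x f c) (hg : HasExpansion l x g d) :
    HasExpansion l x (fun t => f t - g t) (c - d) := by
  have := hf.add (hg.const_mul hx (-1))
  simpa [sub_eq_add_neg] using this

theorem rescale {a : ℂ} (h : HasExpansion l (fun t => a * x t) f c) :
    HasExpansion l x f (PowerSeries.rescale a c) := fun N => by
  have h1 : (fun t => (a * x t) ^ N) =O[l] fun t => x t ^ N := by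
    simp only [mul_pow]
    exact isBigO_const_mul_self _ _ _
  refine ((h N).trans h1).congr_left fun t => ?_
  simp only [eval_trunc, PowerSeries.coeff_rescale]
  congr 1
  exact Finset.sum_congr rfl fun k _ => by ring

theorem isBigO_of_coeff (hf : HasExpansion l x f c) {N : ℕ}
    (h : ∀ k < N, PowerSeries.coeff k c = 0) : f =O[l] fun t => x t ^ N := by
  have h0 : c.trunc N = 0 := by
    ext k
    by_cases hk : k < N <;> simp [PowerSeries.coeff_trunc, hk, h]
  simpa [h0] using hf N

/-- Uniqueness of asymptotic series. Once the lower coefficients vanish, c_k x^k = O(x^{k+1});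
dividing by x^k, possible because the gauge is eventually nonzero, forces c_k = 0. -/
theorem coeff_eq_zero [l.NeBot] (hx : Tendsto x l (𝓝[≠] 0)) (hf : HasExpansion l x f c) {N : ℕ}
    (h : f =O[l] fun t => x t ^ N) : ∀ k < N, PowerSeries.coeff k c = 0 := by
  have hx0 : Tendsto x l (𝓝 0) := hx.mono_right nhdsWithin_le_nhds
  have hne : ∀ᶠ t in l, x t ≠ 0 := hx self_mem_nhdsWithin
  intro k
  induction k using Nat.strong_induction_on with
  | _ k ih =>
    intro hk
    have h1 := hf (k + 1)
    have h2 : c.trunc (k + 1) = Polynomial.monomial k (PowerSeries.coeff k c) := by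
      rw [PowerSeries.trunc_succ]
      have : c.trunc k = 0 := by
        ext j
        by_cases hj : j < k
        · simp [PowerSeries.coeff_trunc, hj, ih j hj (hj.trans hk)]
        · simp [PowerSeries.coeff_trunc, hj]
      rw [this, zero_add]
    simp only [h2, Polynomial.eval_monomial] at h1
    have h3 : (fun t => PowerSeries.coeff k c * x t ^ k) =O[l] fun t => x t ^ (k + 1) := by
      refine ((h.trans (isBigO_pow_of_le hx0 hk)).sub h1).congr_left fun t => ?_
      ring
    have h4 : (fun _ : α => PowerSeries.coeff k c) =O[l] x := by
      have h5 := h3.mul (isBigO_refl (fun t => (x t ^ k)⁻¹) l)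
      refine h5.congr' ?_ ?_
      · filter_upwards [hne] with t ht
        field_simp
      · filter_upwards [hne] with t ht
        rw [pow_succ]
        field_simp
    have h6 := h4.trans_tendsto hx0
    exact tendsto_nhds_unique tendsto_const_nhds h6

theorem tendsto (hx : Tendsto x l (𝓝 0)) (hf : HasExpansion l x f c) :
    Tendsto f l (𝓝 (PowerSeries.constantCoeff c)) := by
  have h1 := (hf 1)
  have h2 : Tendsto (fun t => f t - PowerSeries.constantCoeff c) l (𝓝 0) := by
    have : c.trunc 1 = Polynomial.C (PowerSeries.constantCoeff c) := by
      ext k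
      rcases k with _ | k
      · simp
      · simp
    simp only [this, Polynomial.eval_C, pow_one] at h1
    exact h1.trans_tendsto hx
  simpa using h2.add_const (PowerSeries.constantCoeff c)

/-- The Taylor series of an analytic function is its asymptotic power series. -/
theorem taylor {f : ℂ → ℂ} {s : ℂ} (hf : AnalyticAt ℂ f s) :
    HasExpansion (𝓝 0) id (fun t => f (s + t))
      (PowerSeries.mk fun k => iteratedDeriv k f s / (k.factorial : ℂ)) := fun N => by
  have h := hf.hasFPowerSeriesAt.isBigO_sub_partialSum_pow N
  refine (h.congr_left fun t => ?_).trans (IsBigO.of_bound 1 (by simp))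
  congr 1
  simp only [FormalMultilinearSeries.partialSum, eval_trunc, PowerSeries.coeff_mk, id]
  refine Finset.sum_congr rfl fun k _ => ?_
  rw [FormalMultilinearSeries.apply_eq_pow_smul_coeff, FormalMultilinearSeries.coeff_ofScalars]
  simp [mul_comm]

end HasExpansion

/-! ### Kummer's function and the parabolic cylinder functions -/

theorem hasSum_of_forall_eq {f g : ℕ → ℂ} {a : ℂ} (h : HasSum f a) (hfg : ∀ n, g n = f n) :
    HasSum g a := by
  rwa [funext hfg]

theorem hasSum_kummerM (a c z : ℂ) (hc : ∀ n : ℕ, c ≠ -n) :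
    HasSum (fun n : ℕ => (ascPochhammer ℂ n).eval a / (ascPochhammer ℂ n).eval c
      / (n.factorial : ℂ) * z ^ n) (kummerM a c z) := by
  have hr : (Complex.regularizedHGFunSeries {a} {c}).radius = ⊤ :=
    Complex.radius_regularizedHGFunSeries_eq_top (by simp)
  have h := (Complex.regularizedHGFunSeries {a} {c}).hasSum (x := z) (by
    rw [hr]; simp)
  have h2 := h.mul_left (Complex.Gamma c)
  refine hasSum_of_forall_eq h2 fun n => ?_
  rw [FormalMultilinearSeries.apply_eq_pow_smul_coeff, Complex.regularizedHGFunSeries_coeff]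
  have h3 := Complex.Gamma_add_nat_div_Gamma_eq c hc (n := n)
  have h4 : Complex.Gamma c ≠ 0 := Complex.Gamma_ne_zero hc
  have h5 : Complex.Gamma (c + n) ≠ 0 := Complex.Gamma_ne_zero fun m hm => hc (n + m) (by
    push_cast
    linear_combination hm)
  simp only [Complex.regularizedHGFunCoeff, Multiset.map_singleton, Multiset.prod_singleton,
    smul_eq_mul, ← h3]
  field_simp

theorem differentiable_kummerM (a c : ℂ) : Differentiable ℂ (kummerM a c) := by
  have hr : (Complex.regularizedHGFunSeries {a} {c}).radius = ⊤ :=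
    Complex.radius_regularizedHGFunSeries_eq_top (by simp)
  have h := (Complex.regularizedHGFunSeries {a} {c}).hasFPowerSeriesOnBall (by simp [hr])
  rw [hr] at h
  intro z
  exact ((h.differentiableOn z (by simp)).differentiableAt
    (Metric.isOpen_eball.mem_nhds (by simp))).const_mul _

/-- The function `e^{z²/4} D_ν(z)`. -/
def pcfF (ν z : ℂ) : ℂ := Complex.exp (z ^ 2 / 4) * pcfD ν z

theorem pcfF_eq (ν z : ℂ) : pcfF ν z = (2 : ℂ) ^ (ν / 2) *
    ((√Real.pi : ℂ) * (Complex.Gamma ((1 - ν) / 2))⁻¹ * kummerM (-ν / 2) (1 / 2) (z ^ 2 / 2)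
      - (√(2 * Real.pi) : ℂ) * z * (Complex.Gamma (-ν / 2))⁻¹ *
          kummerM ((1 - ν) / 2) (3 / 2) (z ^ 2 / 2)) := by
  have : Complex.exp (z ^ 2 / 4) * Complex.exp (-z ^ 2 / 4) = 1 := by
    rw [← Complex.exp_add]; ring_nf; simp
  rw [pcfF, pcfD]
  linear_combination ((2 : ℂ) ^ (ν / 2) *
    ((√Real.pi : ℂ) * (Complex.Gamma ((1 - ν) / 2))⁻¹ * kummerM (-ν / 2) (1 / 2) (z ^ 2 / 2)
      - (√(2 * Real.pi) : ℂ) * z * (Complex.Gamma (-ν / 2))⁻¹ *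
          kummerM ((1 - ν) / 2) (3 / 2) (z ^ 2 / 2))) * this

/-- The Taylor coefficients at `0` of a solution of `F'' = z F' - ν F`. -/
def hermiteCoeff (ν A B : ℂ) : ℕ → ℂ
  | 0 => A
  | 1 => B
  | n + 2 => (n - ν) / ((n + 1) * (n + 2)) * hermiteCoeff ν A B n

/-- The recurrence moves by two, so the parities decouple, and (2n - ν)/((2n+1)(2n+2)) is half the
ratio of consecutive Kummer coefficients with a = -ν/2, c = 1/2. -/
theorem hermiteCoeff_even (ν A B : ℂ) (n : ℕ) : hermiteCoeff ν A B (2 * n) =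
    A * ((ascPochhammer ℂ n).eval (-ν / 2) / (ascPochhammer ℂ n).eval (1 / 2)
      / (n.factorial : ℂ) * (1 / 2) ^ n) := by
  induction n with
  | zero => simp [hermiteCoeff]
  | succ n ih =>
    have h1 : (ascPochhammer ℂ n).eval (1 / 2) ≠ 0 := by
      rw [Ne, ascPochhammer_eval_eq_zero_iff]
      rintro ⟨k, -, hk⟩
      have := congrArg Complex.re hk
      norm_num at this
      have : (0 : ℝ) ≤ k := k.cast_nonneg
      linarith
    have h2 : (2 * (n : ℂ) + 1) ≠ 0 := by exact_mod_cast Nat.succ_ne_zero (2 * n)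
    have h3 : ((n : ℂ) + 1) ≠ 0 := by exact_mod_cast Nat.succ_ne_zero n
    have h4 : ((1 : ℂ) / 2 + n) = (2 * n + 1) / 2 := by ring
    have h5 : (n.factorial : ℂ) ≠ 0 := by exact_mod_cast n.factorial_ne_zero
    have h6 : (2 * (n : ℂ) + 2) ≠ 0 := by exact_mod_cast Nat.succ_ne_zero (2 * n + 1)
    rw [show 2 * (n + 1) = 2 * n + 2 by ring, hermiteCoeff, ih, ascPochhammer_succ_eval,
      ascPochhammer_succ_eval, Nat.factorial_succ, h4]
    push_cast
    field_simp
    ring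

theorem hermiteCoeff_odd (ν A B : ℂ) (n : ℕ) : hermiteCoeff ν A B (2 * n + 1) =
    B * ((ascPochhammer ℂ n).eval ((1 - ν) / 2) / (ascPochhammer ℂ n).eval (3 / 2)
      / (n.factorial : ℂ) * (1 / 2) ^ n) := by
  induction n with
  | zero => simp [hermiteCoeff]
  | succ n ih =>
    have h1 : (ascPochhammer ℂ n).eval (3 / 2) ≠ 0 := by
      rw [Ne, ascPochhammer_eval_eq_zero_iff]
      rintro ⟨k, -, hk⟩
      have := congrArg Complex.re hk
      norm_num at this
      have : (0 : ℝ) ≤ k := k.cast_nonneg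
      linarith
    have h2 : (2 * (n : ℂ) + 1 + 2) ≠ 0 := by exact_mod_cast Nat.succ_ne_zero (2 * n + 2)
    have h3 : ((n : ℂ) + 1) ≠ 0 := by exact_mod_cast Nat.succ_ne_zero n
    have h4 : ((3 : ℂ) / 2 + n) = (2 * n + 1 + 2) / 2 := by ring
    have h5 : (n.factorial : ℂ) ≠ 0 := by exact_mod_cast n.factorial_ne_zero
    have h6 : (2 * (n : ℂ) + 1 + 1) ≠ 0 := by exact_mod_cast Nat.succ_ne_zero (2 * n + 1)
    rw [show 2 * (n + 1) + 1 = 2 * n + 1 + 2 by ring, hermiteCoeff, ih, ascPochhammer_succ_eval,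
      ascPochhammer_succ_eval, Nat.factorial_succ, h4]
    push_cast
    field_simp
    ring

/-- `F_ν(0)`. -/
def pcfF0 (ν : ℂ) : ℂ := (2 : ℂ) ^ (ν / 2) * ((√Real.pi : ℂ) * (Complex.Gamma ((1 - ν) / 2))⁻¹)

/-- `F_ν'(0)`. -/
def pcfF1 (ν : ℂ) : ℂ :=
  -((2 : ℂ) ^ (ν / 2) * ((√(2 * Real.pi) : ℂ) * (Complex.Gamma (-ν / 2))⁻¹))

theorem hasSum_pcfF (ν z : ℂ) :
    HasSum (fun n => hermiteCoeff ν (pcfF0 ν) (pcfF1 ν) n * z ^ n) (pcfF ν z) := by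
  have h1 := (hasSum_kummerM (-ν / 2) (1 / 2) (z ^ 2 / 2) (fun n hn => by
    have := congrArg Complex.re hn
    norm_num at this
    have : (0 : ℝ) ≤ n := n.cast_nonneg
    linarith)).mul_left (pcfF0 ν)
  have h2 := (hasSum_kummerM ((1 - ν) / 2) (3 / 2) (z ^ 2 / 2) (fun n hn => by
    have := congrArg Complex.re hn
    norm_num at this
    have : (0 : ℝ) ≤ n := n.cast_nonneg
    linarith)).mul_left (pcfF1 ν * z)
  have h3 := HasSum.even_add_odd
    (f := fun n => hermiteCoeff ν (pcfF0 ν) (pcfF1 ν) n * z ^ n) (by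
      refine hasSum_of_forall_eq h1 fun n => ?_
      rw [hermiteCoeff_even, pow_mul, div_pow, div_pow]
      ring) (by
      refine hasSum_of_forall_eq h2 fun n => ?_
      rw [hermiteCoeff_odd, pow_succ, pow_mul, div_pow, div_pow]
      ring)
  convert h3 using 1
  rw [pcfF_eq, pcfF0, pcfF1]
  ring

theorem differentiable_pcfF (ν : ℂ) : Differentiable ℂ (pcfF ν) := by
  have h1 := differentiable_kummerM (-ν / 2) (1 / 2)
  have h2 := differentiable_kummerM ((1 - ν) / 2) (3 / 2)
  have h3 : pcfF ν = fun z => (2 : ℂ) ^ (ν / 2) *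
    ((√Real.pi : ℂ) * (Complex.Gamma ((1 - ν) / 2))⁻¹ * kummerM (-ν / 2) (1 / 2) (z ^ 2 / 2)
      - (√(2 * Real.pi) : ℂ) * z * (Complex.Gamma (-ν / 2))⁻¹ *
          kummerM ((1 - ν) / 2) (3 / 2) (z ^ 2 / 2)) := funext fun z => pcfF_eq ν z
  rw [h3]
  fun_prop

/-- The coefficients of an everywhere convergent power series. -/
theorem iteratedDeriv_of_hasSum {f : ℂ → ℂ} {c : ℕ → ℂ}
    (h : ∀ z, HasSum (fun n => c n * z ^ n) (f z)) (n : ℕ) :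
    iteratedDeriv n f 0 = n.factorial * c n := by
  have hf : HasFPowerSeriesOnBall f (FormalMultilinearSeries.ofScalars ℂ c) 0 ⊤ := by
    refine ⟨?_, by simp, fun {y} _ => ?_⟩
    · refine ENNReal.le_of_forall_nnreal_lt fun r _ => ?_
      refine FormalMultilinearSeries.le_radius_of_tendsto _ (l := 0) ?_
      have := ((h (r : ℂ)).summable.tendsto_atTop_zero).norm
      simpa using this
    · simpa [FormalMultilinearSeries.ofScalars_apply_eq, mul_comm] using h y
  have h2 := hf.hasFPowerSeriesAt.eq_formalMultilinearSeries
    hf.analyticAt.hasFPowerSeriesAt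
  have h3 := congrArg (fun p => p.coeff n) h2
  simp only [FormalMultilinearSeries.coeff_ofScalars] at h3
  rw [h3]
  have : (n.factorial : ℂ) ≠ 0 := by exact_mod_cast n.factorial_ne_zero
  field_simp

/-! ### Entire solutions of Hermite's equation, through their Taylor coefficients at 0 -/

theorem eq_of_iteratedDeriv_eq {f g : ℂ → ℂ} (hf : Differentiable ℂ f) (hg : Differentiable ℂ g)
    (h : ∀ n, iteratedDeriv n f 0 = iteratedDeriv n g 0) : f = g := by
  funext z
  have h1 := Complex.hasSum_taylorSeries_of_entire hf 0 z
  have h2 := Complex.hasSum_taylorSeries_of_entire hg 0 z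
  simp only [h] at h1
  exact h1.unique h2

theorem differentiable_iteratedDeriv {f : ℂ → ℂ} (hf : Differentiable ℂ f) (n : ℕ) :
    Differentiable ℂ (iteratedDeriv n f) :=
  (hf.contDiff (n := ⊤)).differentiable_iteratedDeriv n (by exact_mod_cast WithTop.coe_lt_top _)

theorem iteratedDeriv_id_mul_deriv {f : ℂ → ℂ} (hf : Differentiable ℂ f) (n : ℕ) (z : ℂ) :
    iteratedDeriv n (fun z => z * deriv f z) z =
      z * iteratedDeriv (n + 1) f z + n * iteratedDeriv n f z := by
  induction n generalizing z with
  | zero => simp [iteratedDeriv_one]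
  | succ n ih =>
    have h1 := (differentiable_iteratedDeriv hf (n + 1)) z
    have h2 := (differentiable_iteratedDeriv hf n) z
    rw [iteratedDeriv_succ, funext ih, deriv_fun_add (by fun_prop) (by fun_prop),
      deriv_fun_mul (by fun_prop) h1, deriv_const_mul _ h2, ← iteratedDeriv_succ,
      ← iteratedDeriv_succ, deriv_id'']
    push_cast
    ring

/-- `F` is an entire solution of `F'' = z F' - ν F`. -/
structure IsHermite (ν : ℂ) (F : ℂ → ℂ) : Prop where
  diff : Differentiable ℂ F
  ode : ∀ z, deriv (deriv F) z = z * deriv F z - ν * F z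

theorem IsHermite.iteratedDeriv {ν : ℂ} {F : ℂ → ℂ} (h : IsHermite ν F) (n : ℕ) :
    iteratedDeriv (n + 2) F 0 = (n - ν) * iteratedDeriv n F 0 := by
  have h1 : _root_.iteratedDeriv (n + 2) F = _root_.iteratedDeriv n (deriv (deriv F)) := by
    rw [iteratedDeriv_succ', iteratedDeriv_succ']
  have h2 : ContDiff ℂ n F := h.diff.contDiff
  have h3 : ContDiff ℂ n (deriv F) := h.diff.deriv.contDiff
  rw [h1, funext h.ode, iteratedDeriv_fun_sub (contDiff_fun_id.mul h3).contDiffAt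
      (contDiff_const.mul h2).contDiffAt,
    iteratedDeriv_id_mul_deriv h.diff, iteratedDeriv_const_mul_field]
  ring

/-- For an entire function the differential equation is equivalent to its recurrence at 0, since
both sides are entire and are determined by their derivatives there. -/
theorem isHermite_of_iteratedDeriv {ν : ℂ} {F : ℂ → ℂ} (hF : Differentiable ℂ F)
    (h : ∀ n : ℕ, iteratedDeriv (n + 2) F 0 = (n - ν) * iteratedDeriv n F 0) : IsHermite ν F := by
  refine ⟨hF, fun z => ?_⟩
  have hd := hF.deriv
  refine congrFun (eq_of_iteratedDeriv_eq (f := deriv (deriv F))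
    (g := fun z => z * deriv F z - ν * F z) hd.deriv (by fun_prop) fun n => ?_) z
  have h2 : ContDiff ℂ n F := hF.contDiff
  have h3 : ContDiff ℂ n (deriv F) := hd.contDiff
  rw [iteratedDeriv_fun_sub (contDiff_fun_id.mul h3).contDiffAt (contDiff_const.mul h2).contDiffAt,
    iteratedDeriv_id_mul_deriv hF, iteratedDeriv_const_mul_field, ← iteratedDeriv_succ',
    ← iteratedDeriv_succ', h]
  ring

theorem IsHermite.ext {ν : ℂ} {F G : ℂ → ℂ} (hF : IsHermite ν F) (hG : IsHermite ν G)
    (h0 : F 0 = G 0) (h1 : deriv F 0 = deriv G 0) : F = G := by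
  refine eq_of_iteratedDeriv_eq hF.diff hG.diff fun n => ?_
  induction n using Nat.twoStepInduction with
  | zero => simpa using h0
  | one => simpa [iteratedDeriv_one] using h1
  | more n ih _ => rw [hF.iteratedDeriv, hG.iteratedDeriv, ih]

theorem pcfF_isHermite (ν : ℂ) : IsHermite ν (pcfF ν) := by
  refine isHermite_of_iteratedDeriv (differentiable_pcfF ν) fun n => ?_
  rw [iteratedDeriv_of_hasSum (hasSum_pcfF ν), iteratedDeriv_of_hasSum (hasSum_pcfF ν),
    hermiteCoeff, Nat.factorial_succ, Nat.factorial_succ]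
  have h3 : ((n : ℂ) + 1) ≠ 0 := by exact_mod_cast Nat.succ_ne_zero n
  have h4 : ((n : ℂ) + 1 + 1) ≠ 0 := by exact_mod_cast Nat.succ_ne_zero (n + 1)
  have h5 : ((n : ℂ) + 2) ≠ 0 := by exact_mod_cast Nat.succ_ne_zero (n + 1)
  push_cast
  field_simp
  ring

theorem pcfF_zero (ν : ℂ) : pcfF ν 0 = pcfF0 ν := by
  simpa [hermiteCoeff] using iteratedDeriv_of_hasSum (hasSum_pcfF ν) 0

theorem deriv_pcfF_zero (ν : ℂ) : deriv (pcfF ν) 0 = pcfF1 ν := by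
  simpa [hermiteCoeff, iteratedDeriv_one] using iteratedDeriv_of_hasSum (hasSum_pcfF ν) 1

theorem sqrt_two_pi : (√(2 * Real.pi) : ℂ) = (2 : ℂ) ^ (1 / 2 : ℂ) * (√Real.pi : ℂ) := by
  rw [Real.sqrt_mul (by norm_num), Complex.ofReal_mul, Real.sqrt_eq_rpow 2,
    Complex.ofReal_cpow (by norm_num)]
  norm_num

theorem two_cpow_add (a b : ℂ) : (2 : ℂ) ^ (a + b) = 2 ^ a * 2 ^ b :=
  Complex.cpow_add _ _ two_ne_zero

/-- The functional equation is used for 1/Γ rather than Γ, so the identity also holds at the poles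
of Γ. -/
theorem pcfF1_eq (ν : ℂ) : pcfF1 ν = ν * pcfF0 (ν - 1) := by
  have h := Complex.one_div_Gamma_eq_self_mul_one_div_Gamma_add_one (-ν / 2)
  have h2 : (2 : ℂ) ^ (ν / 2) = 2 ^ ((ν - 1) / 2) * 2 ^ (1 / 2 : ℂ) := by
    rw [← two_cpow_add]; ring_nf
  have h3 : (2 : ℂ) ^ (1 / 2 : ℂ) * 2 ^ (1 / 2 : ℂ) = 2 := by
    rw [← two_cpow_add]; norm_num
  rw [pcfF1, pcfF0, h, h2, sqrt_two_pi, show (1 - (ν - 1)) / 2 = -ν / 2 + 1 by ring]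
  linear_combination (2 ^ ((ν - 1) / 2) * (√Real.pi : ℂ) * (ν / 2)
    * (Complex.Gamma (-ν / 2 + 1))⁻¹) * h3

theorem pcfF0_eq (ν : ℂ) : pcfF0 ν = -pcfF1 (ν - 1) := by
  have h2 : (2 : ℂ) ^ (ν / 2) = 2 ^ ((ν - 1) / 2) * 2 ^ (1 / 2 : ℂ) := by
    rw [← two_cpow_add]; ring_nf
  rw [pcfF1, pcfF0, h2, sqrt_two_pi, show (1 - ν) / 2 = -(ν - 1) / 2 by ring]
  ring

/-- Differentiating Hermite's equation lowers its index by one, so both sides solve the same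
equation and only the two initial values have to be compared. -/
theorem deriv_pcfF (ν : ℂ) : deriv (pcfF ν) = fun z => ν * pcfF (ν - 1) z := by
  have h := pcfF_isHermite ν
  have h' := pcfF_isHermite (ν - 1)
  have hd := h.diff.deriv
  refine IsHermite.ext (ν := ν - 1) ⟨hd, fun z => ?_⟩ ⟨h'.diff.const_mul ν, fun z => ?_⟩ ?_ ?_
  · rw [funext h.ode, deriv_fun_sub (by fun_prop) (h.diff.const_mul ν z),
      deriv_fun_mul (by fun_prop) (hd z), deriv_const_mul _ (h.diff z), deriv_id'', h.ode]
    ring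
  · have h1 : deriv (fun z => ν * pcfF (ν - 1) z) = fun z => ν * deriv (pcfF (ν - 1)) z :=
      funext fun z => deriv_const_mul _ (h'.diff z)
    rw [h1, deriv_const_mul _ (h'.diff.deriv z), h'.ode]
    ring
  · rw [deriv_pcfF_zero, pcfF_zero, pcfF1_eq]
  · rw [h.ode, deriv_const_mul _ (h'.diff 0), deriv_pcfF_zero, deriv_pcfF_zero, pcfF_zero,
      pcfF0_eq]
    ring

theorem hasDerivAt_pcfF (ν z : ℂ) : HasDerivAt (pcfF ν) (ν * pcfF (ν - 1) z) z := by
  have := (differentiable_pcfF ν z).hasDerivAt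
  rwa [deriv_pcfF] at this

/-- The three term recurrence. -/
theorem pcfF_add_one (ν z : ℂ) : pcfF (ν + 1) z = z * pcfF ν z - ν * pcfF (ν - 1) z := by
  have h1 : ∀ z, HasDerivAt (fun z => z * pcfF ν z - ν * pcfF (ν - 1) z)
      ((ν + 1) * pcfF ν z) z := fun z => by
    have h2 := ((hasDerivAt_id z).mul (hasDerivAt_pcfF ν z)).sub
      ((hasDerivAt_pcfF (ν - 1) z).const_mul ν)
    -- The equation at z, with both derivatives expressed by lower indices, eliminates the index ν -
    -- 2.
    have h3 := (pcfF_isHermite ν).ode z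
    have h4 : deriv (deriv (pcfF ν)) z = ν * ((ν - 1) * pcfF (ν - 1 - 1) z) := by
      rw [deriv_pcfF, deriv_const_mul _ (differentiable_pcfF _ z), deriv_pcfF]
    rw [h4, deriv_pcfF] at h3
    refine h2.congr_deriv ?_
    simp only [id]
    linear_combination -h3
  have h2 : deriv (fun z => z * pcfF ν z - ν * pcfF (ν - 1) z) = fun z => (ν + 1) * pcfF ν z :=
    funext fun z => (h1 z).deriv
  refine congrFun ((pcfF_isHermite (ν + 1)).ext
    (G := fun z => z * pcfF ν z - ν * pcfF (ν - 1) z)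
    ⟨fun z => (h1 z).differentiableAt, fun z => ?_⟩ ?_ ?_) z
  · rw [h2, deriv_const_mul _ (differentiable_pcfF _ z), deriv_pcfF]
    ring
  · simp only [pcfF_zero]
    rw [pcfF0_eq, add_sub_cancel_right, pcfF1_eq]
    ring
  · simp only [h2, deriv_pcfF_zero, pcfF_zero]
    rw [pcfF1_eq, add_sub_cancel_right]

/-! ### The connection formula -/

/-- The factor `√(2π) / Γ(-ν)`. -/
def pcfGamma (ν : ℂ) : ℂ := (√(2 * Real.pi) : ℂ) * (Complex.Gamma (-ν))⁻¹

/-- `e^{iπx}`. -/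
def cis (x : ℂ) : ℂ := Complex.exp (x * (Real.pi * Complex.I))

theorem cis_add (x y : ℂ) : cis (x + y) = cis x * cis y := by
  rw [cis, cis, cis, ← Complex.exp_add, add_mul]

theorem cis_neg_mul_self (x : ℂ) : cis (-x) * cis x = 1 := by
  rw [← cis_add]; simp [cis]

theorem cis_ne_zero (x : ℂ) : cis x ≠ 0 := Complex.exp_ne_zero _

theorem cis_one : cis 1 = -1 := by simp [cis, Complex.exp_pi_mul_I]

theorem cis_half : cis (1 / 2) = Complex.I := by
  rw [cis, show (1 / 2 : ℂ) * (Real.pi * Complex.I) = Real.pi / 2 * Complex.I by ring,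
    Complex.exp_pi_div_two_mul_I]

theorem inv_Gamma_mul_inv_Gamma_one_sub (z : ℂ) :
    (Complex.Gamma z)⁻¹ * (Complex.Gamma (1 - z))⁻¹ = Complex.sin (Real.pi * z) / Real.pi := by
  rw [← mul_inv, Complex.Gamma_mul_Gamma_one_sub, inv_div]

theorem sin_pi_mul (x : ℂ) : Complex.sin (Real.pi * x) = (cis (-x) - cis x) * Complex.I / 2 := by
  rw [Complex.sin, cis, cis]
  ring_nf

/-- Legendre's duplication formula in terms of 1/Γ, free of any condition on z. -/
theorem inv_Gamma_duplication (z : ℂ) : (Complex.Gamma (2 * z))⁻¹ * 2 ^ (2 * z - 1)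
    = (√Real.pi : ℂ) * (Complex.Gamma z)⁻¹ * (Complex.Gamma (z + 1 / 2))⁻¹ := by
  have h := Complex.Gamma_mul_Gamma_add_half z
  have h1 : (√Real.pi : ℂ) ≠ 0 := by
    exact_mod_cast (Real.sqrt_pos.2 Real.pi_pos).ne'
  have h2 : (2 : ℂ) ^ (1 - 2 * z) * 2 ^ (2 * z - 1) = 1 := by
    rw [← two_cpow_add]; simp
  have h3 : (2 : ℂ) ^ (1 - 2 * z) ≠ 0 := left_ne_zero_of_mul_eq_one h2
  rw [mul_assoc, ← mul_inv, h, mul_inv, mul_inv]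
  rw [← eq_inv_of_mul_eq_one_right h2]
  field_simp

/-- This is the connection formula at z = 0. Duplication splits 1/Γ(-ν) into two factors; reflection
combines one of them with the factor in `pcfF0 (-ν - 1)` into a sine. -/
theorem pcfGamma_mul_pcfF0 (ν : ℂ) :
    pcfGamma ν * cis ((ν + 1) / 2) * pcfF0 (-ν - 1) = (1 - cis ν) * pcfF0 ν := by
  have h1 := inv_Gamma_duplication (-ν / 2)
  rw [show 2 * (-ν / 2) = -ν by ring, show -ν / 2 + 1 / 2 = (1 - ν) / 2 by ring] at h1
  have h2 := inv_Gamma_mul_inv_Gamma_one_sub (-ν / 2)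
  rw [sin_pi_mul, show 1 - -ν / 2 = (1 - (-ν - 1)) / 2 by ring,
    show -(-ν / 2) = ν / 2 by ring] at h2
  have h3 : cis ((ν + 1) / 2) = cis (ν / 2) * Complex.I := by
    rw [← cis_half, ← cis_add]; ring_nf
  have h4 : cis (-ν / 2) * cis (ν / 2) = 1 := by rw [← cis_add]; ring_nf; simp [cis]
  have h5 : cis ν = cis (ν / 2) * cis (ν / 2) := by rw [← cis_add]; ring_nf
  have h6 : (2 : ℂ) ^ ((-ν - 1) / 2) * 2 ^ (1 / 2 : ℂ) = 2 ^ (-ν - 1) * 2 * 2 ^ (ν / 2) := by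
    have h7 : (2 : ℂ) ^ (-ν - 1) * 2 = 2 ^ (-ν) := by
      have := two_cpow_add (-ν - 1) 1
      rw [Complex.cpow_one] at this
      rw [← this, sub_add_cancel]
    rw [h7, ← two_cpow_add, ← two_cpow_add]
    ring_nf
  have h7 : (Real.pi : ℂ) ≠ 0 := by exact_mod_cast Real.pi_ne_zero
  have h8 : (√Real.pi : ℂ) * (√Real.pi : ℂ) = Real.pi := by
    exact_mod_cast Real.mul_self_sqrt Real.pi_pos.le
  have hI := Complex.I_mul_I
  rw [pcfGamma, pcfF0, pcfF0, sqrt_two_pi, h3]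
  set G1 := (Complex.Gamma (-ν))⁻¹
  set G2 := (Complex.Gamma ((1 - (-ν - 1)) / 2))⁻¹
  set G3 := (Complex.Gamma ((1 - ν) / 2))⁻¹
  set G4 := (Complex.Gamma (-ν / 2))⁻¹
  have h9 : G4 * G2 * Real.pi = (cis (ν / 2) - cis (-ν / 2)) * Complex.I / 2 := by
    rw [h2]; field_simp
  calc _ = ((2 : ℂ) ^ ((-ν - 1) / 2) * 2 ^ (1 / 2 : ℂ)) * (√Real.pi * √Real.pi) * G1 *
        (cis (ν / 2) * Complex.I) * G2 := by ring
    _ = (G1 * 2 ^ (-ν - 1)) * (2 * 2 ^ (ν / 2)) * (√Real.pi * √Real.pi) *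
        (cis (ν / 2) * Complex.I) * G2 := by rw [h6]; ring
    _ = (√Real.pi * G3) * (2 * 2 ^ (ν / 2)) * (G4 * G2 * Real.pi) *
        (cis (ν / 2) * Complex.I) := by rw [h1, h8]; ring
    _ = _ := by
      rw [h9, h5]
      linear_combination (√Real.pi * G3 * 2 ^ (ν / 2) * (cis (ν / 2) ^ 2 -
        cis (-ν / 2) * cis (ν / 2))) * hI + (√Real.pi * G3 * 2 ^ (ν / 2)) * h4

theorem mul_pcfGamma_sub_one (ν : ℂ) : ν * pcfGamma (ν - 1) = -pcfGamma ν := by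
  have h := Complex.one_div_Gamma_eq_self_mul_one_div_Gamma_add_one (-ν)
  rw [pcfGamma, pcfGamma, h, show -(ν - 1) = -ν + 1 by ring]
  ring

/-- The derivative of the connection formula at z = 0. It reduces to `pcfGamma_mul_pcfF0` at index ν
- 1, because derivatives at 0 are values at the neighbouring index. -/
theorem pcfGamma_mul_pcfF1 (ν : ℂ) :
    pcfGamma ν * cis ((ν + 1) / 2) * (-Complex.I * pcfF1 (-ν - 1)) = (1 + cis ν) * pcfF1 ν := by
  have h1 := pcfGamma_mul_pcfF0 (ν - 1)
  have h2 := mul_pcfGamma_sub_one ν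
  have h3 : cis ((ν + 1) / 2) = cis (ν / 2) * Complex.I := by
    rw [← cis_half, ← cis_add]; ring_nf
  have h4 : cis (ν - 1) = -cis ν := by
    have := cis_add (ν - 1) 1
    rw [sub_add_cancel, cis_one] at this
    linear_combination this
  rw [sub_add_cancel, h4, show -(ν - 1) - 1 = -ν by ring, pcfF0_eq (-ν)] at h1
  rw [pcfF1_eq ν, h3]
  linear_combination ν * h1 + cis (ν / 2) * pcfF1 (-ν - 1) * h2 -
    pcfGamma ν * cis (ν / 2) * pcfF1 (-ν - 1) * Complex.I_mul_I

theorem IsHermite.add {ν : ℂ} {F G : ℂ → ℂ} (hF : IsHermite ν F) (hG : IsHermite ν G) (a b : ℂ) :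
    IsHermite ν fun z => a * F z + b * G z := by
  have hFd := hF.diff
  have hGd := hG.diff
  have hF' := hFd.deriv
  have hG' := hGd.deriv
  have h1 : deriv (fun z => a * F z + b * G z) = fun z => a * deriv F z + b * deriv G z :=
    funext fun z => by
      rw [deriv_fun_add (by fun_prop) (by fun_prop), deriv_const_mul _ (hFd z),
        deriv_const_mul _ (hGd z)]
  refine ⟨by fun_prop, fun z => ?_⟩
  rw [h1, deriv_fun_add (by fun_prop) (by fun_prop), deriv_const_mul _ (hF' z),
    deriv_const_mul _ (hG' z), hF.ode, hG.ode]
  ring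

theorem pcfF_neg_isHermite (ν : ℂ) : IsHermite ν fun z => pcfF ν (-z) := by
  have h := pcfF_isHermite ν
  have hd := h.diff
  refine ⟨by fun_prop, fun z => ?_⟩
  have h1 : deriv (fun z => pcfF ν (-z)) = fun z => -deriv (pcfF ν) (-z) :=
    funext fun z => deriv_comp_neg (pcfF ν) z
  rw [h1, deriv.fun_neg, deriv_comp_neg (deriv (pcfF ν)), h.ode]
  ring

theorem hasDerivAt_exp_mul_pcfF (ν z : ℂ) :
    HasDerivAt (fun z => Complex.exp (z ^ 2 / 2) * pcfF (-ν - 1) (-Complex.I * z))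
      (z * (Complex.exp (z ^ 2 / 2) * pcfF (-ν - 1) (-Complex.I * z)) -
        Complex.I * (Complex.exp (z ^ 2 / 2) * deriv (pcfF (-ν - 1)) (-Complex.I * z))) z := by
  have h1 : HasDerivAt (fun z : ℂ => -Complex.I * z) (-Complex.I) z := by
    simpa using (hasDerivAt_id z).const_mul (-Complex.I)
  have h2 := ((differentiable_pcfF (-ν - 1)) (-Complex.I * z)).hasDerivAt.comp z h1
  have h3 : HasDerivAt (fun z : ℂ => Complex.exp (z ^ 2 / 2)) (Complex.exp (z ^ 2 / 2) * z) z := by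
    have := (((hasDerivAt_id z).pow 2).div_const 2).cexp
    simpa using this
  refine (h3.mul h2).congr_deriv ?_
  simp only [Function.comp]
  ring

/-- Weber's equation is invariant under z ↦ -iz with ν ↦ -ν - 1; the factor e^{z²/2} converts the
Gaussian prefactor of the rotated function. -/
theorem exp_mul_pcfF_isHermite (ν : ℂ) :
    IsHermite ν fun z => Complex.exp (z ^ 2 / 2) * pcfF (-ν - 1) (-Complex.I * z) := by
  have h := pcfF_isHermite (-ν - 1)
  refine ⟨fun z => (hasDerivAt_exp_mul_pcfF ν z).differentiableAt, fun z => ?_⟩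
  have h1 : deriv (fun z => Complex.exp (z ^ 2 / 2) * pcfF (-ν - 1) (-Complex.I * z)) = fun z =>
      z * (Complex.exp (z ^ 2 / 2) * pcfF (-ν - 1) (-Complex.I * z)) - Complex.I *
        (Complex.exp (z ^ 2 / 2) * deriv (pcfF (-ν - 1)) (-Complex.I * z)) :=
    funext fun z => (hasDerivAt_exp_mul_pcfF ν z).deriv
  have h2 : HasDerivAt (fun z : ℂ => -Complex.I * z) (-Complex.I) z := by
    simpa using (hasDerivAt_id z).const_mul (-Complex.I)
  have h3 := (h.diff.deriv (-Complex.I * z)).hasDerivAt.comp z h2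
  have h4 : HasDerivAt (fun z : ℂ => Complex.exp (z ^ 2 / 2)) (Complex.exp (z ^ 2 / 2) * z) z := by
    have := (((hasDerivAt_id z).pow 2).div_const 2).cexp
    simpa using this
  have h5 := ((hasDerivAt_id z).mul (hasDerivAt_exp_mul_pcfF ν z)).sub
    ((h4.mul h3).const_mul Complex.I)
  rw [h1]
  refine h5.deriv.trans ?_
  simp only [Function.comp, id, h.ode]
  linear_combination (Complex.exp (z ^ 2 / 2) * (-ν - 1) * pcfF (-ν - 1) (-Complex.I * z) * (-1)
    - Complex.exp (z ^ 2 / 2) * Complex.I * z * deriv (pcfF (-ν - 1)) (-Complex.I * z))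
      * Complex.I_mul_I

/-- The connection formula between the solutions recessive at `+∞`, `-∞` and `+i∞`. -/
theorem pcfF_connection (ν z : ℂ) : pcfF ν z = cis ν * pcfF ν (-z) +
    pcfGamma ν * cis ((ν + 1) / 2) *
      (Complex.exp (z ^ 2 / 2) * pcfF (-ν - 1) (-Complex.I * z)) := by
  refine congrFun ((pcfF_isHermite ν).ext
    ((pcfF_neg_isHermite ν).add (exp_mul_pcfF_isHermite ν) _ _) ?_ ?_) z
  · have := pcfGamma_mul_pcfF0 ν
    simp only [neg_zero, pcfF_zero, mul_zero]
    norm_num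
    linear_combination -this
  · have h1 := pcfGamma_mul_pcfF1 ν
    have h2 := (hasDerivAt_exp_mul_pcfF ν 0).deriv
    have h3 : deriv (fun z => pcfF ν (-z)) 0 = -pcfF1 ν := by
      rw [deriv_comp_neg (pcfF ν), neg_zero, deriv_pcfF_zero]
    rw [deriv_fun_add (((pcfF_neg_isHermite ν).diff 0).const_mul _)
      (((exp_mul_pcfF_isHermite ν).diff 0).const_mul _),
      deriv_const_mul _ ((pcfF_neg_isHermite ν).diff 0),
      deriv_const_mul _ ((exp_mul_pcfF_isHermite ν).diff 0), h2, h3, deriv_pcfF_zero]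
    simp only [mul_zero, deriv_pcfF_zero]
    norm_num
    linear_combination -h1

end PIV

namespace PIV
open MeasureTheory

/-! ### Integral representation -/

theorem integrableOn_rpow_mul_exp {a b : ℝ} (ha : 0 < a) (hb : 0 < b) :
    IntegrableOn (fun t : ℝ => t ^ (a - 1) * Real.exp (-b * t)) (Set.Ioi 0) := by
  simpa using integrableOn_rpow_mul_exp_neg_mul_rpow (p := 1) (s := a - 1) (by linarith)
    one_pos hb

theorem norm_rpow_mul_cexp {a t : ℝ} (ht : 0 < t) (y : ℂ) :
    ‖((t ^ a : ℝ) : ℂ) * Complex.exp (-(y * t))‖ = t ^ a * Real.exp (-y.re * t) := by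
  rw [norm_mul, Complex.norm_real, Real.norm_of_nonneg (Real.rpow_nonneg ht.le _),
    Complex.norm_exp]
  simp

theorem aestronglyMeasurable_rpow_mul (a : ℝ) {g : ℝ → ℂ} (hg : Continuous g) :
    AEStronglyMeasurable (fun t : ℝ => ((t ^ a : ℝ) : ℂ) * g t)
      (volume.restrict (Set.Ioi 0)) := by
  refine ContinuousOn.aestronglyMeasurable (fun t ht => ?_) measurableSet_Ioi
  have : ContinuousAt (fun t : ℝ => ((t ^ a : ℝ) : ℂ)) t :=
    Complex.continuous_ofReal.continuousAt.comp
      (Real.continuousAt_rpow_const _ _ (Or.inl (ne_of_gt ht)))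
  exact (this.mul hg.continuousAt).continuousWithinAt

theorem integrableOn_rpow_mul_cexp {a : ℝ} {y : ℂ} (ha : 0 < a) (hy : 0 < y.re) :
    IntegrableOn (fun t : ℝ => ((t ^ (a - 1) : ℝ) : ℂ) * Complex.exp (-(y * t))) (Set.Ioi 0) := by
  refine (integrableOn_rpow_mul_exp ha hy).mono'
    (aestronglyMeasurable_rpow_mul _ (by fun_prop)) ?_
  filter_upwards [ae_restrict_mem measurableSet_Ioi] with t ht
  rw [norm_rpow_mul_cexp ht]

theorem differentiableAt_integral_rpow_mul_cexp {a : ℝ} {y : ℂ} (ha : 0 < a) (hy : 0 < y.re) :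
    DifferentiableAt ℂ (fun y : ℂ => ∫ t : ℝ in Set.Ioi 0,
      ((t ^ (a - 1) : ℝ) : ℂ) * Complex.exp (-(y * t))) y := by
  -- On this half-plane the decay rate stays above Re y / 2, which supplies one integrable bound for
  -- all derivatives.
  have hs : {w : ℂ | y.re / 2 < w.re} ∈ 𝓝 y :=
    (isOpen_lt continuous_const Complex.continuous_re).mem_nhds (by
      simp only [Set.mem_ofPred_eq]; linarith)
  refine (hasDerivAt_integral_of_dominated_loc_of_deriv_le (μ := volume.restrict (Set.Ioi 0))
    (F := fun (y : ℂ) (t : ℝ) => ((t ^ (a - 1) : ℝ) : ℂ) * Complex.exp (-(y * t)))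
    (F' := fun (y : ℂ) (t : ℝ) => ((t ^ (a - 1) : ℝ) : ℂ) * (Complex.exp (-(y * t)) * -t))
    (bound := fun t => t ^ (a + 1 - 1) * Real.exp (-(y.re / 2) * t)) hs
    (.of_forall fun w => aestronglyMeasurable_rpow_mul _ (by fun_prop))
    (integrableOn_rpow_mul_cexp ha hy) (aestronglyMeasurable_rpow_mul _ (by fun_prop)) ?_
    (integrableOn_rpow_mul_exp (by linarith) (by linarith)) ?_).2.differentiableAt
  · filter_upwards [ae_restrict_mem measurableSet_Ioi] with t ht w hw
    have ht' : (0 : ℝ) < t := ht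
    rw [← mul_assoc, norm_mul, norm_rpow_mul_cexp ht, norm_neg, Complex.norm_real,
      Real.norm_of_nonneg ht'.le, show a + 1 - 1 = a - 1 + 1 by ring, Real.rpow_add_one ht'.ne']
    have h1 : Real.exp (-w.re * t) ≤ Real.exp (-(y.re / 2) * t) := by
      apply Real.exp_le_exp.2
      have hw' : y.re / 2 < w.re := hw
      nlinarith
    have h2 : 0 ≤ t ^ (a - 1) := Real.rpow_nonneg ht'.le _
    calc _ = t ^ (a - 1) * t * Real.exp (-w.re * t) := by ring
      _ ≤ _ := by gcongr
  · refine .of_forall fun t w _ => ?_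
    have : HasDerivAt (fun y : ℂ => -(y * (t : ℂ))) (-(t : ℂ)) w := by
      simpa using ((hasDerivAt_id w).mul_const (t : ℂ)).fun_neg
    exact this.cexp.const_mul _

/-- Euler's integral with a complex rate. -/
theorem integral_rpow_mul_cexp {a : ℝ} {y : ℂ} (ha : 0 < a) (hy : 0 < y.re) :
    ∫ t : ℝ in Set.Ioi 0, ((t ^ (a - 1) : ℝ) : ℂ) * Complex.exp (-(y * t)) =
      y ^ (-a : ℂ) * Complex.Gamma a := by
  set U : Set ℂ := {w | 0 < w.re}
  have hU : IsOpen U := isOpen_lt continuous_const Complex.continuous_re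
  have h1 : AnalyticOnNhd ℂ (fun y : ℂ => ∫ t : ℝ in Set.Ioi 0,
      ((t ^ (a - 1) : ℝ) : ℂ) * Complex.exp (-(y * t))) U :=
    DifferentiableOn.analyticOnNhd (fun w hw =>
      (differentiableAt_integral_rpow_mul_cexp ha hw).differentiableWithinAt) hU
  have h2 : AnalyticOnNhd ℂ (fun y : ℂ => y ^ (-a : ℂ) * Complex.Gamma a) U :=
    DifferentiableOn.analyticOnNhd (fun w hw => (DifferentiableAt.mul_const
      (differentiableAt_id.cpow_const (Or.inl hw)) _).differentiableWithinAt) hU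
  have hc : IsPreconnected U := (convex_halfSpace_re_gt 0).isPreconnected
  have h3 : ∀ r : ℝ, 0 < r → (∫ t : ℝ in Set.Ioi 0,
      ((t ^ (a - 1) : ℝ) : ℂ) * Complex.exp (-((r : ℂ) * t))) =
        (r : ℂ) ^ (-a : ℂ) * Complex.Gamma a := fun r hr => by
    have := Complex.integral_cpow_mul_exp_neg_mul_Ioi (a := a) (by simpa using ha) hr
    rw [one_div, Complex.inv_cpow _ _ (by
      rw [Complex.arg_ofReal_of_nonneg hr.le]; exact Real.pi_ne_zero.symm), ← Complex.cpow_neg]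
      at this
    rw [← this]
    refine setIntegral_congr_fun measurableSet_Ioi fun t ht => ?_
    rw [Complex.ofReal_cpow (le_of_lt ht)]
    simp
  -- Identity theorem: both sides are analytic in the right half-plane and agree on the positive
  -- reals, which accumulate at 1.
  refine h1.eqOn_of_preconnected_of_frequently_eq h2 hc (z₀ := ((1 : ℝ) : ℂ)) (by simp [U]) ?_ hy
  have h4 : Tendsto (fun r : ℝ => (r : ℂ)) (𝓝[≠] 1) (𝓝[≠] ((1 : ℝ) : ℂ)) :=
    tendsto_nhdsWithin_iff.2 ⟨(Complex.continuous_ofReal.tendsto 1).mono_left nhdsWithin_le_nhds,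
      eventually_nhdsWithin_of_forall fun r hr => by simpa using hr⟩
  refine h4.frequently (Eventually.frequently ?_)
  filter_upwards [nhdsWithin_le_nhds (lt_mem_nhds one_pos)] with r hr
  exact h3 r hr

theorem integral_rpow_mul_cexp_sq {b : ℝ} {w : ℂ} (hb : 0 < b) (hw : 0 < w.re) :
    ∫ t : ℝ in Set.Ioi 0, ((t ^ (b - 1) : ℝ) : ℂ) * Complex.exp (-(w * t ^ 2)) =
      w ^ (-(b / 2 : ℝ) : ℂ) * Complex.Gamma (b / 2 : ℝ) / 2 := by
  rw [← integral_rpow_mul_cexp (half_pos hb) hw, ← integral_comp_rpow_Ioi_of_pos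
    (g := fun t : ℝ => ((t ^ (b / 2 - 1) : ℝ) : ℂ) * Complex.exp (-(w * t))) two_pos,
    ← integral_div]
  refine setIntegral_congr_fun measurableSet_Ioi fun t ht => ?_
  have ht' : (0 : ℝ) < t := ht
  have h1 : t ^ (b - 1) = t * (t ^ (2 : ℝ)) ^ (b / 2 - 1) := by
    rw [← Real.rpow_mul ht'.le]
    nth_rewrite 2 [← Real.rpow_one t]
    rw [← Real.rpow_add ht']
    ring_nf
  rw [h1, show (2 : ℝ) - 1 = 1 by norm_num, Real.rpow_one, Real.rpow_two, Complex.real_smul]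
  push_cast
  ring

theorem integrableOn_rpow_mul_exp_sq {a b : ℝ} (ha : 0 < a) (hb : 0 < b) (c : ℝ) :
    IntegrableOn (fun t : ℝ => t ^ (a - 1) * Real.exp (-b * t ^ 2) * Real.exp (c * t))
      (Set.Ioi 0) := by
  have h1 := (integrableOn_rpow_mul_exp_neg_mul_sq (b := b / 2) (by linarith) (s := a - 1)
    (by linarith)).const_mul (Real.exp (c ^ 2 / (2 * b)))
  refine h1.mono' ?_ ?_
  · refine ContinuousOn.aestronglyMeasurable (fun t ht => ?_) measurableSet_Ioi
    have : ContinuousAt (fun t : ℝ => t ^ (a - 1)) t :=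
      Real.continuousAt_rpow_const _ _ (Or.inl (ne_of_gt ht))
    refine ContinuousAt.continuousWithinAt ?_
    fun_prop
  · filter_upwards [ae_restrict_mem measurableSet_Ioi] with t ht
    have h2 : 0 ≤ t ^ (a - 1) := Real.rpow_nonneg (le_of_lt ht) _
    rw [Real.norm_of_nonneg (by positivity), mul_assoc, ← Real.exp_add, mul_left_comm,
      ← Real.exp_add]
    refine mul_le_mul_of_nonneg_left (Real.exp_le_exp.2 ?_) h2
    -- Completing the square lets half of the Gaussian absorb the factor e^{ct}.
    have h3 : c ^ 2 / (2 * b) - c * t + b / 2 * t ^ 2 = (c - b * t) ^ 2 / (2 * b) := by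
      field_simp
      ring
    have h4 : 0 ≤ (c - b * t) ^ 2 / (2 * b) := by positivity
    linarith

/-- Expand e^{-yt} and integrate term by term; the absolute series sums to e^{‖y‖t}, still
integrable against the Gaussian. -/
theorem hasSum_integral_rpow_mul_cexp_sq {a : ℝ} {w : ℂ} (ha : 0 < a) (hw : 0 < w.re) (y : ℂ) :
    HasSum (fun n : ℕ => (-y) ^ n / (n.factorial : ℂ) *
        (w ^ (-((a + n) / 2 : ℝ) : ℂ) * Complex.Gamma ((a + n) / 2 : ℝ) / 2))
      (∫ t : ℝ in Set.Ioi 0, ((t ^ (a - 1) : ℝ) : ℂ) *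
        (Complex.exp (-(y * t)) * Complex.exp (-(w * t ^ 2)))) := by
  have h := hasSum_integral_of_dominated_convergence (μ := volume.restrict (Set.Ioi 0))
    (F := fun (n : ℕ) (t : ℝ) => ((t ^ (a - 1) : ℝ) : ℂ) *
      (((-(y * t)) ^ n / (n.factorial : ℂ)) * Complex.exp (-(w * t ^ 2))))
    (f := fun t : ℝ => ((t ^ (a - 1) : ℝ) : ℂ) *
        (Complex.exp (-(y * t)) * Complex.exp (-(w * t ^ 2))))
    (fun n t => t ^ (a - 1) * Real.exp (-w.re * t ^ 2) * ((‖y‖ * t) ^ n / n.factorial))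
    (fun n => aestronglyMeasurable_rpow_mul _ (by fun_prop)) ?_ ?_ ?_ ?_
  · refine hasSum_of_forall_eq h fun n => ?_
    rw [← integral_rpow_mul_cexp_sq (by positivity) hw, ← integral_const_mul]
    refine setIntegral_congr_fun measurableSet_Ioi fun t ht => ?_
    have ht' : (0 : ℝ) < t := ht
    have h1 : t ^ (a + n - 1) = t ^ (a - 1) * t ^ n := by
      rw [← Real.rpow_natCast, ← Real.rpow_add ht']; ring_nf
    rw [h1, ← neg_mul y, mul_pow]
    push_cast
    ring
  · intro n
    filter_upwards [ae_restrict_mem measurableSet_Ioi] with t ht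
    have ht' : (0 : ℝ) < t := ht
    have h1 : ((w * (t : ℂ) ^ 2)).re = w.re * t ^ 2 := by
      rw [← Complex.ofReal_pow, Complex.re_mul_ofReal]
    rw [norm_mul, norm_mul, Complex.norm_exp, Complex.norm_real,
      Real.norm_of_nonneg (Real.rpow_nonneg ht'.le _), norm_div, norm_pow, norm_neg, norm_mul,
      Complex.norm_real, Real.norm_of_nonneg ht'.le, Complex.norm_natCast, Complex.neg_re, h1,
      ← neg_mul]
    exact le_of_eq (by ring)
  · refine .of_forall fun t => ?_
    exact (Real.summable_pow_div_factorial _).mul_left _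
  · refine (integrableOn_rpow_mul_exp_sq ha hw ‖y‖).congr (.of_forall fun t => ?_)
    simp only
    rw [tsum_mul_left, Real.exp_eq_exp_ℝ, NormedSpace.exp_eq_tsum_div]
  · refine .of_forall fun t => ?_
    have := NormedSpace.expSeries_div_hasSum_exp (𝔸 := ℂ) (-(y * t))
    rw [← Complex.exp_eq_exp_ℂ] at this
    exact (this.mul_right _).mul_left _

/-- The even and odd Taylor coefficients of the rotated Laplace integral of `D_{-a}`. -/
theorem hermiteCoeff_eq_Gamma {a : ℝ} (ha : 0 < a) (n : ℕ) :
    hermiteCoeff (-a) (pcfF0 (-a)) (pcfF1 (-a)) n * (2 : ℂ) ^ ((n : ℂ) / 2) =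
      (2 : ℂ) ^ ((a : ℂ) / 2) / (2 * Complex.Gamma a) * ((-1) ^ n / (n.factorial : ℂ) * 2 ^ n *
        Complex.Gamma ((a + n) / 2 : ℝ)) := by
  have hG : ∀ x : ℝ, 0 < x → Complex.Gamma x ≠ 0 := fun x hx =>
    Complex.Gamma_ne_zero_of_re_pos (by simpa using hx)
  have h2 := inv_Gamma_duplication (a / 2)
  have hp : (√Real.pi : ℂ) ≠ 0 := by
    exact_mod_cast (Real.sqrt_pos.2 Real.pi_pos).ne'
  rw [show 2 * (a / 2 : ℂ) = a by ring, show (a : ℂ) / 2 + 1 / 2 = (1 + a) / 2 by ring] at h2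
  have h3 : (2 : ℂ) ^ ((a : ℂ) - 1) * 2 ^ (-(a : ℂ) / 2) = 2 ^ ((a : ℂ) / 2) / 2 := by
    have := two_cpow_add (-1) ((a : ℂ) / 2)
    rw [Complex.cpow_neg_one] at this
    calc _ = (2 : ℂ) ^ (-1 + (a : ℂ) / 2) := by rw [← two_cpow_add]; ring_nf
      _ = _ := by rw [this]; ring
  have hGa := hG a ha
  have hG1 : Complex.Gamma ((a : ℂ) / 2) ≠ 0 := by simpa using hG (a / 2) (by linarith)
  have hG2 : Complex.Gamma ((1 + (a : ℂ)) / 2) ≠ 0 := by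
    simpa using hG ((1 + a) / 2) (by linarith)
  induction n using Nat.twoStepInduction with
  | zero =>
    simp only [hermiteCoeff, pcfF0, Nat.cast_zero, zero_div, Complex.cpow_zero, mul_one, pow_zero,
      Nat.factorial_zero, Nat.cast_one, div_one, one_mul, add_zero, sub_neg_eq_add]
    push_cast
    have h4 : (√Real.pi : ℂ) * (Complex.Gamma ((1 + (a : ℂ)) / 2))⁻¹ =
        Complex.Gamma ((a : ℂ) / 2) * ((Complex.Gamma a)⁻¹ * 2 ^ ((a : ℂ) - 1)) := by
      rw [h2]; field_simp
    rw [h4]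
    linear_combination (Complex.Gamma ((a : ℂ) / 2) * (Complex.Gamma a)⁻¹) * h3
  | one =>
    simp only [hermiteCoeff, pcfF1, Nat.cast_one, pow_one, Nat.factorial_one, div_one, neg_neg]
    push_cast
    have h4 : (√Real.pi : ℂ) * (Complex.Gamma ((a : ℂ) / 2))⁻¹ =
        Complex.Gamma ((1 + (a : ℂ)) / 2) * ((Complex.Gamma a)⁻¹ * 2 ^ ((a : ℂ) - 1)) := by
      rw [h2]; field_simp
    have h5 : (2 : ℂ) ^ (1 / 2 : ℂ) * 2 ^ (1 / 2 : ℂ) = 2 := by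
      rw [← two_cpow_add]; norm_num
    rw [sqrt_two_pi, mul_assoc ((2 : ℂ) ^ (1 / 2 : ℂ)), h4, add_comm (a : ℂ) 1]
    linear_combination (-2 * Complex.Gamma ((1 + (a : ℂ)) / 2) * (Complex.Gamma a)⁻¹) * h3
      - 2 ^ (-(a : ℂ) / 2) * Complex.Gamma ((1 + (a : ℂ)) / 2) *
        ((Complex.Gamma a)⁻¹ * 2 ^ ((a : ℂ) - 1)) * h5
  | more n ih _ =>
    have h6 : (2 : ℂ) ^ (((n + 2 : ℕ) : ℂ) / 2) = 2 ^ ((n : ℂ) / 2) * 2 := by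
      rw [show ((n + 2 : ℕ) : ℂ) / 2 = (n : ℂ) / 2 + 1 by push_cast; ring, two_cpow_add,
        Complex.cpow_one]
    have h7 : Complex.Gamma ((a + (n + 2 : ℕ)) / 2 : ℝ) =
        ((a + n) / 2) * Complex.Gamma ((a + n) / 2 : ℝ) := by
      have := Complex.Gamma_add_one ((a + n) / 2 : ℝ) (by
        exact_mod_cast (by positivity : (a + n) / 2 ≠ 0))
      rw [show (((a + (n + 2 : ℕ)) / 2 : ℝ) : ℂ) = ((a + n) / 2 : ℝ) + 1 by push_cast; ring, this]
      push_cast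
      ring
    have h8 : ((n : ℂ) + 1) ≠ 0 := by exact_mod_cast Nat.succ_ne_zero n
    have h9 : ((n : ℂ) + 1 + 1) ≠ 0 := by exact_mod_cast Nat.succ_ne_zero (n + 1)
    have h10 : ((n : ℂ) + 2) ≠ 0 := by exact_mod_cast Nat.succ_ne_zero (n + 1)
    have h11 : (n.factorial : ℂ) ≠ 0 := by exact_mod_cast n.factorial_ne_zero
    rw [hermiteCoeff, h6, h7, Nat.factorial_succ, Nat.factorial_succ]
    have : ((n : ℂ) - -(a : ℂ)) / ((n + 1) * (n + 2)) *
        hermiteCoeff (-a) (pcfF0 (-a)) (pcfF1 (-a)) n * (2 ^ ((n : ℂ) / 2) * 2) =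
        ((n : ℂ) + a) * 2 / ((n + 1) * (n + 2)) *
        (hermiteCoeff (-a) (pcfF0 (-a)) (pcfF1 (-a)) n * 2 ^ ((n : ℂ) / 2)) := by ring
    rw [this, ih]
    push_cast
    field_simp
    ring

/-- The Laplace integral for `D_{-a}`, along a ray. -/
theorem pcfF_eq_integral {a : ℝ} (ha : 0 < a) {θ : ℝ} (h1 : -(Real.pi / 4) < θ)
    (h2 : θ < Real.pi / 4) (ζ : ℂ) :
    pcfF (-a) ((√2 : ℝ) * ζ) = (2 : ℂ) ^ (-(a : ℂ) / 2) / Complex.Gamma a *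
      Complex.exp (θ * Complex.I * a) * ∫ t : ℝ in Set.Ioi 0, ((t ^ (a - 1) : ℝ) : ℂ) *
        (Complex.exp (-(ζ * Complex.exp (θ * Complex.I) * t)) *
          Complex.exp (-(Complex.exp (θ * Complex.I) ^ 2 / 4 * t ^ 2))) := by
  have hw : 0 < (Complex.exp (θ * Complex.I) ^ 2 / 4).re := by
    rw [← Complex.exp_nat_mul, show ((2 : ℕ) : ℂ) * (θ * Complex.I) = (2 * θ : ℝ) * Complex.I by
      push_cast; ring]
    have : 0 < Real.cos (2 * θ) := Real.cos_pos_of_mem_Ioo ⟨by linarith, by linarith⟩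
    have h4 : (Complex.exp ((2 * θ : ℝ) * Complex.I) / 4).re = Real.cos (2 * θ) / 4 := by
      rw [show (4 : ℂ) = ((4 : ℝ) : ℂ) by norm_num, Complex.div_ofReal_re,
        Complex.exp_ofReal_mul_I_re]
    rw [h4]
    positivity
  have h3 := (hasSum_integral_rpow_mul_cexp_sq ha hw (ζ * Complex.exp (θ * Complex.I))).mul_left
    ((2 : ℂ) ^ (-(a : ℂ) / 2) / Complex.Gamma a * Complex.exp (θ * Complex.I * a))
  refine (hasSum_pcfF (-a) ((√2 : ℝ) * ζ)).unique (hasSum_of_forall_eq h3 fun n => ?_)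
  have h4 : ((√2 : ℝ) : ℂ) ^ n = (2 : ℂ) ^ ((n : ℂ) / 2) := by
    rw [Real.sqrt_eq_rpow, Complex.ofReal_cpow (by norm_num), ← Complex.cpow_nat_mul]
    push_cast
    ring_nf
  -- The principal logarithm of e^{2iθ}/4 has imaginary part 2θ, since |2θ| < π/2.
  have h5 : (Complex.exp (θ * Complex.I) ^ 2 / 4) ^ (-((a + n) / 2 : ℝ) : ℂ) =
      (2 : ℂ) ^ (a : ℂ) * 2 ^ n * Complex.exp (-(θ * Complex.I * (a + n))) := by
    have hl : Complex.exp (Real.log 2) = 2 := by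
      rw [← Complex.ofReal_exp, Real.exp_log two_pos]; norm_num
    have hb : Complex.exp (θ * Complex.I) ^ 2 / 4 =
        Complex.exp ((-2 * Real.log 2 : ℝ) + (2 * θ : ℝ) * Complex.I) := by
      rw [Complex.exp_add, ← Complex.exp_nat_mul, show ((-2 * Real.log 2 : ℝ) : ℂ) =
        -(Real.log 2 + Real.log 2) by push_cast; ring, Complex.exp_neg, Complex.exp_add, hl]
      push_cast
      ring_nf
    have him : (((-2 * Real.log 2 : ℝ) : ℂ) + (2 * θ : ℝ) * Complex.I).im = 2 * θ := by
      simp only [Complex.add_im, Complex.ofReal_im, Complex.im_ofReal_mul, Complex.I_im]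
      ring
    have hlog2 : Complex.log 2 = Real.log 2 := by
      rw [Complex.ofReal_log two_pos.le]; norm_num
    rw [Complex.cpow_def_of_ne_zero (by rw [hb]; exact Complex.exp_ne_zero _), hb, Complex.log_exp
      (by rw [him]; linarith) (by rw [him]; linarith), ← Complex.cpow_natCast (2 : ℂ) n,
      Complex.cpow_def_of_ne_zero two_ne_zero, Complex.cpow_def_of_ne_zero two_ne_zero, hlog2,
      ← Complex.exp_add, ← Complex.exp_add]
    congr 1
    push_cast
    ring
  have h6 := hermiteCoeff_eq_Gamma ha n
  rw [mul_pow, ← mul_assoc, h4, h6, h5]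
  -- The angle cancels in every Taylor coefficient in ζ, so no contour has to be rotated.
  have h7 : Complex.exp (-(θ * Complex.I * (a + n))) * Complex.exp (θ * Complex.I * a) *
    Complex.exp (θ * Complex.I) ^ n = 1 := by
    rw [← Complex.exp_nat_mul, ← Complex.exp_add, ← Complex.exp_add]
    ring_nf
    simp
  have h8 : (2 : ℂ) ^ ((a : ℂ) / 2) = 2 ^ (-(a : ℂ) / 2) * 2 ^ (a : ℂ) := by
    rw [← two_cpow_add]; ring_nf
  have hGa : Complex.Gamma a ≠ 0 := Complex.Gamma_ne_zero_of_re_pos (by simpa using ha)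
  rw [h8, neg_pow (ζ * _), mul_pow]
  linear_combination (-(2 : ℂ) ^ (-(a : ℂ) / 2) * 2 ^ (a : ℂ) / (2 * Complex.Gamma a) *
    ((-1) ^ n / (n.factorial : ℂ) * 2 ^ n * Complex.Gamma ((a + n) / 2 : ℝ)) * ζ ^ n) * h7

/-! ### Watson's lemma -/

theorem continuous_polynomial_eval_ofReal (p : Polynomial ℂ) :
    Continuous fun t : ℝ => p.eval (t : ℂ) :=
  p.continuous.comp Complex.continuous_ofReal

/-- The truncated series integrates exactly by Euler's integral, and the remainder is bounded by C
t^N under the integral. The bound depends on y only through Re y, which makes it uniform on sectors.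
-/
theorem watson_bound {a : ℝ} (ha : 0 < a) {g : ℝ → ℂ} (hg : Continuous g) {c : PowerSeries ℂ}
    {N : ℕ} {C : ℝ} (hC : ∀ t : ℝ, 0 < t → ‖g t - (c.trunc N).eval (t : ℂ)‖ ≤ C * t ^ N)
    {y : ℂ} (hy : 0 < y.re) :
    ‖(∫ t : ℝ in Set.Ioi 0, ((t ^ (a - 1) : ℝ) : ℂ) * (Complex.exp (-(y * t)) * g t)) -
      ∑ k ∈ Finset.range N, PowerSeries.coeff k c *
        (y ^ (-(a + k : ℝ) : ℂ) * Complex.Gamma (a + k : ℝ))‖ ≤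
      C * ((1 / y.re) ^ (a + N) * Real.Gamma (a + N)) := by
  have hterm : ∀ k : ℕ, ∀ t : ℝ, 0 < t →
      ((t ^ (a - 1) : ℝ) : ℂ) * (Complex.exp (-(y * t)) * (PowerSeries.coeff k c * (t : ℂ) ^ k)) =
      PowerSeries.coeff k c * (((t ^ (a + k - 1) : ℝ) : ℂ) * Complex.exp (-(y * t))) := by
    intro k t ht
    have h1 : t ^ (a + k - 1) = t ^ (a - 1) * t ^ k := by
      rw [← Real.rpow_natCast, ← Real.rpow_add ht]; ring_nf
    rw [h1]
    push_cast
    ring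
  have hint : ∀ k : ℕ, IntegrableOn (fun t : ℝ => PowerSeries.coeff k c *
      (((t ^ (a + k - 1) : ℝ) : ℂ) * Complex.exp (-(y * t)))) (Set.Ioi 0) := fun k =>
    (integrableOn_rpow_mul_cexp (by positivity) hy).const_mul _
  have hmain : ∫ t : ℝ in Set.Ioi 0, ((t ^ (a - 1) : ℝ) : ℂ) *
      (Complex.exp (-(y * t)) * (c.trunc N).eval (t : ℂ)) =
      ∑ k ∈ Finset.range N, PowerSeries.coeff k c *
        (y ^ (-(a + k : ℝ) : ℂ) * Complex.Gamma (a + k : ℝ)) := by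
    have h1 : ∫ t : ℝ in Set.Ioi 0, ((t ^ (a - 1) : ℝ) : ℂ) *
        (Complex.exp (-(y * t)) * (c.trunc N).eval (t : ℂ)) =
        ∫ t : ℝ in Set.Ioi 0, ∑ k ∈ Finset.range N, PowerSeries.coeff k c *
          (((t ^ (a + k - 1) : ℝ) : ℂ) * Complex.exp (-(y * t))) := by
      refine setIntegral_congr_fun measurableSet_Ioi fun t ht => ?_
      rw [eval_trunc, Finset.mul_sum, Finset.mul_sum]
      exact Finset.sum_congr rfl fun k _ => hterm k t ht
    rw [h1, integral_finsetSum _ fun k _ => hint k]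
    refine Finset.sum_congr rfl fun k _ => ?_
    rw [integral_const_mul, integral_rpow_mul_cexp (by positivity) hy]
  have hmainint : IntegrableOn (fun t : ℝ => ((t ^ (a - 1) : ℝ) : ℂ) *
      (Complex.exp (-(y * t)) * (c.trunc N).eval (t : ℂ))) (Set.Ioi 0) := by
    have h1 := integrable_finsetSum (μ := volume.restrict (Set.Ioi 0)) (Finset.range N)
      fun k _ => hint k
    refine h1.congr ?_
    filter_upwards [ae_restrict_mem measurableSet_Ioi] with t ht
    rw [eval_trunc, Finset.mul_sum, Finset.mul_sum]
    exact Finset.sum_congr rfl fun k _ => (hterm k t ht).symm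
  have hbound : ∀ t : ℝ, 0 < t → ‖((t ^ (a - 1) : ℝ) : ℂ) *
      (Complex.exp (-(y * t)) * (g t - (c.trunc N).eval (t : ℂ)))‖ ≤
      C * (t ^ (a + N - 1) * Real.exp (-(y.re * t))) := by
    intro t ht
    rw [← mul_assoc, norm_mul, norm_rpow_mul_cexp ht]
    have h1 : t ^ (a + N - 1) = t ^ (a - 1) * t ^ N := by
      rw [← Real.rpow_natCast, ← Real.rpow_add ht]; ring_nf
    have h2 : 0 ≤ t ^ (a - 1) := Real.rpow_nonneg ht.le _
    calc _ ≤ t ^ (a - 1) * Real.exp (-y.re * t) * (C * t ^ N) := by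
          gcongr
          exact hC t ht
      _ = _ := by rw [h1, neg_mul]; ring
  have hbint : IntegrableOn (fun t : ℝ => C * (t ^ (a + N - 1) * Real.exp (-(y.re * t))))
      (Set.Ioi 0) := by
    have := (integrableOn_rpow_mul_exp (a := a + N) (by positivity) hy).const_mul C
    simp only [neg_mul] at this
    exact this
  have hrem : IntegrableOn (fun t : ℝ => ((t ^ (a - 1) : ℝ) : ℂ) *
      (Complex.exp (-(y * t)) * (g t - (c.trunc N).eval (t : ℂ)))) (Set.Ioi 0) := by
    refine hbint.mono' (aestronglyMeasurable_rpow_mul _ ?_) ?_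
    · have := continuous_polynomial_eval_ofReal (c.trunc N)
      fun_prop
    · filter_upwards [ae_restrict_mem measurableSet_Ioi] with t ht
      exact hbound t ht
  have hsplit : (∫ t : ℝ in Set.Ioi 0, ((t ^ (a - 1) : ℝ) : ℂ) *
      (Complex.exp (-(y * t)) * g t)) = (∫ t : ℝ in Set.Ioi 0, ((t ^ (a - 1) : ℝ) : ℂ) *
      (Complex.exp (-(y * t)) * (c.trunc N).eval (t : ℂ))) +
      ∫ t : ℝ in Set.Ioi 0, ((t ^ (a - 1) : ℝ) : ℂ) *
      (Complex.exp (-(y * t)) * (g t - (c.trunc N).eval (t : ℂ))) := by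
    rw [← integral_add hmainint hrem]
    congr 1
    funext t
    ring
  rw [hsplit, hmain, add_sub_cancel_left]
  refine (norm_integral_le_of_norm_le hbint ?_).trans ?_
  · filter_upwards [ae_restrict_mem measurableSet_Ioi] with t ht
    exact hbound t ht
  · rw [integral_const_mul, Real.integral_rpow_mul_exp_neg_mul_Ioi (by positivity) hy]

/-! ### The generating function -/

theorem HasExpansion.sq_gauge {α : Type*} {l : Filter α} {x f : α → ℂ} {c : PowerSeries ℂ} {a : ℂ}
    (hx : Tendsto x l (𝓝 0)) (h : HasExpansion l (fun t => a * x t ^ 2) f c) :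
    HasExpansion l x f (PowerSeries.mk fun k =>
      if Even k then a ^ (k / 2) * PowerSeries.coeff (k / 2) c else 0) := by
  refine HasExpansion.of_le hx fun N => ⟨2 * N, by omega, ?_⟩
  have h1 : (fun t => (a * x t ^ 2) ^ N) =O[l] fun t => x t ^ N := by
    have h2 := (HasExpansion.isBigO_pow_of_le hx (show N ≤ 2 * N by omega)).const_mul_left (a ^ N)
    refine h2.congr_left fun t => ?_
    rw [mul_pow, pow_mul]
  refine ((h N).trans h1).congr_left fun t => ?_
  have key : ∀ N, ((PowerSeries.mk fun k => if Even k then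
      a ^ (k / 2) * PowerSeries.coeff (k / 2) c else 0).trunc (2 * N)).eval (x t) =
      (c.trunc N).eval (a * x t ^ 2) := by
    intro N
    simp only [eval_trunc, PowerSeries.coeff_mk]
    induction N with
    | zero => simp
    | succ N ih =>
      have hodd : ¬ Even (2 * N + 1) := by simp
      rw [show 2 * (N + 1) = 2 * N + 1 + 1 by ring, Finset.sum_range_succ, Finset.sum_range_succ,
        Finset.sum_range_succ, ih, if_pos (even_two_mul N), if_neg hodd,
        Nat.mul_div_cancel_left _ two_pos]
      ring
  rw [key]

/-- The power series of `e^{-sτ - τ²/4}` in `τ`. -/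
def gaussSeries (s : ℂ) : PowerSeries ℂ :=
  PowerSeries.rescale (-s) (PowerSeries.exp ℂ) * PowerSeries.mk fun k =>
      if Even k then (-1 / 4 : ℂ) ^ (k / 2) * PowerSeries.coeff (k / 2) (PowerSeries.exp ℂ) else 0

theorem hasExpansion_exp : HasExpansion (𝓝 0) id Complex.exp (PowerSeries.exp ℂ) := by
  have h := HasExpansion.taylor (f := Complex.exp) (s := 0) (by fun_prop)
  have h1 : (PowerSeries.mk fun k => iteratedDeriv k Complex.exp 0 / (k.factorial : ℂ)) =
      PowerSeries.exp ℂ := by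
    ext k
    simp [PowerSeries.coeff_exp, iteratedDeriv_eq_iterate]
  rw [h1] at h
  simpa using h

theorem hasExpansion_gauss (s : ℂ) : HasExpansion (𝓝 0) id
    (fun τ => Complex.exp (-s * τ) * Complex.exp (-1 / 4 * τ ^ 2)) (gaussSeries s) := by
  have hid : Tendsto (id : ℂ → ℂ) (𝓝 0) (𝓝 0) := tendsto_id
  refine HasExpansion.mul hid ?_ ?_
  · have : Tendsto (fun τ : ℂ => -s * τ) (𝓝 0) (𝓝 0) :=
      Continuous.tendsto' (by fun_prop) _ _ (by simp)
    exact (hasExpansion_exp.comp_tendsto this).rescale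
  · have : Tendsto (fun τ : ℂ => -1 / 4 * τ ^ 2) (𝓝 0) (𝓝 0) :=
      Continuous.tendsto' (by fun_prop) _ _ (by simp)
    exact (hasExpansion_exp.comp_tendsto this).sq_gauge hid

theorem gaussSeries_neg (s : ℂ) :
    gaussSeries (-s) = PowerSeries.rescale (-1) (gaussSeries s) := by
  have h1 : PowerSeries.rescale (-1) (PowerSeries.mk fun k => if Even k then
      (-1 / 4 : ℂ) ^ (k / 2) * PowerSeries.coeff (k / 2) (PowerSeries.exp ℂ) else 0) =
      PowerSeries.mk fun k => if Even k then
      (-1 / 4 : ℂ) ^ (k / 2) * PowerSeries.coeff (k / 2) (PowerSeries.exp ℂ) else 0 := by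
    ext k
    rw [PowerSeries.coeff_rescale, PowerSeries.coeff_mk]
    split_ifs with h
    · rw [h.neg_one_pow, one_mul]
    · simp
  rw [gaussSeries, gaussSeries, map_mul, h1, PowerSeries.rescale_rescale]
  simp

theorem coeff_gaussSeries (k : ℕ) :
    ∃ P : Polynomial ℂ, ∀ s, PowerSeries.coeff k (gaussSeries s) = P.eval s := by
  refine ⟨∑ p ∈ Finset.HasAntidiagonal.antidiagonal k, Polynomial.C (PowerSeries.coeff p.1 (PowerSeries.exp ℂ) *
    (if Even p.2 then (-1 / 4 : ℂ) ^ (p.2 / 2) * PowerSeries.coeff (p.2 / 2) (PowerSeries.exp ℂ)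
      else 0)) * (-Polynomial.X) ^ p.1, fun s => ?_⟩
  rw [gaussSeries, PowerSeries.coeff_mul, Polynomial.eval_finsetSum]
  refine Finset.sum_congr rfl fun p _ => ?_
  rw [PowerSeries.coeff_rescale, PowerSeries.coeff_mk]
  simp only [Polynomial.eval_mul, Polynomial.eval_C, Polynomial.eval_pow, Polynomial.eval_neg,
    Polynomial.eval_X]
  ring

theorem constantCoeff_gaussSeries (s : ℂ) : PowerSeries.constantCoeff (gaussSeries s) = 1 := by
  rw [gaussSeries, map_mul]
  simp [← PowerSeries.coeff_zero_eq_constantCoeff_apply]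

/-- Watson's lemma needs the Taylor remainder bounded on the whole ray. Near 0 this is Taylor's
theorem; further out the function is bounded, since |θ| < π/4 keeps the quadratic exponent decaying,
and the polynomial has degree below N. -/
theorem gauss_remainder_bound (s : ℂ) {θ : ℝ} (h1 : -(Real.pi / 4) < θ)
    (h2 : θ < Real.pi / 4) (N : ℕ) : ∃ C : ℝ, ∀ t : ℝ, 0 < t →
      ‖Complex.exp (-s * (Complex.exp (θ * Complex.I) * t)) *
        Complex.exp (-1 / 4 * (Complex.exp (θ * Complex.I) * t) ^ 2) -
      ((gaussSeries s).trunc N).eval (Complex.exp (θ * Complex.I) * t)‖ ≤ C * t ^ N := by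
  set e := Complex.exp (θ * Complex.I)
  have hnorm : ‖e‖ = 1 := Complex.norm_exp_ofReal_mul_I θ
  have hb : 0 < Real.cos (2 * θ) := Real.cos_pos_of_mem_Ioo ⟨by linarith, by linarith⟩
  obtain ⟨C1, hC1⟩ := (hasExpansion_gauss s N).bound
  obtain ⟨δ, hδ, hδ'⟩ := Metric.eventually_nhds_iff.1 hC1
  set b := Real.cos (2 * θ)
  set D := Real.exp (‖s‖ ^ 2 / b)
  have hsq : e ^ 2 = Complex.exp ((2 * θ : ℝ) * Complex.I) := by
    rw [← Complex.exp_nat_mul]; push_cast; ring_nf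
  have hgauss : ∀ t : ℝ, 0 < t → ‖Complex.exp (-s * (e * t)) *
      Complex.exp (-1 / 4 * (e * t) ^ 2)‖ ≤ D := by
    intro t ht
    rw [norm_mul, Complex.norm_exp, Complex.norm_exp, ← Real.exp_add]
    apply Real.exp_le_exp.2
    have h3 : (-s * (e * t)).re ≤ ‖s‖ * t := by
      refine (Complex.re_le_norm _).trans (le_of_eq ?_)
      rw [norm_mul, norm_mul, norm_neg, hnorm, Complex.norm_real, Real.norm_of_nonneg ht.le,
        one_mul]
    have h4 : (-1 / 4 * (e * t) ^ 2).re = -(b / 4) * t ^ 2 := by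
      rw [mul_pow, hsq, show (-1 / 4 : ℂ) * (Complex.exp ((2 * θ : ℝ) * Complex.I) * (t : ℂ) ^ 2) =
        ((-1 / 4 * t ^ 2 : ℝ) : ℂ) * Complex.exp ((2 * θ : ℝ) * Complex.I) by push_cast; ring,
        Complex.re_ofReal_mul, Complex.exp_ofReal_mul_I_re]
      ring
    rw [h4]
    have h5 : ‖s‖ ^ 2 / b - ‖s‖ * t + b / 4 * t ^ 2 = (2 * ‖s‖ - b * t) ^ 2 / (4 * b) := by
      field_simp
      ring
    have h6 : 0 ≤ (2 * ‖s‖ - b * t) ^ 2 / (4 * b) := by positivity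
    linarith
  -- For t ≥ δ one has t/(δ/2) ≥ 1, so each lower power t^k is at most (δ/2)^{k-N} t^N.
  set M := ∑ k ∈ Finset.range N, ‖PowerSeries.coeff k (gaussSeries s)‖ * ((δ / 2) ^ N)⁻¹
    * (δ / 2) ^ k
  refine ⟨max (C1) (D * ((δ / 2) ^ N)⁻¹ + M), fun t ht => ?_⟩
  rcases lt_or_ge t δ with htδ | htδ
  · have h3 := @hδ' (e * t) (by
      rw [dist_zero_right, norm_mul, hnorm, Complex.norm_real, Real.norm_of_nonneg ht.le, one_mul]
      exact htδ)
    simp only [id, norm_pow, norm_mul e, hnorm, Complex.norm_real, Real.norm_of_nonneg ht.le,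
      one_mul] at h3
    refine h3.trans ?_
    gcongr
    exact le_max_left _ _
  · have hδ2 : 0 < δ / 2 := half_pos hδ
    have htd : 1 ≤ t / (δ / 2) := by
      rw [le_div_iff₀ hδ2]; linarith
    have h3 : ‖((gaussSeries s).trunc N).eval (e * t)‖ ≤ M * t ^ N := by
      rw [eval_trunc, Finset.sum_mul]
      refine (norm_sum_le _ _).trans (Finset.sum_le_sum fun k hk => ?_)
      rw [norm_mul, norm_pow, norm_mul, hnorm, one_mul, Complex.norm_real,
        Real.norm_of_nonneg ht.le]
      have h4 : (t / (δ / 2)) ^ k ≤ (t / (δ / 2)) ^ N :=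
        pow_le_pow_right₀ htd (Finset.mem_range.1 hk).le
      rw [div_pow t, div_pow t] at h4
      have h5 : t ^ k ≤ ((δ / 2) ^ N)⁻¹ * (δ / 2) ^ k * t ^ N := by
        rw [div_le_iff₀ (by positivity)] at h4
        calc _ ≤ _ := h4
          _ = _ := by ring
      calc _ ≤ ‖PowerSeries.coeff k (gaussSeries s)‖ * (((δ / 2) ^ N)⁻¹ * (δ / 2) ^ k * t ^ N) := by
            gcongr
        _ = _ := by ring
    have h6 : D ≤ D * ((δ / 2) ^ N)⁻¹ * t ^ N := by
      have h7 : 1 ≤ (t / (δ / 2)) ^ N := one_le_pow₀ htd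
      rw [div_pow t] at h7
      have h8 : 0 ≤ D := (Real.exp_pos _).le
      calc D = D * 1 := by ring
        _ ≤ D * (t ^ N / (δ / 2) ^ N) := by gcongr
        _ = _ := by ring
    calc _ ≤ D + M * t ^ N := (norm_sub_le _ _).trans (add_le_add (hgauss t ht) h3)
      _ ≤ D * ((δ / 2) ^ N)⁻¹ * t ^ N + M * t ^ N := by gcongr
      _ = (D * ((δ / 2) ^ N)⁻¹ + M) * t ^ N := by ring
      _ ≤ _ := by
        gcongr
        exact le_max_right _ _

/-! ### Asymptotics in the right half-plane, for all real indices -/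

/-- The neighbourhoods of infinity in the right half-plane. -/
def rightInfty : Filter ℂ := Bornology.cobounded ℂ ⊓ 𝓟 {l | 0 < l.re}

theorem tendsto_inv_cobounded_inf (S : Set ℂ) :
    Tendsto (fun l : ℂ => l⁻¹) (Bornology.cobounded ℂ ⊓ 𝓟 S) (𝓝 0) :=
  tendsto_inv₀_cobounded.mono_left inf_le_left

/-- A rotation that brings a quarter of the plane into the right half-plane. -/
theorem exists_rotation {l : ℂ} (hl : 0 < l.re) : ∃ θ ∈ ({Real.pi / 8, -(Real.pi / 8)} : Set ℝ),
    Real.sin (Real.pi / 8) * ‖l‖ ≤ (l * Complex.exp (θ * Complex.I)).re := by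
  have hpi := Real.pi_pos
  have hs : 0 < Real.sin (Real.pi / 8) := Real.sin_pos_of_pos_of_lt_pi (by linarith) (by linarith)
  have hsc : Real.sin (Real.pi / 8) ≤ Real.cos (Real.pi / 8) := by
    rw [← Real.cos_pi_div_two_sub]
    exact Real.cos_le_cos_of_nonneg_of_le_pi (by linarith) (by linarith) (by linarith)
  have hn : ‖l‖ ≤ l.re + |l.im| := by
    have := Complex.norm_le_abs_re_add_abs_im l
    rwa [abs_of_pos hl] at this
  rcases le_total 0 l.im with h | h
  · refine ⟨-(Real.pi / 8), by simp, ?_⟩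
    rw [Complex.mul_re, Complex.exp_ofReal_mul_I_re, Complex.exp_ofReal_mul_I_im, Real.cos_neg,
      Real.sin_neg]
    rw [abs_of_nonneg h] at hn
    nlinarith
  · refine ⟨Real.pi / 8, by simp, ?_⟩
    rw [Complex.mul_re, Complex.exp_ofReal_mul_I_re, Complex.exp_ofReal_mul_I_im]
    rw [abs_of_nonpos h] at hn
    nlinarith

/-- The arguments satisfy |arg l| + |θ| < π, so the product does not cross the cut of the principal
logarithm. -/
theorem mul_exp_cpow {l : ℂ} (hl : 0 < l.re) {θ : ℝ} (h1 : -(Real.pi / 4) < θ)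
    (h2 : θ < Real.pi / 4) (z : ℂ) : (l * Complex.exp (θ * Complex.I)) ^ z =
      l ^ z * Complex.exp (θ * Complex.I * z) := by
  have hpi := Real.pi_pos
  have hl0 : l ≠ 0 := fun h => by simp [h] at hl
  have harg := Complex.abs_arg_lt_pi_div_two_iff.2 (Or.inl hl)
  rw [abs_lt] at harg
  have he : Complex.log (Complex.exp (θ * Complex.I)) = θ * Complex.I :=
    Complex.log_exp (by simp; linarith) (by simp; linarith)
  have harge : Complex.arg (Complex.exp (θ * Complex.I)) = θ := by
    rw [Complex.arg_exp_mul_I]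
    exact (toIocMod_eq_self _).2 ⟨by linarith, by linarith⟩
  rw [Complex.cpow_def_of_ne_zero (mul_ne_zero hl0 (Complex.exp_ne_zero _)),
    Complex.cpow_def_of_ne_zero hl0, Complex.log_mul hl0 (Complex.exp_ne_zero _)
      (by rw [harge]; constructor <;> linarith), he, add_mul, Complex.exp_add]

/-- The expansion for negative index, with explicit error bound, on one ray sector. -/
theorem pcfF_expansion_bound {a : ℝ} (ha : 0 < a) (s : ℂ) {θ : ℝ} (h1 : -(Real.pi / 4) < θ)
    (h2 : θ < Real.pi / 4) (N : ℕ) : ∃ C : ℝ, ∀ l : ℂ, 0 < l.re →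
      Real.sin (Real.pi / 8) * ‖l‖ ≤ (l * Complex.exp (θ * Complex.I)).re →
      ‖(2 : ℂ) ^ ((a : ℂ) / 2) * l ^ (a : ℂ) * pcfF (-a) ((√2 : ℝ) * (l + s)) -
        ∑ k ∈ Finset.range N, PowerSeries.coeff k (gaussSeries s) *
          (Complex.Gamma (a + k : ℝ) / Complex.Gamma a) * l⁻¹ ^ k‖ ≤ C * ‖l⁻¹ ^ N‖ := by
  have hpi := Real.pi_pos
  have hs : 0 < Real.sin (Real.pi / 8) := Real.sin_pos_of_pos_of_lt_pi (by linarith) (by linarith)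
  obtain ⟨C, hC⟩ := gauss_remainder_bound s h1 h2 N
  set e := Complex.exp (θ * Complex.I) with he
  have hnorm : ‖e‖ = 1 := Complex.norm_exp_ofReal_mul_I θ
  have hC0 : 0 ≤ C := by
    have := (norm_nonneg _).trans (hC 1 one_pos)
    simpa using this
  have hGa : Complex.Gamma a ≠ 0 := Complex.Gamma_ne_zero_of_re_pos (by simpa using ha)
  -- The constant of `watson_bound` at y = l e^{iθ}, with Re y replaced by its lower bound sin(π/8)
  -- ‖l‖.
  refine ⟨(C * ((Real.sin (Real.pi / 8))⁻¹ ^ (a + N) * Real.Gamma (a + N))) / ‖Complex.Gamma a‖,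
    fun l hl hle => ?_⟩
  have hl0 : l ≠ 0 := fun h => by simp [h] at hl
  have hln : 0 < ‖l‖ := norm_pos_iff.2 hl0
  have hy : 0 < (l * e).re := lt_of_lt_of_le (by positivity) hle
  have hW := watson_bound ha (g := fun t : ℝ => Complex.exp (-s * (e * t)) *
    Complex.exp (-1 / 4 * (e * t) ^ 2)) (by fun_prop) (c := PowerSeries.rescale e (gaussSeries s))
    (N := N) (C := C) (fun t ht => by
      have := hC t ht
      have h3 : ((PowerSeries.rescale e (gaussSeries s)).trunc N).eval (t : ℂ) =
          ((gaussSeries s).trunc N).eval (e * t) := by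
        rw [eval_trunc, eval_trunc]
        refine Finset.sum_congr rfl fun k _ => ?_
        rw [PowerSeries.coeff_rescale]
        ring
      rwa [h3]) hy
  have hI := pcfF_eq_integral ha h1 h2 (l + s)
  have hint : ∀ t : ℝ, Complex.exp (-((l + s) * e * t)) * Complex.exp (-(e ^ 2 / 4 * t ^ 2)) =
      Complex.exp (-(l * e * t)) * (Complex.exp (-s * (e * t)) *
        Complex.exp (-1 / 4 * (e * t) ^ 2)) := by
    intro t
    rw [← Complex.exp_add, ← Complex.exp_add, ← Complex.exp_add]
    ring_nf
  simp only [← he, hint] at hI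
  set J := ∫ t : ℝ in Set.Ioi 0, ((t ^ (a - 1) : ℝ) : ℂ) *
    (Complex.exp (-(l * e * t)) * (Complex.exp (-s * (e * t)) *
        Complex.exp (-1 / 4 * (e * t) ^ 2)))
  have h22 : (2 : ℂ) ^ ((a : ℂ) / 2) * 2 ^ (-(a : ℂ) / 2) = 1 := by
    rw [← two_cpow_add]; ring_nf; simp
  have hmain : (2 : ℂ) ^ ((a : ℂ) / 2) * l ^ (a : ℂ) * pcfF (-a) ((√2 : ℝ) * (l + s)) =
      l ^ (a : ℂ) * Complex.exp (θ * Complex.I * a) / Complex.Gamma a * J := by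
    rw [hI]
    linear_combination (l ^ (a : ℂ) * Complex.exp (θ * Complex.I * a) / Complex.Gamma a * J) * h22
  have hterm : ∀ k : ℕ, PowerSeries.coeff k (gaussSeries s) *
      (Complex.Gamma (a + k : ℝ) / Complex.Gamma a) * l⁻¹ ^ k =
      l ^ (a : ℂ) * Complex.exp (θ * Complex.I * a) / Complex.Gamma a *
      (PowerSeries.coeff k (PowerSeries.rescale e (gaussSeries s)) *
        ((l * e) ^ (-(a + k : ℝ) : ℂ) * Complex.Gamma (a + k : ℝ))) := by
    intro k
    have h3 : l ^ (a : ℂ) * l ^ (-(a + k : ℝ) : ℂ) = l⁻¹ ^ k := by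
      rw [← Complex.cpow_add _ _ hl0, inv_pow, ← Complex.cpow_natCast, ← Complex.cpow_neg]
      push_cast
      ring_nf
    have h4 : Complex.exp (θ * Complex.I * a) * e ^ k *
        Complex.exp (θ * Complex.I * (-(a + k : ℝ) : ℂ)) = 1 := by
      rw [← Complex.exp_nat_mul, ← Complex.exp_add, ← Complex.exp_add, ← Complex.exp_zero]
      push_cast
      ring_nf
    rw [mul_exp_cpow hl h1 h2, PowerSeries.coeff_rescale, ← h3]
    linear_combination (-(l ^ (a : ℂ) * l ^ (-(a + k : ℝ) : ℂ)) / Complex.Gamma a *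
      PowerSeries.coeff k (gaussSeries s) * Complex.Gamma (a + k : ℝ)) * h4
  rw [hmain, Finset.sum_congr rfl fun k _ => hterm k, ← Finset.mul_sum, ← mul_sub, norm_mul]
  have h5 : ‖l ^ (a : ℂ) * Complex.exp (θ * Complex.I * a) / Complex.Gamma a‖ =
      ‖l‖ ^ a / ‖Complex.Gamma a‖ := by
    rw [norm_div, norm_mul, Complex.norm_cpow_real, show (θ : ℂ) * Complex.I * a =
      ((θ * a : ℝ) : ℂ) * Complex.I by push_cast; ring, Complex.norm_exp_ofReal_mul_I, mul_one]
  rw [h5]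
  have h6 : (1 / (l * e).re) ^ (a + N) ≤ (Real.sin (Real.pi / 8))⁻¹ ^ (a + N) * ‖l‖⁻¹ ^ (a + N) := by
    rw [← Real.mul_rpow (by positivity) (by positivity), ← mul_inv]
    refine Real.rpow_le_rpow (by positivity) ?_ (by positivity)
    rw [one_div]
    exact inv_anti₀ (by positivity) hle
  have hGN : 0 ≤ Real.Gamma (a + N) := (Real.Gamma_pos_of_pos (by positivity)).le
  have h7 : ‖l‖ ^ a * ‖l‖⁻¹ ^ (a + N) = ‖l⁻¹ ^ N‖ := by
    rw [norm_pow, norm_inv, Real.inv_rpow hln.le, Real.rpow_add hln, Real.rpow_natCast, inv_pow]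
    field_simp
  calc _ ≤ ‖l‖ ^ a / ‖Complex.Gamma a‖ * (C * ((Real.sin (Real.pi / 8))⁻¹ ^ (a + N) *
        ‖l‖⁻¹ ^ (a + N) * Real.Gamma (a + N))) := by
        gcongr
        refine hW.trans ?_
        gcongr
    _ = _ := by rw [← h7]; ring

/-- `d` is the asymptotic series of `2^{-μ/2} λ^{-μ} F_μ(√2(λ+s))`, as a function of `s`. -/
structure IsPcfSeries (μ : ℝ) (d : ℂ → PowerSeries ℂ) : Prop where
  constantCoeff : ∀ s, PowerSeries.constantCoeff (d s) = 1
  neg : ∀ s, d (-s) = PowerSeries.rescale (-1) (d s)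
  coeff : ∀ k, ∃ P : Polynomial ℂ, ∀ s, PowerSeries.coeff k (d s) = P.eval s
  hasExpansion : ∀ s, HasExpansion rightInfty (fun l => l⁻¹)
    (fun l => (2 : ℂ) ^ (-(μ : ℂ) / 2) * l ^ (-μ : ℂ) * pcfF μ ((√2 : ℝ) * (l + s))) (d s)

/-- Watson's lemma multiplies the k-th Gaussian coefficient by Γ(a+k)/Γ(a). The two rays ±π/8
together cover the half-plane up to its boundary, and the larger constant serves both. -/
theorem isPcfSeries_of_neg {a : ℝ} (ha : 0 < a) : IsPcfSeries (-a) fun s => PowerSeries.mk fun k =>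
    PowerSeries.coeff k (gaussSeries s) * (Complex.Gamma (a + k : ℝ) / Complex.Gamma a) := by
  have hGa : Complex.Gamma a ≠ 0 := Complex.Gamma_ne_zero_of_re_pos (by simpa using ha)
  refine ⟨fun s => ?_, fun s => ?_, fun k => ?_, fun s N => ?_⟩
  · rw [← PowerSeries.coeff_zero_eq_constantCoeff_apply, PowerSeries.coeff_mk,
      PowerSeries.coeff_zero_eq_constantCoeff_apply, constantCoeff_gaussSeries]
    simp [hGa]
  · ext k
    rw [PowerSeries.coeff_rescale, PowerSeries.coeff_mk, PowerSeries.coeff_mk, gaussSeries_neg,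
      PowerSeries.coeff_rescale]
    ring
  · obtain ⟨P, hP⟩ := coeff_gaussSeries k
    refine ⟨P * Polynomial.C (Complex.Gamma (a + k : ℝ) / Complex.Gamma a), fun s => ?_⟩
    rw [PowerSeries.coeff_mk, hP]
    simp
  · have hpi := Real.pi_pos
    obtain ⟨C1, hC1⟩ := pcfF_expansion_bound ha s (θ := Real.pi / 8) (by linarith) (by linarith) N
    obtain ⟨C2, hC2⟩ := pcfF_expansion_bound ha s (θ := -(Real.pi / 8)) (by linarith)
      (by linarith) N
    refine IsBigO.of_bound (max C1 C2) ?_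
    filter_upwards [mem_inf_of_right (mem_principal_self _)] with l hl
    have heq : (2 : ℂ) ^ (-((-a : ℝ) : ℂ) / 2) * l ^ (-((-a : ℝ) : ℂ)) *
        pcfF ((-a : ℝ) : ℂ) ((√2 : ℝ) * (l + s)) - ((PowerSeries.mk fun k =>
          PowerSeries.coeff k (gaussSeries s) *
            (Complex.Gamma (a + k : ℝ) / Complex.Gamma a)).trunc N).eval l⁻¹ =
        (2 : ℂ) ^ ((a : ℂ) / 2) * l ^ (a : ℂ) * pcfF (-a) ((√2 : ℝ) * (l + s)) -
        ∑ k ∈ Finset.range N, PowerSeries.coeff k (gaussSeries s) *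
          (Complex.Gamma (a + k : ℝ) / Complex.Gamma a) * l⁻¹ ^ k := by
      rw [eval_trunc]
      simp only [PowerSeries.coeff_mk, Complex.ofReal_neg, neg_neg]
    rw [heq]
    obtain ⟨θ, hθ, hle⟩ := exists_rotation hl
    rcases hθ with rfl | hθ
    · refine (hC1 l hl hle).trans ?_
      gcongr
      exact le_max_left _ _
    · rw [Set.mem_singleton_iff] at hθ
      subst hθ
      refine (hC2 l hl hle).trans ?_
      gcongr
      exact le_max_right _ _

/-- In F_{μ+1} = z F_μ - μ F_{μ-1} with z = √2(λ+s), dividing by 2^{(μ+1)/2} λ^{μ+1} turns z into 1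
+ s/λ and μ into μ/(2λ²). -/
theorem IsPcfSeries.add_one {μ : ℝ} {d d' : ℂ → PowerSeries ℂ} (h : IsPcfSeries μ d)
    (h' : IsPcfSeries (μ - 1) d') : IsPcfSeries (μ + 1) fun s =>
      (1 + PowerSeries.C s * PowerSeries.X) * d s -
        PowerSeries.C (μ / 2 : ℂ) * PowerSeries.X ^ 2 * d' s := by
  have hx : Tendsto (fun l : ℂ => l⁻¹) rightInfty (𝓝 0) := tendsto_inv_cobounded_inf _
  refine ⟨fun s => ?_, fun s => ?_, fun k => ?_, fun s => ?_⟩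
  · simp [h.constantCoeff]
  · rw [h.neg, h'.neg]
    have h1 : PowerSeries.rescale (-1 : ℂ) (PowerSeries.X : PowerSeries ℂ) = -PowerSeries.X := by
      ext k
      rw [PowerSeries.coeff_rescale, map_neg, PowerSeries.coeff_X]
      split_ifs with hk <;> simp [hk]
    have h2 : ∀ c : ℂ, PowerSeries.rescale (-1 : ℂ) (PowerSeries.C c) = PowerSeries.C c := by
      intro c
      ext k
      rw [PowerSeries.coeff_rescale, PowerSeries.coeff_C]
      split_ifs with hk <;> simp [hk]
    simp only [map_sub, map_mul, map_add, map_one, map_pow, h1, h2, map_neg]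
    ring
  · obtain ⟨P0, hP0⟩ := h.coeff k
    have hP1 : ∃ P : Polynomial ℂ, ∀ s,
        PowerSeries.coeff k (PowerSeries.X * d s) = P.eval s := by
      rcases k with _ | k
      · exact ⟨0, fun s => by simp⟩
      · obtain ⟨P, hP⟩ := h.coeff k
        exact ⟨P, fun s => by rw [PowerSeries.coeff_succ_X_mul, hP]⟩
    have hP2 : ∃ P : Polynomial ℂ, ∀ s,
        PowerSeries.coeff k (PowerSeries.X ^ 2 * d' s) = P.eval s := by
      rcases k with _ | _ | k
      · exact ⟨0, fun s => by simp⟩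
      · exact ⟨0, fun s => by rw [PowerSeries.coeff_X_pow_mul']; simp⟩
      · obtain ⟨P, hP⟩ := h'.coeff k
        exact ⟨P, fun s => by
          rw [show k + 1 + 1 = k + 2 by ring, PowerSeries.coeff_X_pow_mul, hP]⟩
    obtain ⟨P1, hP1⟩ := hP1
    obtain ⟨P2, hP2⟩ := hP2
    refine ⟨P0 + Polynomial.X * P1 - Polynomial.C (μ / 2 : ℂ) * P2, fun s => ?_⟩
    rw [map_sub, add_mul, one_mul, map_add, mul_assoc, mul_assoc, PowerSeries.coeff_C_mul,
      PowerSeries.coeff_C_mul, hP0, hP1, hP2]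
    simp
  · have e1 := ((HasExpansion.const hx 1).add
      ((HasExpansion.gauge hx).const_mul hx s)).mul hx (h.hasExpansion s)
    have e2 := (((HasExpansion.gauge hx).mul hx (HasExpansion.gauge hx)).const_mul hx
      (μ / 2 : ℂ)).mul hx (h'.hasExpansion s)
    have e3 := e1.sub hx e2
    rw [map_one, ← pow_two] at e3
    refine e3.congr' ?_
    filter_upwards [mem_inf_of_right (mem_principal_self _)] with l hl
    have hl0 : l ≠ 0 := fun h => by simp [h] at hl
    have h3 : l ^ (-((μ - 1 : ℝ) : ℂ)) = l ^ (-((μ + 1 : ℝ) : ℂ)) * l ^ 2 := by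
      rw [← Complex.cpow_natCast l 2, ← Complex.cpow_add _ _ hl0]
      push_cast
      ring_nf
    have h4 : l ^ (-(μ : ℂ)) = l ^ (-((μ + 1 : ℝ) : ℂ)) * l := by
      nth_rewrite 3 [← Complex.cpow_one l]
      rw [← Complex.cpow_add _ _ hl0]
      push_cast
      ring_nf
    have h5 : (2 : ℂ) ^ (-((μ - 1 : ℝ) : ℂ) / 2) = 2 ^ (-((μ + 1 : ℝ) : ℂ) / 2) * 2 := by
      have := two_cpow_add (-((μ + 1 : ℝ) : ℂ) / 2) 1
      rw [Complex.cpow_one] at this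
      rw [← this]
      push_cast
      ring_nf
    have h6 : (2 : ℂ) ^ (-(μ : ℂ) / 2) = 2 ^ (-((μ + 1 : ℝ) : ℂ) / 2) * (√2 : ℝ) := by
      rw [Real.sqrt_eq_rpow, Complex.ofReal_cpow (by norm_num)]
      push_cast
      rw [← two_cpow_add]
      ring_nf
    have h7 := pcfF_add_one μ ((√2 : ℝ) * (l + s))
    rw [h3, h4, h5, h6]
    push_cast at h7 ⊢
    rw [h7]
    field_simp

theorem exists_isPcfSeries (μ : ℝ) : ∃ d, IsPcfSeries μ d := by
  -- If μ < n + 1, then μ - 1 and μ - 2 both lie below n, so ordinary induction suffices for the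
  -- two-step recurrence. The base case is the Laplace integral.
  have key : ∀ n : ℕ, ∀ μ : ℝ, μ < n → ∃ d, IsPcfSeries μ d := by
    intro n
    induction n with
    | zero =>
      intro μ hμ
      have h := isPcfSeries_of_neg (a := -μ) (by simpa using hμ)
      rw [neg_neg] at h
      exact ⟨_, h⟩
    | succ n ih =>
      intro μ hμ
      push_cast at hμ
      obtain ⟨d, hd⟩ := ih (μ - 1) (by linarith)
      obtain ⟨d', hd'⟩ := ih (μ - 1 - 1) (by linarith)
      have h := hd.add_one hd'
      rw [sub_add_cancel] at h
      exact ⟨_, h⟩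
  obtain ⟨n, hn⟩ := exists_nat_gt μ
  exact key n μ hn

end PIV

namespace PIV

/-! ### Gluing along the axes, and Liouville's theorem -/

/-- Morera's theorem: integrals over rectangles vanish by Cauchy when the open rectangle misses the
real axis, and a rectangle that meets it is cut along the axis into two such rectangles. -/
theorem differentiableOn_of_im_ne_zero {f : ℂ → ℂ} {U : Set ℂ} (hU : IsOpen U)
    (hc : ContinuousOn f U) (hd : DifferentiableOn ℂ f (U ∩ {l | l.im ≠ 0})) :
    DifferentiableOn ℂ f U := by
  refine (Complex.isConservativeOn_and_continuousOn_iff_isDifferentiableOn hU).1 ⟨?_, hc⟩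
  intro z w hzw
  have hrect : ∀ a ∈ Set.uIcc z.im w.im, ∀ b ∈ Set.uIcc z.im w.im,
      (Set.uIcc z.re w.re ×ℂ Set.uIcc a b) ⊆ U := fun a ha b hb l hl =>
    hzw ⟨hl.1, Set.uIcc_subset_uIcc ha hb hl.2⟩
  have hclosed : ∀ a ∈ Set.uIcc z.im w.im, ∀ b ∈ Set.uIcc z.im w.im,
      0 ∉ Set.Ioo (min a b) (max a b) →
      (∫ x : ℝ in z.re..w.re, f (x + a * Complex.I)) - (∫ x : ℝ in z.re..w.re, f (x + b * Complex.I))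
        + Complex.I • (∫ y : ℝ in a..b, f (w.re + y * Complex.I))
        - Complex.I • (∫ y : ℝ in a..b, f (z.re + y * Complex.I)) = 0 := by
    intro a ha b hb h0
    have := Complex.integral_boundary_rect_eq_zero_of_continuousOn_of_differentiableOn f
      (z.re + a * Complex.I) (w.re + b * Complex.I)
    simp only [Complex.add_re, Complex.ofReal_re, Complex.mul_re, Complex.I_re, mul_zero,
      Complex.ofReal_im, Complex.I_im, sub_self, add_zero, Complex.add_im, Complex.mul_im, mul_one,
      zero_add] at this
    refine this (hc.mono (hrect a ha b hb)) (hd.mono fun l hl => ⟨hrect a ha b hb ⟨?_, ?_⟩, ?_⟩)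
    · exact Set.Ioo_subset_Icc_self hl.1
    · exact Set.Ioo_subset_Icc_self hl.2
    · intro h
      exact h0 (h ▸ hl.2)
  have hz : z.im ∈ Set.uIcc z.im w.im := Set.left_mem_uIcc
  have hw : w.im ∈ Set.uIcc z.im w.im := Set.right_mem_uIcc
  rw [eq_neg_iff_add_eq_zero, Complex.wedgeIntegral_add_wedgeIntegral_eq]
  by_cases h0 : (0 : ℝ) ∈ Set.Ioo (min z.im w.im) (max z.im w.im)
  · have hm : (0 : ℝ) ∈ Set.uIcc z.im w.im := Set.Ioo_subset_Icc_self h0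
    have e1 := hclosed _ hz 0 hm (by
      rcases le_total z.im 0 with h | h <;> simp [h])
    have e2 := hclosed 0 hm _ hw (by
      rcases le_total w.im 0 with h | h <;> simp [h])
    have hint : ∀ r ∈ Set.uIcc z.re w.re, ∀ a ∈ Set.uIcc z.im w.im, ∀ b ∈ Set.uIcc z.im w.im,
        IntervalIntegrable (fun y : ℝ => f (r + y * Complex.I)) MeasureTheory.volume a b := by
      intro r hr a ha b hb
      refine ContinuousOn.intervalIntegrable (hc.comp (by fun_prop) fun y hy => ?_)
      refine hrect a ha b hb ⟨?_, ?_⟩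
      · simpa using hr
      · simpa using hy
    have e3 := intervalIntegral.integral_add_adjacent_intervals
      (hint w.re Set.right_mem_uIcc _ hz 0 hm) (hint w.re Set.right_mem_uIcc 0 hm _ hw)
    have e4 := intervalIntegral.integral_add_adjacent_intervals
      (hint z.re Set.left_mem_uIcc _ hz 0 hm) (hint z.re Set.left_mem_uIcc 0 hm _ hw)
    rw [← e3, ← e4]
    simp only [smul_eq_mul] at e1 e2 ⊢
    linear_combination e1 + e2
  · exact hclosed _ hz _ hw h0

theorem differentiableOn_of_re_ne_zero {f : ℂ → ℂ} {U : Set ℂ} (hU : IsOpen U)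
    (hc : ContinuousOn f U) (hd : DifferentiableOn ℂ f (U ∩ {l | l.re ≠ 0})) :
    DifferentiableOn ℂ f U := by
  have hm : Differentiable ℂ fun l : ℂ => -Complex.I * l := by fun_prop
  have h1 : DifferentiableOn ℂ (fun l => f (-Complex.I * l)) ((fun l => -Complex.I * l) ⁻¹' U) := by
    refine differentiableOn_of_im_ne_zero (hU.preimage hm.continuous)
      (hc.comp hm.continuous.continuousOn fun l hl => hl)
      (hd.comp hm.differentiableOn fun l hl => ⟨hl.1, ?_⟩)
    simpa using hl.2
  have hm' : DifferentiableOn ℂ (fun l : ℂ => Complex.I * l) U := by fun_prop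
  have h2 := h1.comp hm' fun l hl => by
    change -Complex.I * (Complex.I * l) ∈ U
    rwa [← mul_assoc, neg_mul, Complex.I_mul_I, neg_neg, one_mul]
  refine h2.congr fun l _ => ?_
  simp [← mul_assoc]

theorem dense_offAxes : Dense offAxes := by
  intro p
  have h : Tendsto (fun t : ℝ => p + t * (1 + Complex.I)) (𝓝[>] 0) (𝓝 p) := by
    have : Continuous fun t : ℝ => p + t * (1 + Complex.I) := by fun_prop
    have := this.tendsto 0
    simp only [Complex.ofReal_zero, zero_mul, add_zero] at this
    exact this.mono_left nhdsWithin_le_nhds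
  refine mem_closure_of_tendsto h ?_
  have hne : ∀ a : ℝ, ∀ᶠ t : ℝ in 𝓝[>] 0, a + t ≠ 0 := by
    intro a
    rcases eq_or_ne a 0 with rfl | ha
    · filter_upwards [self_mem_nhdsWithin] with t ht
      simpa using (ne_of_gt ht)
    · have : ∀ᶠ t : ℝ in 𝓝 0, a + t ≠ 0 :=
        (by fun_prop : ContinuousAt (fun t : ℝ => a + t) 0).eventually_ne (by simpa)
      exact this.filter_mono nhdsWithin_le_nhds
  filter_upwards [hne p.re, hne p.im] with t h1 h2
  constructor <;> simpa

instance (p : ℂ) : (𝓝[offAxes] p).NeBot := mem_closure_iff_nhdsWithin_neBot.1 (dense_offAxes p)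

/-- `f` has the same limit at `p` within `S` and within `T`. -/
def Glues (f : ℂ → ℂ) (p : ℂ) (S T : Set ℂ) : Prop :=
  ∃ c, Tendsto f (𝓝[S] p) (𝓝 c) ∧ Tendsto f (𝓝[T] p) (𝓝 c)

/-- A function off the axes whose limits from the two sides of each axis agree. -/
structure GluesOnAxes (f : ℂ → ℂ) : Prop where
  differentiableOn : DifferentiableOn ℂ f offAxes
  glue₁ : ∀ x : ℝ, 0 < x → Glues f x quad1 quad4
  glue₂ : ∀ x : ℝ, 0 < x → Glues f (x * Complex.I) quad2 quad1
  glue₃ : ∀ x : ℝ, 0 < x → Glues f (-x) quad3 quad2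
  glue₄ : ∀ x : ℝ, 0 < x → Glues f (-x * Complex.I) quad4 quad3

/-- The nonzero coordinates of p keep their sign nearby, so close to p the set `offAxes` is covered
by the two adjacent quadrants. -/
theorem Glues.tendsto_offAxes {f : ℂ → ℂ} {p : ℂ} {S T : Set ℂ} (h : Glues f p S T)
    (hST : offAxes ∩ {l | (p.re ≠ 0 → 0 < l.re * p.re) ∧ (p.im ≠ 0 → 0 < l.im * p.im)} ⊆ S ∪ T) :
    ∃ c, Tendsto f (𝓝[offAxes] p) (𝓝 c) := by
  obtain ⟨c, h1, h2⟩ := h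
  refine ⟨c, ?_⟩
  have h3 : Tendsto f (𝓝[S ∪ T] p) (𝓝 c) := by
    rw [nhdsWithin_union]
    exact h1.sup h2
  refine h3.mono_left (nhdsWithin_le_of_mem ?_)
  refine mem_of_superset ?_ hST
  refine inter_mem self_mem_nhdsWithin (mem_nhdsWithin_of_mem_nhds (inter_mem ?_ ?_))
  · by_cases hp : p.re = 0
    · exact Eventually.of_forall fun l h => absurd hp h
    · have : ContinuousAt (fun l : ℂ => l.re * p.re) p := by fun_prop
      filter_upwards [this.eventually (lt_mem_nhds (mul_self_pos.2 hp))] with l hl _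
      exact hl
  · by_cases hp : p.im = 0
    · exact Eventually.of_forall fun l h => absurd hp h
    · have : ContinuousAt (fun l : ℂ => l.im * p.im) p := by fun_prop
      filter_upwards [this.eventually (lt_mem_nhds (mul_self_pos.2 hp))] with l hl _
      exact hl

theorem GluesOnAxes.tendsto {f : ℂ → ℂ} (h : GluesOnAxes f) {p : ℂ} (hp : p ≠ 0) :
    ∃ c, Tendsto f (𝓝[offAxes] p) (𝓝 c) := by
  by_cases hp' : p ∈ offAxes
  · exact ⟨_, (h.differentiableOn p hp').continuousWithinAt⟩
  by_cases him : p.im = 0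
  · have hre : p.re ≠ 0 := fun h0 => hp (Complex.ext h0 him)
    have hpe : p = (p.re : ℂ) := Complex.ext (by simp) (by simp [him])
    rcases lt_or_gt_of_ne hre with hlt | hgt
    · have := h.glue₃ (-p.re) (by linarith)
      rw [show (-((-p.re : ℝ) : ℂ)) = p by rw [hpe]; simp] at this
      refine this.tendsto_offAxes fun l hl => ?_
      have h1 := hl.2.1 hre
      have h2 : l.re < 0 := by nlinarith
      rcases lt_or_gt_of_ne hl.1.2 with h3 | h3
      · exact Or.inl ⟨h2, h3⟩
      · exact Or.inr ⟨h2, h3⟩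
    · have := h.glue₁ p.re hgt
      rw [← hpe] at this
      refine this.tendsto_offAxes fun l hl => ?_
      have h1 := hl.2.1 hre
      have h2 : 0 < l.re := by nlinarith
      rcases lt_or_gt_of_ne hl.1.2 with h3 | h3
      · exact Or.inr ⟨h2, h3⟩
      · exact Or.inl ⟨h2, h3⟩
  · have hre : p.re = 0 := by
      by_contra hre
      exact hp' ⟨hre, him⟩
    have hpe : p = (p.im : ℂ) * Complex.I := Complex.ext (by simp [hre]) (by simp)
    rcases lt_or_gt_of_ne him with hlt | hgt
    · have := h.glue₄ (-p.im) (by linarith)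
      rw [show (-((-p.im : ℝ) : ℂ)) * Complex.I = p by
        refine Complex.ext (by simp [hre]) (by simp)] at this
      refine this.tendsto_offAxes fun l hl => ?_
      have h1 := hl.2.2 him
      have h2 : l.im < 0 := by nlinarith
      rcases lt_or_gt_of_ne hl.1.1 with h3 | h3
      · exact Or.inr ⟨h3, h2⟩
      · exact Or.inl ⟨h3, h2⟩
    · have := h.glue₂ p.im hgt
      rw [← hpe] at this
      refine this.tendsto_offAxes fun l hl => ?_
      have h1 := hl.2.2 him
      have h2 : 0 < l.im := by nlinarith
      rcases lt_or_gt_of_ne hl.1.1 with h3 | h3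
      · exact Or.inl ⟨h3, h2⟩
      · exact Or.inr ⟨h3, h2⟩

/-- A function that glues along the axes and is bounded at `0` extends to an entire function. -/
theorem GluesOnAxes.exists_entire {f : ℂ → ℂ} (h : GluesOnAxes f)
    (h0 : f =O[𝓝[offAxes] 0] fun _ => (1 : ℂ)) :
    ∃ g : ℂ → ℂ, Differentiable ℂ g ∧ ∀ l ∈ offAxes, g l = f l := by
  set F := extendFrom offAxes f
  have hF : ∀ l ∈ offAxes, F l = f l := extendFrom_extends h.differentiableOn.continuousOn
  have hFc : ContinuousOn F {0}ᶜ := continuousOn_extendFrom (fun l _ => dense_offAxes l)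
    fun l hl => h.tendsto hl
  have hFd : DifferentiableOn ℂ F offAxes := h.differentiableOn.congr hF
  have hre : IsOpen {l : ℂ | l.re ≠ 0} := isOpen_ne_fun Complex.continuous_re continuous_const
  -- The real axis is removed first, away from the imaginary axis; then the imaginary axis, away
  -- from 0; finally 0 is a removable singularity because the function is bounded there.
  have h1 : DifferentiableOn ℂ F {l | l.re ≠ 0} :=
    differentiableOn_of_im_ne_zero hre
      (hFc.mono fun l hl h => hl (by rw [Set.mem_singleton_iff.1 h]; simp)) hFd
  have h2 : DifferentiableOn ℂ F {0}ᶜ :=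
    differentiableOn_of_re_ne_zero isOpen_compl_singleton hFc (h1.mono Set.inter_subset_right)
  obtain ⟨C, hC⟩ := h0.bound
  obtain ⟨s, hs, hso, hs0⟩ : ∃ s : Set ℂ, (∀ l ∈ s, l ∈ offAxes → ‖f l‖ ≤ C) ∧ IsOpen s ∧ (0 : ℂ) ∈ s := by
    obtain ⟨s, hs, hso, h0s⟩ := mem_nhds_iff.1 (mem_nhdsWithin_iff_eventually.1 hC)
    exact ⟨s, fun l hl hl' => by simpa using hs hl hl', hso, h0s⟩
  have hb : ∀ l ∈ s \ {0}, ‖F l‖ ≤ C := by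
    intro l hl
    have ht : Tendsto F (𝓝[offAxes] l) (𝓝 (F l)) :=
      ((hFc l hl.2).continuousAt (isOpen_compl_singleton.mem_nhds hl.2)).mono_left
        nhdsWithin_le_nhds
    refine le_of_tendsto ht.norm ?_
    filter_upwards [self_mem_nhdsWithin, mem_nhdsWithin_of_mem_nhds (hso.mem_nhds hl.1)]
      with z hz hz'
    rw [hF z hz]
    exact hs z hz' hz
  have hs0' : s ∈ 𝓝 (0 : ℂ) := hso.mem_nhds hs0
  have h3 := Complex.differentiableOn_update_limUnder_of_bddAbove (f := F) (c := 0) hs0'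
    (h2.mono fun l hl => hl.2) ⟨C, by rintro _ ⟨l, hl, rfl⟩; exact hb l hl⟩
  refine ⟨Function.update F 0 (limUnder (𝓝[≠] 0) F), fun l => ?_, fun l hl => ?_⟩
  · by_cases hl : l = 0
    · subst hl
      exact (h3 0 hs0).differentiableAt hs0'
    · refine ((h2 l hl).differentiableAt (isOpen_compl_singleton.mem_nhds hl)).congr_of_eventuallyEq ?_
      filter_upwards [isOpen_compl_singleton.mem_nhds hl] with z hz
      exact Function.update_of_ne hz _ _
  · rw [Function.update_of_ne, hF l hl]
    rintro rfl
    exact hl.1 rfl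

/-- The neighbourhoods of infinity off the axes. -/
def infty : Filter ℂ := Bornology.cobounded ℂ ⊓ 𝓟 offAxes

theorem eventually_infty {p : ℂ → Prop} : (∀ᶠ l in infty, p l) ↔
    ∃ R : ℝ, ∀ l ∈ offAxes, R < ‖l‖ → p l := by
  rw [infty, eventually_inf_principal, ← comap_norm_atTop, eventually_comap]
  constructor
  · intro h
    obtain ⟨R, hR⟩ := eventually_atTop.1 h
    exact ⟨R, fun l hl hl' => hR ‖l‖ hl'.le l rfl hl⟩
  · rintro ⟨R, hR⟩
    filter_upwards [eventually_gt_atTop R] with r hr l hl hl'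
    exact hR l hl' (hl ▸ hr)

theorem exists_bound_of_isBigO_infty {f : ℂ → ℂ} (hf : Continuous f) {N : ℕ}
    (h : f =O[infty] fun l => l ^ N) : ∃ C R : ℝ, ∀ l, R < ‖l‖ → ‖f l‖ ≤ C * ‖l ^ N‖ := by
  obtain ⟨C, hC⟩ := h.bound
  obtain ⟨R, hR⟩ := eventually_infty.1 hC
  refine ⟨C, R, fun l hl => ?_⟩
  have h1 : Tendsto (fun z => ‖f z‖) (𝓝[offAxes] l) (𝓝 ‖f l‖) :=
    (hf.norm.tendsto l).mono_left nhdsWithin_le_nhds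
  have h2 : Tendsto (fun z => C * ‖z ^ N‖) (𝓝[offAxes] l) (𝓝 (C * ‖l ^ N‖)) :=
    ((by fun_prop : Continuous fun z : ℂ => C * ‖z ^ N‖).tendsto l).mono_left nhdsWithin_le_nhds
  refine le_of_tendsto_of_tendsto h1 h2 ?_
  have : ∀ᶠ z in 𝓝 l, R < ‖z‖ := continuous_norm.continuousAt.eventually (lt_mem_nhds hl)
  filter_upwards [self_mem_nhdsWithin, this.filter_mono nhdsWithin_le_nhds] with z hz hz'
  exact hR z hz hz'

/-- **Liouville's theorem** for functions of polynomial growth. -/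
theorem exists_polynomial_of_bound {f : ℂ → ℂ} (hf : Differentiable ℂ f) {N : ℕ} {C R : ℝ}
    (h : ∀ l, R < ‖l‖ → ‖f l‖ ≤ C * ‖l ^ N‖) :
    ∃ p : Polynomial ℂ, p.natDegree ≤ N ∧ ∀ l, f l = p.eval l := by
  induction N generalizing f C R with
  | zero =>
    simp only [pow_zero, norm_one, mul_one] at h
    obtain ⟨C', hC'⟩ := (isCompact_closedBall (0 : ℂ) R).exists_bound_of_continuousOn
      hf.continuous.continuousOn
    obtain ⟨c, hc⟩ := hf.exists_const_forall_eq_of_bounded (by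
      refine isBounded_iff_forall_norm_le.2 ⟨max C C', ?_⟩
      rintro _ ⟨l, rfl⟩
      rcases lt_or_ge R ‖l‖ with hl | hl
      · exact (h l hl).trans (le_max_left _ _)
      · exact (hC' l (by simpa using hl)).trans (le_max_right _ _))
    exact ⟨Polynomial.C c, by simp, fun l => by simp [hc]⟩
  | succ N ih =>
    -- The difference quotient (f(λ) - f(0))/λ is entire and grows one power slower, which drives
    -- the induction.
    have hd : Differentiable ℂ (dslope f 0) := by
      have := (Complex.differentiableOn_dslope (f := f) (c := 0) univ_mem).2 hf.differentiableOn
      exact differentiableOn_univ.1 this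
    obtain ⟨p, hp, hpf⟩ := ih hd (C := C + ‖f 0‖) (R := max R 1) (fun l hl => by
      have hl1 : 1 < ‖l‖ := (le_max_right _ _).trans_lt hl
      have hl0 : l ≠ 0 := fun h => by rw [h, norm_zero] at hl1; linarith
      rw [dslope_of_ne _ hl0, slope_def_field, sub_zero, norm_div,
        div_le_iff₀ (norm_pos_iff.2 hl0)]
      calc ‖f l - f 0‖ ≤ ‖f l‖ + ‖f 0‖ := norm_sub_le _ _
        _ ≤ C * ‖l ^ (N + 1)‖ + ‖f 0‖ * ‖l ^ (N + 1)‖ := by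
          refine add_le_add (h l ((le_max_left _ _).trans_lt hl)) ?_
          refine le_mul_of_one_le_right (norm_nonneg _) ?_
          rw [norm_pow]
          exact one_le_pow₀ hl1.le
        _ = _ := by rw [pow_succ, norm_mul]; ring)
    refine ⟨Polynomial.X * p + Polynomial.C (f 0), ?_, fun l => ?_⟩
    · refine (Polynomial.natDegree_add_le _ _).trans ?_
      simp only [Polynomial.natDegree_C]
      refine max_le ?_ (by omega)
      refine (Polynomial.natDegree_mul_le).trans ?_
      have := Polynomial.natDegree_X_le (R := ℂ)
      omega
    · have := sub_smul_dslope f 0 l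
      rw [hpf] at this
      simp only [smul_eq_mul, sub_zero] at this
      simp only [Polynomial.eval_add, Polynomial.eval_mul, Polynomial.eval_X, Polynomial.eval_C]
      rw [this]
      ring

theorem exists_polynomial_of_isBigO {f : ℂ → ℂ} (hf : Differentiable ℂ f) {N : ℕ}
    (h : f =O[infty] fun l => l ^ N) :
    ∃ p : Polynomial ℂ, p.natDegree ≤ N ∧ ∀ l, f l = p.eval l := by
  obtain ⟨C, R, hCR⟩ := exists_bound_of_isBigO_infty hf.continuous h
  exact exists_polynomial_of_bound hf hCR

/-! ### The logarithm with cut along the negative imaginary axis -/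

theorem cutLog_of_re_pos {l : ℂ} (h : 0 < l.re) : cutLog l = Complex.log l := by
  have hl : l ≠ 0 := fun h0 => by simp [h0] at h
  have ha := abs_lt.1 (Complex.abs_arg_lt_pi_div_two_iff.2 (Or.inl h))
  have hpi := Real.pi_pos
  rw [cutLog, Complex.log_mul (by simp) hl, Complex.log_neg_I]
  · ring
  · rw [Complex.arg_neg_I]
    constructor <;> linarith

theorem cutLog_of_re_neg {l : ℂ} (h : l.re < 0) :
    cutLog l = Complex.log (-l) + Real.pi * Complex.I := by
  have h' : 0 < (-l).re := by simpa using h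
  have hl : -l ≠ 0 := fun h0 => by simp [h0] at h'
  have ha := abs_lt.1 (Complex.abs_arg_lt_pi_div_two_iff.2 (Or.inl h'))
  have hpi := Real.pi_pos
  rw [cutLog, show -Complex.I * l = Complex.I * -l by ring,
    Complex.log_mul (by simp) hl, Complex.log_I]
  · ring
  · rw [Complex.arg_I]
    constructor <;> linarith

theorem cutLog_of_mem_quad3 {l : ℂ} (h : l ∈ quad3) :
    cutLog l = Complex.log (Complex.I * l) + 3 * Real.pi / 2 * Complex.I := by
  have h1 : 0 < (Complex.I * l).re := by simpa using h.2
  have h2 : (Complex.I * l).im < 0 := by simpa using h.1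
  have hl : Complex.I * l ≠ 0 := fun h0 => by simp [h0] at h1
  have ha := abs_lt.1 (Complex.abs_arg_lt_pi_div_two_iff.2 (Or.inl h1))
  have ha2 := Complex.arg_neg_iff.2 h2
  have hpi := Real.pi_pos
  rw [cutLog, show -Complex.I * l = -1 * (Complex.I * l) by ring,
    Complex.log_mul (by simp) hl, Complex.log_neg_one]
  · ring
  · rw [Complex.arg_neg_one]
    constructor <;> linarith

theorem cutLog_of_mem_quad4 {l : ℂ} (h : l ∈ quad4) :
    cutLog l = Complex.log (Complex.I * l) - Real.pi / 2 * Complex.I := by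
  have h1 : 0 < (Complex.I * l).re := by simpa using h.2
  have h2 : 0 < (Complex.I * l).im := by simpa using h.1
  have hl : Complex.I * l ≠ 0 := fun h0 => by simp [h0] at h1
  have h3 : (-Complex.I * l).im < 0 := by simpa using h.1
  have ha2 := Complex.arg_neg_iff.2 h3
  have ha3 := Complex.neg_pi_lt_arg (-Complex.I * l)
  have hpi := Real.pi_pos
  have hl' : -Complex.I * l ≠ 0 := by rwa [neg_mul, neg_ne_zero]
  have : Complex.log (Complex.I * l) = Complex.log (-1) + Complex.log (-Complex.I * l) := by
    rw [← Complex.log_mul (by simp) hl']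
    · ring_nf
    · rw [Complex.arg_neg_one]
      constructor <;> linarith
  rw [cutLog, this, Complex.log_neg_one]
  ring

theorem exp_cutLog {l : ℂ} (hl : l ≠ 0) : Complex.exp (cutLog l) = l := by
  rw [cutLog, Complex.exp_add, Complex.exp_log (by simpa using hl), Complex.exp_pi_div_two_mul_I]
  linear_combination (-l) * Complex.I_mul_I

/-- On each half-plane or quadrant below, the cut power is a constant phase times a principal power
of a rotated variable lying in the right half-plane. These phases must match those of the connection
formula. -/
theorem exp_mul_cutLog_of_re_pos {l : ℂ} (h : 0 < l.re) (a : ℂ) :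
    Complex.exp (a * cutLog l) = l ^ a := by
  rw [Complex.cpow_def_of_ne_zero (fun h0 => by simp [h0] at h), cutLog_of_re_pos h, mul_comm]

theorem exp_mul_cutLog_of_re_neg {l : ℂ} (h : l.re < 0) (a : ℂ) :
    Complex.exp (a * cutLog l) = cis a * (-l) ^ a := by
  rw [Complex.cpow_def_of_ne_zero (fun h0 => by simp [neg_eq_zero.1 h0] at h), cutLog_of_re_neg h,
    cis, ← Complex.exp_add]
  ring_nf

theorem exp_mul_cutLog_of_im_pos {l : ℂ} (h : 0 < l.im) (a : ℂ) :
    Complex.exp (a * cutLog l) = cis (a / 2) * (-Complex.I * l) ^ a := by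
  have hl : l ≠ 0 := fun h0 => by simp [h0] at h
  rw [Complex.cpow_def_of_ne_zero (by simpa using hl), cutLog, cis, ← Complex.exp_add]
  ring_nf

theorem exp_mul_cutLog_of_mem_quad3 {l : ℂ} (h : l ∈ quad3) (a : ℂ) :
    Complex.exp (a * cutLog l) = cis (3 * a / 2) * (Complex.I * l) ^ a := by
  have hl : l ≠ 0 := fun h0 => by simpa [h0] using h.1
  rw [Complex.cpow_def_of_ne_zero (by simpa using hl), cutLog_of_mem_quad3 h, cis,
    ← Complex.exp_add]
  ring_nf

theorem exp_mul_cutLog_of_mem_quad4 {l : ℂ} (h : l ∈ quad4) (a : ℂ) :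
    Complex.exp (a * cutLog l) = cis (-a / 2) * (Complex.I * l) ^ a := by
  have hl : l ≠ 0 := fun h0 => by simpa [h0] using h.1
  rw [Complex.cpow_def_of_ne_zero (by simpa using hl), cutLog_of_mem_quad4 h, cis,
    ← Complex.exp_add]
  ring_nf

/-! ### The model matrix -/

/-- The excluded values of ν are the zeros of 1/Γ(-ν), where the solutions decaying to the left and
to the right become dependent. -/
theorem pcfGamma_ne_zero {ν : ℝ} (hν : ∀ n : ℕ, ν ≠ n) : pcfGamma ν ≠ 0 := by
  refine mul_ne_zero (by simp [Real.sqrt_eq_zero', Real.pi_pos]) (inv_ne_zero (Complex.Gamma_ne_zero fun n h => ?_))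
  exact hν n (by exact_mod_cast neg_injective h)

/-- The normalisation constant of the first row of the model matrix. -/
def modelConst (ν : ℝ) : ℂ := 2 ^ (ν / 2 : ℂ) * cis (-ν) * (pcfGamma ν)⁻¹ * ν

/-- The columns of this entire matrix are the solutions that decay to the left and to the right. -/
def pcfB (ν : ℝ) (s l : ℂ) : Mat :=
  Complex.exp (-((l + s) ^ 2 / 2)) •
    !![-(modelConst ν * cis ν * pcfF (ν - 1) (-((√2 : ℝ) * (l + s)))),
        modelConst ν * pcfF (ν - 1) ((√2 : ℝ) * (l + s));
      2 ^ (-ν / 2 : ℂ) * cis ν * pcfF ν (-((√2 : ℝ) * (l + s))),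
        2 ^ (-ν / 2 : ℂ) * pcfF ν ((√2 : ℝ) * (l + s))]

/-- A matrix function that is constant on each of the four quadrants. -/
def onQuadrants (A₁ A₂ A₃ A₄ : Mat) (l : ℂ) : Mat :=
  if 0 < l.re then (if 0 < l.im then A₁ else A₄) else (if 0 < l.im then A₂ else A₃)

/-- The matrices that turn `pcfB` into the model matrix. -/
def pcfK (ν : ℝ) : ℂ → Mat :=
  onQuadrants !![1, 0; -1, 1] !![1, 1; -1, 0] !![cis (-(2 * ν)), 1; -1, 0]
    !![1, 0; -cis (2 * ν), 1]

/-- The model matrix, with its exponential behaviour at infinity removed. -/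
def pcfW (ν : ℝ) (s l : ℂ) : Mat :=
  pcfB ν s l * pcfK ν l * expSigma (-((l + s) ^ 2 / 2 - ν * cutLog l))

section
variable {A₁ A₂ A₃ A₄ : Mat} {l : ℂ}

theorem onQuadrants_of_mem_quad1 (h : l ∈ quad1) : onQuadrants A₁ A₂ A₃ A₄ l = A₁ := by
  rw [onQuadrants, if_pos h.1, if_pos h.2]

theorem onQuadrants_of_mem_quad2 (h : l ∈ quad2) : onQuadrants A₁ A₂ A₃ A₄ l = A₂ := by
  rw [onQuadrants, if_neg h.1.le.not_gt, if_pos h.2]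

theorem onQuadrants_of_mem_quad3 (h : l ∈ quad3) : onQuadrants A₁ A₂ A₃ A₄ l = A₃ := by
  rw [onQuadrants, if_neg h.1.le.not_gt, if_neg h.2.le.not_gt]

theorem onQuadrants_of_mem_quad4 (h : l ∈ quad4) : onQuadrants A₁ A₂ A₃ A₄ l = A₄ := by
  rw [onQuadrants, if_pos h.1, if_neg h.2.le.not_gt]

end

/-- The function with the asymptotic series of `IsPcfSeries`, on a rotated half-plane. -/
def pcfBase (μ : ℝ) (w s l : ℂ) : ℂ :=
  2 ^ (-μ / 2 : ℂ) * (w * l) ^ (-μ : ℂ) * pcfF μ ((√2 : ℝ) * (w * (l + s)))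

/-- Substituting wλ for λ moves the expansion to a rotated half-plane; s becomes ws and the gauge
1/(wλ) is rescaled back to 1/λ. -/
theorem IsPcfSeries.hasExpansion_pcfBase {μ : ℝ} {d : ℂ → PowerSeries ℂ} (h : IsPcfSeries μ d)
    {w : ℂ} (hw : w ≠ 0) (s : ℂ) :
    HasExpansion (Bornology.cobounded ℂ ⊓ 𝓟 {l | 0 < (w * l).re}) (fun l => l⁻¹)
      (pcfBase μ w s) (PowerSeries.rescale w⁻¹ (d (w * s))) := by
  have ht : Tendsto (fun l => w * l) (Bornology.cobounded ℂ ⊓ 𝓟 {l | 0 < (w * l).re})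
      rightInfty := by
    refine tendsto_inf.2 ⟨?_, tendsto_principal.2 ?_⟩
    · exact (tendsto_mul_left_cobounded hw).mono_left inf_le_left
    · exact mem_inf_of_right (mem_principal_self _)
  have h1 := (h.hasExpansion (w * s)).comp_tendsto ht
  refine HasExpansion.rescale ((h1.congr' ?_).congr_gauge ?_)
  · refine Eventually.of_forall fun l => ?_
    simp only [Function.comp_apply, pcfBase, mul_add]
  · refine Eventually.of_forall fun l => ?_
    simp only [Function.comp_apply, mul_inv]

/-- The asymptotic series of `2^{-μ/2} λ^{-μ} F_μ(√2(λ+s))`. -/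
def pcfSeries (μ : ℝ) : ℂ → PowerSeries ℂ := (exists_isPcfSeries μ).choose

theorem isPcfSeries_pcfSeries (μ : ℝ) : IsPcfSeries μ (pcfSeries μ) :=
  (exists_isPcfSeries μ).choose_spec

/-- The asymptotic series of the model matrix. -/
def pcfWSeries (ν : ℝ) (s : ℂ) : Matrix (Fin 2) (Fin 2) (PowerSeries ℂ) :=
  !![PowerSeries.rescale Complex.I (pcfSeries (-ν) (-Complex.I * s)),
      PowerSeries.X * (PowerSeries.C (modelConst ν * 2 ^ ((ν - 1) / 2 : ℂ)) * pcfSeries (ν - 1) s);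
    PowerSeries.X * (PowerSeries.C (2 ^ (-ν - 1 / 2 : ℂ) * pcfGamma ν * cis ν) *
        PowerSeries.rescale Complex.I (pcfSeries (-ν - 1) (-Complex.I * s))),
      pcfSeries ν s]

theorem cis_sub_one (x : ℂ) : cis (x - 1) = -cis x := by
  have h := cis_add (x - 1) 1
  rw [sub_add_cancel, cis_one] at h
  rw [h]; ring

/-! ### The model matrix in each quadrant -/

section
variable {ν : ℝ} (hν : ∀ n : ℕ, ν ≠ n) (s l : ℂ)

theorem exp_half_sq (l s : ℂ) : Complex.exp (-((l + s) ^ 2 / 2)) *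
    Complex.exp (((√2 : ℝ) * (l + s)) ^ 2 / 2) = Complex.exp ((l + s) ^ 2 / 2) := by
  have h2 : ((√2 : ℝ) : ℂ) ^ 2 = 2 := by
    rw [← Complex.ofReal_pow, Real.sq_sqrt (by norm_num)]; simp
  rw [mul_pow, h2, ← Complex.exp_add]
  ring_nf

theorem exp_half_sq' (l s : ℂ) : Complex.exp (-((l + s) ^ 2 / 2)) *
    Complex.exp ((-((√2 : ℝ) * (l + s))) ^ 2 / 2) = Complex.exp ((l + s) ^ 2 / 2) := by
  rw [neg_sq, exp_half_sq]

/-- By the connection formula, the first column of `pcfK` in the upper half-plane selects the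
solution that is small towards +i∞; its asymptotics are those of index -ν - 1 in the variable -iλ.
-/
theorem pcfB_upper_one : pcfB ν s l 1 0 - pcfB ν s l 1 1 = Complex.exp ((l + s) ^ 2 / 2) *
    (-(2 ^ (-ν / 2 : ℂ) * pcfGamma ν * cis ((ν + 1) / 2)) *
      pcfF (-ν - 1) ((√2 : ℝ) * (-Complex.I * (l + s)))) := by
  have h := pcfF_connection ν ((√2 : ℝ) * (l + s))
  have e := exp_half_sq l s
  simp only [pcfB, Matrix.smul_apply, Matrix.of_apply, Matrix.cons_val', Matrix.cons_val_zero,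
    Matrix.cons_val_one, Matrix.cons_val_fin_one, smul_eq_mul]
  rw [h, ← e, mul_left_comm ((√2 : ℝ) : ℂ)]
  ring

/-- The connection formula at -z instead of z; the factor cis(2ν) is the price of the phase cis ν in
the first column of `pcfB`. -/
theorem pcfB_lower_one : pcfB ν s l 1 0 - cis (2 * ν) * pcfB ν s l 1 1 =
    Complex.exp ((l + s) ^ 2 / 2) * (2 ^ (-ν / 2 : ℂ) * cis ν * pcfGamma ν * cis ((ν + 1) / 2) *
      pcfF (-ν - 1) ((√2 : ℝ) * (Complex.I * (l + s)))) := by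
  have h := pcfF_connection ν (-((√2 : ℝ) * (l + s)))
  have e := exp_half_sq' l s
  simp only [pcfB, Matrix.smul_apply, Matrix.of_apply, Matrix.cons_val', Matrix.cons_val_zero,
    Matrix.cons_val_one, Matrix.cons_val_fin_one, smul_eq_mul]
  rw [h, ← e, mul_left_comm ((√2 : ℝ) : ℂ), two_mul, cis_add, neg_neg,
    neg_mul_neg]
  ring

include hν in
-- The constant `modelConst` is chosen for this: it makes the upper left series of the model start
-- with 1.
theorem modelConst_mul : modelConst ν * pcfGamma (ν - 1) = -(2 ^ (ν / 2 : ℂ) * cis (-ν)) := by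
  have h := mul_pcfGamma_sub_one (ν : ℂ)
  have h0 := pcfGamma_ne_zero hν
  rw [modelConst, mul_assoc, h]
  field_simp

include hν in
theorem pcfB_upper_zero : pcfB ν s l 0 0 - pcfB ν s l 0 1 = Complex.exp ((l + s) ^ 2 / 2) *
    (2 ^ (ν / 2 : ℂ) * cis (-ν) * cis (ν / 2) *
      pcfF (-ν) ((√2 : ℝ) * (-Complex.I * (l + s)))) := by
  have h := pcfF_connection (ν - 1) ((√2 : ℝ) * (l + s))
  have e := exp_half_sq l s
  have hm := modelConst_mul hν
  rw [sub_add_cancel, show -((ν : ℂ) - 1) - 1 = -ν by ring, cis_sub_one] at h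
  simp only [pcfB, Matrix.smul_apply, Matrix.of_apply, Matrix.cons_val', Matrix.cons_val_zero,
    Matrix.cons_val_one, Matrix.cons_val_fin_one, smul_eq_mul]
  rw [h, ← e, mul_left_comm ((√2 : ℝ) : ℂ)]
  linear_combination (-Complex.exp (-((l + s) ^ 2 / 2)) *
    Complex.exp (((√2 : ℝ) * (l + s)) ^ 2 / 2) * cis (ν / 2) *
      pcfF (-ν) (-Complex.I * ((√2 : ℝ) * (l + s)))) * hm

include hν in
theorem pcfB_lower_zero : pcfB ν s l 0 0 - cis (2 * ν) * pcfB ν s l 0 1 =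
    Complex.exp ((l + s) ^ 2 / 2) * (2 ^ (ν / 2 : ℂ) * cis (ν / 2) *
      pcfF (-ν) ((√2 : ℝ) * (Complex.I * (l + s)))) := by
  have h := pcfF_connection (ν - 1) (-((√2 : ℝ) * (l + s)))
  have e := exp_half_sq' l s
  have hm := modelConst_mul hν
  have hc := cis_neg_mul_self ν
  rw [sub_add_cancel, show -((ν : ℂ) - 1) - 1 = -ν by ring, cis_sub_one, neg_neg,
    neg_mul_neg] at h
  simp only [pcfB, Matrix.smul_apply, Matrix.of_apply, Matrix.cons_val', Matrix.cons_val_zero,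
    Matrix.cons_val_one, Matrix.cons_val_fin_one, smul_eq_mul]
  rw [h, ← e, mul_left_comm ((√2 : ℝ) : ℂ), two_mul, cis_add]
  have hc' : cis (ν : ℂ) * cis (-ν) = 1 := by rw [mul_comm, hc]
  linear_combination (-Complex.exp (-((l + s) ^ 2 / 2)) *
    Complex.exp ((-((√2 : ℝ) * (l + s))) ^ 2 / 2) * cis (ν / 2) *
      pcfF (-ν) (Complex.I * ((√2 : ℝ) * (l + s)))) * (cis ν * hm - 2 ^ (ν / 2 : ℂ) * hc')

end

section
variable {ν : ℝ} {s l : ℂ}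

theorem pcfW_apply_zero (i : Fin 2) : pcfW ν s l i 0 =
    (pcfB ν s l i 0 * pcfK ν l 0 0 + pcfB ν s l i 1 * pcfK ν l 1 0) *
      (Complex.exp (-((l + s) ^ 2 / 2)) * Complex.exp (ν * cutLog l)) := by
  rw [← Complex.exp_add, pcfW]
  simp only [Matrix.mul_apply, Fin.sum_univ_two, expSigma, Matrix.of_apply, Matrix.cons_val', Matrix.cons_val_zero,
    Matrix.cons_val_one, Matrix.cons_val_fin_one, mul_zero, add_zero]
  ring_nf

theorem pcfW_apply_one (i : Fin 2) : pcfW ν s l i 1 =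
    (pcfB ν s l i 0 * pcfK ν l 0 1 + pcfB ν s l i 1 * pcfK ν l 1 1) *
      (Complex.exp ((l + s) ^ 2 / 2) * Complex.exp (-ν * cutLog l)) := by
  rw [← Complex.exp_add, pcfW]
  simp only [Matrix.mul_apply, Fin.sum_univ_two, expSigma, Matrix.of_apply, Matrix.cons_val', Matrix.cons_val_zero,
    Matrix.cons_val_one, Matrix.cons_val_fin_one, mul_zero, zero_add]
  ring_nf

theorem pcfK_of_re_pos (h : 0 < l.re) : pcfK ν l 0 1 = 0 ∧ pcfK ν l 1 1 = 1 := by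
  rw [pcfK, onQuadrants, if_pos h]
  split_ifs <;> simp

theorem pcfK_of_re_neg (h : l.re < 0) : pcfK ν l 0 1 = 1 ∧ pcfK ν l 1 1 = 0 := by
  rw [pcfK, onQuadrants, if_neg h.le.not_gt]
  split_ifs <;> simp

theorem pcfK_of_im_pos (h : 0 < l.im) : pcfK ν l 0 0 = 1 ∧ pcfK ν l 1 0 = -1 := by
  rw [pcfK, onQuadrants]
  split_ifs <;> simp

theorem exp_mul_exp_neg (x : ℂ) : Complex.exp (-x) * Complex.exp x = 1 := by
  rw [← Complex.exp_add]; simp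

theorem two_cpow_half_mul (a b : ℂ) (c : ℂ) (h : a + b = c) : (2 : ℂ) ^ a * 2 ^ b = 2 ^ c := by
  rw [← two_cpow_add, h]

theorem cpow_sub_one' {z : ℂ} (hz : z ≠ 0) (a : ℂ) : z ^ a = z ^ (a + 1) * z⁻¹ := by
  rw [Complex.cpow_add _ _ hz, Complex.cpow_one]
  field_simp

/-- In both right quadrants the second column of `pcfK` is (0, 1), so the model uses the
right-decaying solution. Lowering the index by one in the top row costs the factor 1/λ. -/
theorem pcfW_of_re_pos (h : 0 < l.re) :
    pcfW ν s l 0 1 = l⁻¹ * (modelConst ν * 2 ^ ((ν - 1) / 2 : ℂ) * pcfBase (ν - 1) 1 s l) ∧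
      pcfW ν s l 1 1 = pcfBase ν 1 s l := by
  have hl : l ≠ 0 := fun h0 => by simp [h0] at h
  have he := exp_mul_exp_neg ((l + s) ^ 2 / 2)
  constructor
  · rw [pcfW_apply_one, (pcfK_of_re_pos h).1, (pcfK_of_re_pos h).2, exp_mul_cutLog_of_re_pos h,
      pcfBase, cpow_sub_one' hl]
    have h2 := two_cpow_half_mul ((ν - 1) / 2) (-(ν - 1) / 2) 0 (by ring)
    rw [Complex.cpow_zero] at h2
    push_cast
    rw [one_mul, one_mul, show -((ν : ℂ) - 1) = -ν + 1 by ring] at *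
    simp only [pcfB, Matrix.smul_apply, Matrix.of_apply, Matrix.cons_val', Matrix.cons_val_zero,
      Matrix.cons_val_one, Matrix.cons_val_fin_one, smul_eq_mul]
    linear_combination (modelConst ν * pcfF (ν - 1) ((√2 : ℝ) * (l + s)) *
      l ^ (-ν + 1 : ℂ) * l⁻¹) * (he - h2)
  · rw [pcfW_apply_one, (pcfK_of_re_pos h).1, (pcfK_of_re_pos h).2, exp_mul_cutLog_of_re_pos h,
      pcfBase]
    rw [one_mul, one_mul]
    simp only [pcfB, Matrix.smul_apply, Matrix.of_apply, Matrix.cons_val', Matrix.cons_val_zero,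
      Matrix.cons_val_one, Matrix.cons_val_fin_one, smul_eq_mul]
    linear_combination (2 ^ (-ν / 2 : ℂ) * pcfF ν ((√2 : ℝ) * (l + s)) * l ^ (-ν : ℂ)) * he

theorem pcfW_of_re_neg (h : l.re < 0) :
    pcfW ν s l 0 1 = l⁻¹ * (modelConst ν * 2 ^ ((ν - 1) / 2 : ℂ) * pcfBase (ν - 1) (-1) s l) ∧
      pcfW ν s l 1 1 = pcfBase ν (-1) s l := by
  have hl : -l ≠ 0 := fun h0 => by simp [neg_eq_zero.1 h0] at h
  have he := exp_mul_exp_neg ((l + s) ^ 2 / 2)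
  have hc := cis_neg_mul_self ν
  have hz : (√2 : ℝ) * (-1 * (l + s)) = -((√2 : ℝ) * (l + s)) := by ring
  constructor
  · rw [pcfW_apply_one, (pcfK_of_re_neg h).1, (pcfK_of_re_neg h).2, exp_mul_cutLog_of_re_neg h,
      pcfBase, cpow_sub_one' hl, inv_neg, hz, neg_one_mul l]
    have h2 := two_cpow_half_mul ((ν - 1) / 2) (-(ν - 1) / 2) 0 (by ring)
    rw [Complex.cpow_zero] at h2
    push_cast
    rw [show -((ν : ℂ) - 1) = -ν + 1 by ring] at *
    simp only [pcfB, Matrix.smul_apply, Matrix.of_apply, Matrix.cons_val', Matrix.cons_val_zero,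
      Matrix.cons_val_one, Matrix.cons_val_fin_one, smul_eq_mul]
    linear_combination (modelConst ν * pcfF (ν - 1) (-((√2 : ℝ) * (l + s))) *
      (-l) ^ (-ν + 1 : ℂ) * l⁻¹) * (cis (-ν) * cis ν * he + hc - h2)
  · rw [pcfW_apply_one, (pcfK_of_re_neg h).1, (pcfK_of_re_neg h).2, exp_mul_cutLog_of_re_neg h,
      pcfBase, hz, neg_one_mul l]
    simp only [pcfB, Matrix.smul_apply, Matrix.of_apply, Matrix.cons_val', Matrix.cons_val_zero,
      Matrix.cons_val_one, Matrix.cons_val_fin_one, smul_eq_mul]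
    linear_combination (2 ^ (-ν / 2 : ℂ) * pcfF ν (-((√2 : ℝ) * (l + s))) * (-l) ^ (-ν : ℂ)) *
      (cis (-ν) * cis ν * he + hc)

theorem pcfW_of_im_pos (hν : ∀ n : ℕ, ν ≠ n) (h : 0 < l.im) :
    pcfW ν s l 0 0 = pcfBase (-ν) (-Complex.I) s l ∧
      pcfW ν s l 1 0 = l⁻¹ * (2 ^ (-ν - 1 / 2 : ℂ) * pcfGamma ν * cis ν *
        pcfBase (-ν - 1) (-Complex.I) s l) := by
  have hl : l ≠ 0 := fun h0 => by simp [h0] at h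
  have hil : -Complex.I * l ≠ 0 := by simpa using hl
  have he := exp_mul_exp_neg ((l + s) ^ 2 / 2)
  constructor
  · have hB := pcfB_upper_zero hν s l
    rw [pcfW_apply_zero, (pcfK_of_im_pos h).1, (pcfK_of_im_pos h).2, exp_mul_cutLog_of_im_pos h,
      pcfBase, show ∀ a b : ℂ, a * 1 + b * -1 = a - b by intros; ring, hB]
    push_cast
    rw [neg_neg]
    have hc : cis (-(ν : ℂ)) * cis (ν / 2) * cis (ν / 2) = 1 := by
      rw [mul_assoc, ← cis_add, add_halves, cis_neg_mul_self]
    linear_combination (2 ^ (ν / 2 : ℂ) * pcfF (-ν) ((√2 : ℝ) * (-Complex.I * (l + s))) *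
      (-Complex.I * l) ^ (ν : ℂ)) * (hc + cis (-(ν : ℂ)) * cis (ν / 2) * cis (ν / 2) * he)
  · have hB := pcfB_upper_one (ν := ν) s l
    rw [pcfW_apply_zero, (pcfK_of_im_pos h).1, (pcfK_of_im_pos h).2, exp_mul_cutLog_of_im_pos h,
      pcfBase, show ∀ a b : ℂ, a * 1 + b * -1 = a - b by intros; ring, hB]
    push_cast
    rw [show -(-(ν : ℂ) - 1) = ν + 1 by ring, cpow_sub_one' hil ν]
    have hc : cis ((ν + 1) / 2 : ℂ) * cis (ν / 2) = cis ν * Complex.I := by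
      rw [← cis_add, ← cis_half, ← cis_add]; ring_nf
    have h2 := two_cpow_half_mul (-ν - 1 / 2) ((ν + 1) / 2) (-ν / 2) (by ring)
    have hi : (-Complex.I * l)⁻¹ * Complex.I = -l⁻¹ := by
      rw [mul_inv, inv_neg, Complex.inv_I, neg_neg]
      linear_combination l⁻¹ * Complex.I_mul_I
    rw [← h2]
    linear_combination (-(2 ^ (-ν - 1 / 2 : ℂ) * 2 ^ ((ν + 1) / 2 : ℂ)) * pcfGamma ν *
      pcfF (-ν - 1) ((√2 : ℝ) * (-Complex.I * (l + s))) * (-Complex.I * l) ^ (ν + 1 : ℂ)) *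
      (cis ((ν + 1) / 2 : ℂ) * cis (ν / 2) * (-Complex.I * l)⁻¹ * he +
        (-Complex.I * l)⁻¹ * hc + cis ν * hi)

theorem pcfW_of_mem_quad4 (hν : ∀ n : ℕ, ν ≠ n) (h : l ∈ quad4) :
    pcfW ν s l 0 0 = pcfBase (-ν) Complex.I s l ∧
      pcfW ν s l 1 0 = l⁻¹ * (2 ^ (-ν - 1 / 2 : ℂ) * pcfGamma ν * cis ν *
        pcfBase (-ν - 1) Complex.I s l) := by
  have hl : l ≠ 0 := fun h0 => by simpa [h0] using h.1
  have hil : Complex.I * l ≠ 0 := by simpa using hl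
  have he := exp_mul_exp_neg ((l + s) ^ 2 / 2)
  have hK : pcfK ν l 0 0 = 1 ∧ pcfK ν l 1 0 = -cis (2 * ν) := by
    rw [pcfK, onQuadrants_of_mem_quad4 h]; simp
  constructor
  · have hB := pcfB_lower_zero hν s l
    rw [pcfW_apply_zero, hK.1, hK.2, exp_mul_cutLog_of_mem_quad4 h,
      pcfBase, show ∀ a b c : ℂ, a * 1 + b * -c = a - c * b by intros; ring, hB]
    push_cast
    rw [neg_neg]
    have hc : cis (-ν / 2 : ℂ) * cis (ν / 2) = 1 := by rw [neg_div, cis_neg_mul_self]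
    linear_combination (2 ^ (ν / 2 : ℂ) * pcfF (-ν) ((√2 : ℝ) * (Complex.I * (l + s))) *
      (Complex.I * l) ^ (ν : ℂ)) * (hc + cis (-ν / 2 : ℂ) * cis (ν / 2) * he)
  · have hB := pcfB_lower_one (ν := ν) s l
    rw [pcfW_apply_zero, hK.1, hK.2, exp_mul_cutLog_of_mem_quad4 h,
      pcfBase, show ∀ a b c : ℂ, a * 1 + b * -c = a - c * b by intros; ring, hB]
    push_cast
    rw [show -(-(ν : ℂ) - 1) = ν + 1 by ring, cpow_sub_one' hil ν]
    have hc : cis ((ν + 1) / 2 : ℂ) * cis (-ν / 2) = Complex.I := by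
      rw [← cis_add, ← cis_half]; ring_nf
    have h2 := two_cpow_half_mul (-ν - 1 / 2) ((ν + 1) / 2) (-ν / 2) (by ring)
    have hi : (Complex.I * l)⁻¹ * Complex.I = l⁻¹ := by
      rw [mul_inv, Complex.inv_I]
      linear_combination -l⁻¹ * Complex.I_mul_I
    rw [← h2]
    linear_combination ((2 ^ (-ν - 1 / 2 : ℂ) * 2 ^ ((ν + 1) / 2 : ℂ)) * pcfGamma ν * cis ν *
      pcfF (-ν - 1) ((√2 : ℝ) * (Complex.I * (l + s))) * (Complex.I * l) ^ (ν + 1 : ℂ)) *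
      (cis ((ν + 1) / 2 : ℂ) * cis (-ν / 2) * (Complex.I * l)⁻¹ * he +
        (Complex.I * l)⁻¹ * hc + hi)

/-- The third and fourth quadrants lie on opposite sides of the cut. The extra factor cis(-2ν) in
the third-quadrant `pcfK` compensates the change of phase of λ^ν, so the same function results in
both. -/
theorem pcfW_of_mem_quad3 (hν : ∀ n : ℕ, ν ≠ n) (h : l ∈ quad3) :
    pcfW ν s l 0 0 = pcfBase (-ν) Complex.I s l ∧
      pcfW ν s l 1 0 = l⁻¹ * (2 ^ (-ν - 1 / 2 : ℂ) * pcfGamma ν * cis ν *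
        pcfBase (-ν - 1) Complex.I s l) := by
  have hl : l ≠ 0 := fun h0 => by simpa [h0] using h.1
  have hil : Complex.I * l ≠ 0 := by simpa using hl
  have he := exp_mul_exp_neg ((l + s) ^ 2 / 2)
  have hK : pcfK ν l 0 0 = cis (-(2 * ν)) ∧ pcfK ν l 1 0 = -1 := by
    rw [pcfK, onQuadrants_of_mem_quad3 h]; simp
  have h2ν := cis_neg_mul_self (2 * ν)
  have hK' : ∀ a b : ℂ, a * cis (-(2 * ν)) + b * -1 = cis (-(2 * ν)) * (a - cis (2 * ν) * b) := by
    intro a b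
    linear_combination b * h2ν
  constructor
  · have hB := pcfB_lower_zero hν s l
    rw [pcfW_apply_zero, hK.1, hK.2, exp_mul_cutLog_of_mem_quad3 h, pcfBase, hK', hB]
    push_cast
    rw [neg_neg]
    have hc : cis (-(2 * ν) : ℂ) * cis (3 * ν / 2) * cis (ν / 2) = 1 := by
      rw [← cis_add, ← cis_add, show -(2 * ν) + 3 * ν / 2 + ν / 2 = (0 : ℂ) by ring]
      simp [cis]
    linear_combination (2 ^ (ν / 2 : ℂ) * pcfF (-ν) ((√2 : ℝ) * (Complex.I * (l + s))) *
      (Complex.I * l) ^ (ν : ℂ)) *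
        (hc + cis (-(2 * ν) : ℂ) * cis (3 * ν / 2) * cis (ν / 2) * he)
  · have hB := pcfB_lower_one (ν := ν) s l
    rw [pcfW_apply_zero, hK.1, hK.2, exp_mul_cutLog_of_mem_quad3 h, pcfBase, hK', hB]
    push_cast
    rw [show -(-(ν : ℂ) - 1) = ν + 1 by ring, cpow_sub_one' hil ν]
    have hc : cis (-(2 * ν) : ℂ) * cis ((ν + 1) / 2 : ℂ) * cis (3 * ν / 2) = Complex.I := by
      rw [← cis_add, ← cis_add, ← cis_half]; ring_nf
    have h2 := two_cpow_half_mul (-ν - 1 / 2) ((ν + 1) / 2) (-ν / 2) (by ring)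
    have hi : (Complex.I * l)⁻¹ * Complex.I = l⁻¹ := by
      rw [mul_inv, Complex.inv_I]
      linear_combination -l⁻¹ * Complex.I_mul_I
    rw [← h2]
    linear_combination ((2 ^ (-ν - 1 / 2 : ℂ) * 2 ^ ((ν + 1) / 2 : ℂ)) * pcfGamma ν * cis ν *
      pcfF (-ν - 1) ((√2 : ℝ) * (Complex.I * (l + s))) * (Complex.I * l) ^ (ν + 1 : ℂ)) *
      (cis (-(2 * ν) : ℂ) * cis ((ν + 1) / 2 : ℂ) * cis (3 * ν / 2) * (Complex.I * l)⁻¹ * he +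
        (Complex.I * l)⁻¹ * hc + hi)

end

/-! ### One expansion of the model in all directions -/

theorem pcfBase_one_series (μ : ℝ) (s : ℂ) (S : Set ℂ) (hS : ∀ l ∈ S, 0 < l.re) :
    HasExpansion (Bornology.cobounded ℂ ⊓ 𝓟 S) (fun l => l⁻¹) (pcfBase μ 1 s) (pcfSeries μ s) := by
  have h := (isPcfSeries_pcfSeries μ).hasExpansion_pcfBase one_ne_zero s
  rw [inv_one, PowerSeries.rescale_one, one_mul] at h
  exact h.mono (inf_le_inf_left _ (principal_mono.2 fun l hl => by simpa using hS l hl))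

/-- The parity rule `IsPcfSeries.neg` makes the sign of the gauge cancel the sign of s, so left and
right half-planes share one series. The same rule joins the lower to the upper half-plane. -/
theorem pcfBase_neg_one_series (μ : ℝ) (s : ℂ) (S : Set ℂ) (hS : ∀ l ∈ S, l.re < 0) :
    HasExpansion (Bornology.cobounded ℂ ⊓ 𝓟 S) (fun l => l⁻¹) (pcfBase μ (-1) s)
      (pcfSeries μ s) := by
  have h := (isPcfSeries_pcfSeries μ).hasExpansion_pcfBase (neg_ne_zero.2 one_ne_zero) s
  rw [neg_one_mul, (isPcfSeries_pcfSeries μ).neg, PowerSeries.rescale_rescale, inv_neg, inv_one,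
    neg_one_mul, neg_neg, PowerSeries.rescale_one] at h
  exact h.mono (inf_le_inf_left _ (principal_mono.2 fun l hl => by simpa using hS l hl))

theorem pcfBase_neg_I_series (μ : ℝ) (s : ℂ) (S : Set ℂ) (hS : ∀ l ∈ S, 0 < l.im) :
    HasExpansion (Bornology.cobounded ℂ ⊓ 𝓟 S) (fun l => l⁻¹) (pcfBase μ (-Complex.I) s)
      (PowerSeries.rescale Complex.I (pcfSeries μ (-Complex.I * s))) := by
  have h := (isPcfSeries_pcfSeries μ).hasExpansion_pcfBase (neg_ne_zero.2 Complex.I_ne_zero) s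
  rw [inv_neg, Complex.inv_I, neg_neg] at h
  exact h.mono (inf_le_inf_left _ (principal_mono.2 fun l hl => by simpa using hS l hl))

theorem pcfBase_I_series (μ : ℝ) (s : ℂ) (S : Set ℂ) (hS : ∀ l ∈ S, l.im < 0) :
    HasExpansion (Bornology.cobounded ℂ ⊓ 𝓟 S) (fun l => l⁻¹) (pcfBase μ Complex.I s)
      (PowerSeries.rescale Complex.I (pcfSeries μ (-Complex.I * s))) := by
  have h := (isPcfSeries_pcfSeries μ).hasExpansion_pcfBase Complex.I_ne_zero s
  rw [show Complex.I * s = -(-Complex.I * s) by ring, (isPcfSeries_pcfSeries μ).neg,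
    PowerSeries.rescale_rescale, Complex.inv_I, neg_mul_neg, one_mul] at h
  exact h.mono (inf_le_inf_left _ (principal_mono.2 fun l hl => by simpa using hS l hl))

theorem offAxes_eq : offAxes = (quad1 ∪ quad2) ∪ (quad3 ∪ quad4) := by
  ext l
  constructor
  · rintro ⟨h1, h2⟩
    rcases lt_or_gt_of_ne h1 with h1 | h1 <;> rcases lt_or_gt_of_ne h2 with h2 | h2
    · exact Or.inr (Or.inl ⟨h1, h2⟩)
    · exact Or.inl (Or.inr ⟨h1, h2⟩)
    · exact Or.inr (Or.inr ⟨h1, h2⟩)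
    · exact Or.inl (Or.inl ⟨h1, h2⟩)
  · rintro ((h | h) | h | h)
    exacts [⟨h.1.ne', h.2.ne'⟩, ⟨h.1.ne, h.2.ne'⟩, ⟨h.1.ne, h.2.ne⟩, ⟨h.1.ne', h.2.ne⟩]

theorem HasExpansion.of_quadrants {x f : ℂ → ℂ} {c : PowerSeries ℂ}
    (h1 : HasExpansion (Bornology.cobounded ℂ ⊓ 𝓟 quad1) x f c)
    (h2 : HasExpansion (Bornology.cobounded ℂ ⊓ 𝓟 quad2) x f c)
    (h3 : HasExpansion (Bornology.cobounded ℂ ⊓ 𝓟 quad3) x f c)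
    (h4 : HasExpansion (Bornology.cobounded ℂ ⊓ 𝓟 quad4) x f c) :
    HasExpansion infty x f c := by
  rw [infty, offAxes_eq, ← sup_principal, ← sup_principal, ← sup_principal]
  simp only [inf_sup_left]
  exact (h1.sup h2).sup (h3.sup h4)

/-- The asymptotic expansion of the model matrix, uniformly in all directions. -/
theorem hasExpansion_pcfW {ν : ℝ} (hν : ∀ n : ℕ, ν ≠ n) (s : ℂ) (i j : Fin 2) :
    HasExpansion infty (fun l => l⁻¹) (fun l => pcfW ν s l i j) (pcfWSeries ν s i j) := by
  have hx : ∀ S : Set ℂ, Tendsto (fun l : ℂ => l⁻¹) (Bornology.cobounded ℂ ⊓ 𝓟 S) (𝓝 0) :=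
    tendsto_inv_cobounded_inf
  have hmem : ∀ S : Set ℂ, ∀ᶠ l in Bornology.cobounded ℂ ⊓ 𝓟 S, l ∈ S :=
    fun S => mem_inf_of_right (mem_principal_self _)
  have hbase : ∀ {S : Set ℂ} {f : ℂ → ℂ} {μ : ℝ} {w a : ℂ} {d : PowerSeries ℂ},
      HasExpansion (Bornology.cobounded ℂ ⊓ 𝓟 S) (fun l => l⁻¹) (pcfBase μ w s) d →
      (∀ l ∈ S, f l = l⁻¹ * (a * pcfBase μ w s l)) →
      HasExpansion (Bornology.cobounded ℂ ⊓ 𝓟 S) (fun l => l⁻¹) f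
        (PowerSeries.X * (PowerSeries.C a * d)) := fun {S} _ _ _ a _ hd hf =>
    ((HasExpansion.gauge (hx S)).mul (hx S) (hd.const_mul (hx S) a)).congr'
      ((hmem S).mono fun l hl => (hf l hl).symm)
  have hbase' : ∀ {S : Set ℂ} {f g : ℂ → ℂ} {d : PowerSeries ℂ},
      HasExpansion (Bornology.cobounded ℂ ⊓ 𝓟 S) (fun l => l⁻¹) g d →
      (∀ l ∈ S, f l = g l) → HasExpansion (Bornology.cobounded ℂ ⊓ 𝓟 S) (fun l => l⁻¹) f d :=
    fun {S} _ _ _ hd hf => hd.congr' ((hmem S).mono fun l hl => (hf l hl).symm)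
  fin_cases i <;> fin_cases j
  · exact .of_quadrants
      (hbase' (pcfBase_neg_I_series _ s _ fun l hl => hl.2) fun l hl => (pcfW_of_im_pos hν hl.2).1)
      (hbase' (pcfBase_neg_I_series _ s _ fun l hl => hl.2) fun l hl => (pcfW_of_im_pos hν hl.2).1)
      (hbase' (pcfBase_I_series _ s _ fun l hl => hl.2) fun l hl => (pcfW_of_mem_quad3 hν hl).1)
      (hbase' (pcfBase_I_series _ s _ fun l hl => hl.2) fun l hl => (pcfW_of_mem_quad4 hν hl).1)
  · exact .of_quadrants
      (hbase (pcfBase_one_series _ s _ fun l hl => hl.1) fun l hl => (pcfW_of_re_pos hl.1).1)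
      (hbase (pcfBase_neg_one_series _ s _ fun l hl => hl.1) fun l hl => (pcfW_of_re_neg hl.1).1)
      (hbase (pcfBase_neg_one_series _ s _ fun l hl => hl.1) fun l hl => (pcfW_of_re_neg hl.1).1)
      (hbase (pcfBase_one_series _ s _ fun l hl => hl.1) fun l hl => (pcfW_of_re_pos hl.1).1)
  · exact .of_quadrants
      (hbase (pcfBase_neg_I_series _ s _ fun l hl => hl.2) fun l hl => (pcfW_of_im_pos hν hl.2).2)
      (hbase (pcfBase_neg_I_series _ s _ fun l hl => hl.2) fun l hl => (pcfW_of_im_pos hν hl.2).2)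
      (hbase (pcfBase_I_series _ s _ fun l hl => hl.2) fun l hl => (pcfW_of_mem_quad3 hν hl).2)
      (hbase (pcfBase_I_series _ s _ fun l hl => hl.2) fun l hl => (pcfW_of_mem_quad4 hν hl).2)
  · exact .of_quadrants
      (hbase' (pcfBase_one_series _ s _ fun l hl => hl.1) fun l hl => (pcfW_of_re_pos hl.1).2)
      (hbase' (pcfBase_neg_one_series _ s _ fun l hl => hl.1) fun l hl => (pcfW_of_re_neg hl.1).2)
      (hbase' (pcfBase_neg_one_series _ s _ fun l hl => hl.1) fun l hl => (pcfW_of_re_neg hl.1).2)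
      (hbase' (pcfBase_one_series _ s _ fun l hl => hl.1) fun l hl => (pcfW_of_re_pos hl.1).2)

theorem constantCoeff_rescale (a : ℂ) (d : PowerSeries ℂ) :
    PowerSeries.constantCoeff (PowerSeries.rescale a d) = PowerSeries.constantCoeff d := by
  rw [← PowerSeries.coeff_zero_eq_constantCoeff_apply, PowerSeries.coeff_rescale]
  simp

theorem constantCoeff_pcfWSeries (ν : ℝ) (s : ℂ) (i j : Fin 2) :
    PowerSeries.constantCoeff (pcfWSeries ν s i j) = (1 : Mat) i j := by
  fin_cases i <;> fin_cases j <;>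
    simp [pcfWSeries, (isPcfSeries_pcfSeries _).constantCoeff, constantCoeff_rescale]

theorem tendsto_inv_infty : Tendsto (fun l : ℂ => l⁻¹) infty (𝓝 0) := tendsto_inv_cobounded_inf _

instance : infty.NeBot := by
  rw [← frequently_true_iff_neBot]
  intro h
  obtain ⟨R, hR⟩ := eventually_infty.1 h
  have hlt : R < ‖((|R| + 1 : ℝ) : ℂ) * (1 + Complex.I)‖ := by
    refine lt_of_lt_of_le ?_ (Complex.abs_re_le_norm _)
    have := le_abs_self R
    have := abs_nonneg R
    simp only [Complex.re_ofReal_mul, Complex.add_re, Complex.one_re, Complex.I_re, add_zero,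
      mul_one]
    rw [abs_of_pos (by linarith)]
    linarith
  refine hR _ ⟨?_, ?_⟩ hlt trivial
  · have := abs_nonneg R
    simp only [Complex.re_ofReal_mul, Complex.add_re, Complex.one_re, Complex.I_re, add_zero,
      mul_one]
    linarith
  · have := abs_nonneg R
    simp only [Complex.im_ofReal_mul, Complex.add_im, Complex.one_im, Complex.I_im, zero_add,
      mul_one]
    linarith

theorem tendsto_inv_infty' : Tendsto (fun l : ℂ => l⁻¹) infty (𝓝[≠] 0) := by
  refine tendsto_nhdsWithin_iff.2 ⟨tendsto_inv_infty, ?_⟩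
  filter_upwards [mem_inf_of_right (mem_principal_self offAxes)] with l hl
  refine inv_ne_zero fun h => ?_
  rw [h] at hl
  exact hl.1 rfl

theorem differentiable_pcfB (ν : ℝ) (s : ℂ) (i j : Fin 2) :
    Differentiable ℂ fun l => pcfB ν s l i j := by
  have h : ∀ μ a : ℂ, Differentiable ℂ fun l => pcfF μ (a * (l + s)) := fun μ a =>
    (differentiable_pcfF μ).comp (by fun_prop)
  have h1 := fun μ => h μ ((√2 : ℝ) : ℂ)
  have h2 := fun μ => h μ (-((√2 : ℝ) : ℂ))
  simp only [neg_mul] at h2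
  fin_cases i <;> fin_cases j <;> simp only [pcfB] <;> simp <;> fun_prop

theorem det_pcfK (ν : ℝ) (l : ℂ) : (pcfK ν l).det = 1 := by
  have := cis_neg_mul_self (2 * ν)
  rw [pcfK, onQuadrants]
  split_ifs <;> simp [Matrix.det_fin_two]

theorem det_expSigma (x : ℂ) : (expSigma x).det = 1 := by
  simp [expSigma, Matrix.det_fin_two, ← Complex.exp_add]

theorem det_pcfW (ν : ℝ) (s l : ℂ) : (pcfW ν s l).det = (pcfB ν s l).det := by
  rw [pcfW, Matrix.det_mul, Matrix.det_mul, det_pcfK, det_expSigma, mul_one, mul_one]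

/-- The factors relating `pcfW` to `pcfB` have determinant 1, so the entire function det `pcfB`
tends to 1 at infinity, and Liouville's theorem applies. -/
theorem det_pcfB {ν : ℝ} (hν : ∀ n : ℕ, ν ≠ n) (s l : ℂ) : (pcfB ν s l).det = 1 := by
  have hd : Differentiable ℂ fun l => (pcfB ν s l).det := by
    have := differentiable_pcfB ν s
    simp only [Matrix.det_fin_two]
    exact ((this 0 0).mul (this 1 1)).sub ((this 0 1).mul (this 1 0))
  have ht : Tendsto (fun l => (pcfB ν s l).det) infty (𝓝 1) := by
    have h := fun i j => (hasExpansion_pcfW hν s i j).tendsto tendsto_inv_infty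
    simp only [constantCoeff_pcfWSeries] at h
    have := ((h 0 0).mul (h 1 1)).sub ((h 0 1).mul (h 1 0))
    simp only [← Matrix.det_fin_two, det_pcfW] at this
    simpa [Matrix.det_fin_two] using this
  obtain ⟨p, hp, hpf⟩ := exists_polynomial_of_isBigO (N := 0) hd (by simpa using ht.isBigO_one ℂ)
  obtain ⟨c, rfl⟩ := Polynomial.natDegree_eq_zero.1 (Nat.le_zero.1 hp)
  simp only [Polynomial.eval_C] at hpf
  rw [hpf]
  simp only [hpf] at ht
  exact tendsto_nhds_unique tendsto_const_nhds ht

/-! ### The jump matrices -/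

theorem cis_half_int_sq (k : ℤ) : cis (k / 2) * cis (k / 2) = cis k := by
  rw [← cis_add, add_halves]

theorem cis_int_sq (k : ℤ) : cis k * cis k = 1 := by
  rw [← cis_add, cis, show ((k : ℂ) + k) * (Real.pi * Complex.I) = k * (2 * Real.pi * Complex.I) by
    ring, Complex.exp_int_mul_two_pi_mul_I]

/-- The diagonal matrix that removes the dependence of the jumps on `k`. -/
def jumpScale (k : ℤ) : Mat := Matrix.diagonal ![1, cis (k / 2)]

/-- The inverse of `jumpScale`. -/
def jumpScaleInv (k : ℤ) : Mat := Matrix.diagonal ![1, cis (-(k / 2))]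

theorem jumpScale_eq (k : ℤ) : jumpScale k = !![1, 0; 0, cis (k / 2)] := by
  ext i j
  fin_cases i <;> fin_cases j <;> simp [jumpScale]

theorem jumpScale_mul_inv (k : ℤ) : jumpScale k * jumpScaleInv k = 1 := by
  rw [jumpScale, jumpScaleInv, Matrix.diagonal_mul_diagonal, ← Matrix.diagonal_one]
  congr 1
  ext i
  have := cis_neg_mul_self (k / 2)
  fin_cases i
  · simp
  · simpa [mul_comm] using this

/-- The value of `pcfK` in the first quadrant. -/
def pcfK₁ : Mat := !![1, 0; -1, 1]

/-- The value of `pcfK` in the second quadrant. -/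
def pcfK₂ : Mat := !![1, 1; -1, 0]

/-- The value of `pcfK` in the third quadrant. -/
def pcfK₃ (ν : ℝ) : Mat := !![cis (-(2 * ν)), 1; -1, 0]

/-- The value of `pcfK` in the fourth quadrant. -/
def pcfK₄ (ν : ℝ) : Mat := !![1, 0; -cis (2 * ν), 1]

theorem pcfK_eq (ν : ℝ) : pcfK ν = onQuadrants pcfK₁ pcfK₂ (pcfK₃ ν) (pcfK₄ ν) := rfl

section
variable (ν : ℝ) (k : ℤ)

/-- For integer k the square of cis k is 1, so k enters only through cis(∓k/2), which conjugation by
`jumpScale` removes. -/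
theorem stokes₁_eq : stokes₁ (-(k / 2)) (ν + k / 2) = cis (-(k / 2)) * (cis (2 * ν) - 1) := by
  have h1 := cis_half_int_sq k
  have h2 := cis_int_sq k
  have h3 := cis_neg_mul_self (k / 2)
  have h4 := cis_neg_mul_self ν
  simp only [stokes₁, mul_assoc, ← cis.eq_1]
  rw [show (ν : ℂ) + k / 2 - -(k / 2) = ν + k by ring, neg_add, cis_add, cis_add, cis_add, two_mul,
    cis_add]
  have h5 := cis_neg_mul_self k
  have h6 : cis (k / 2 : ℂ) * cis k = cis (-(k / 2)) := by
    linear_combination (-cis (k / 2 : ℂ) * cis k) * h3 + cis (-(k / 2 : ℂ)) * cis k * h1 +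
      cis (-(k / 2 : ℂ)) * h2
  have h7 : cis (-k : ℂ) * cis (k / 2) = cis (-(k / 2)) := by rw [← cis_add]; ring_nf
  linear_combination cis ν * cis ν * h6 - cis (-k : ℂ) * cis (k / 2) * h4 - h7

theorem stokes₂_eq : stokes₂ (-(k / 2)) = cis (k / 2) := by
  simp only [stokes₂, mul_assoc, ← cis.eq_1, neg_neg]

theorem stokes₃_eq : stokes₃ (-(k / 2)) (ν + k / 2) = cis (-(k / 2)) * (cis (-(2 * ν)) - 1) := by
  have h4 := cis_neg_mul_self ν
  simp only [stokes₃, mul_assoc, ← cis.eq_1]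
  rw [show (ν : ℂ) + k / 2 + -(k / 2) = ν by ring, neg_add, cis_add, two_mul, neg_add, cis_add]
  linear_combination (-cis (-(k / 2 : ℂ))) * h4

theorem stokes₄_eq : stokes₄ (-(k / 2)) (ν + k / 2) = -(cis (2 * ν) * cis (k / 2)) := by
  simp only [stokes₄, mul_assoc, ← cis.eq_1]
  rw [← cis_add]
  ring_nf

theorem connection_eq : connection (-(k / 2)) (ν + k / 2) =
    lowerTri (-(cis (2 * ν) * cis (-(k / 2)))) := by
  have h2 := cis_int_sq k
  simp only [connection, mul_assoc, ← cis.eq_1]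
  rw [show 2 * ((ν : ℂ) + k / 2) - -(k / 2) = 2 * ν + (k + k + -(k / 2)) by ring, cis_add, cis_add,
    cis_add, h2, one_mul]

theorem expSigma_two_pi : expSigma (2 * Real.pi * Complex.I * (ν + k / 2)) =
    cis k • !![cis (2 * ν), 0; 0, cis (-(2 * ν))] := by
  have h1 : Complex.exp (2 * Real.pi * Complex.I * (ν + k / 2)) = cis (2 * ν) * cis k := by
    rw [← cis_add, cis]; ring_nf
  have h2 : Complex.exp (-(2 * Real.pi * Complex.I * (ν + k / 2))) =
      cis (-(2 * ν)) * cis k := by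
    have h3 : cis (-k : ℂ) = cis k := by
      linear_combination cis (-k : ℂ) * (-cis_int_sq k) + cis k * cis_neg_mul_self k
    rw [← h3, ← cis_add, cis]; ring_nf
  rw [expSigma, h1, h2]
  ext i j
  fin_cases i <;> fin_cases j <;> simp [mul_comm]

/-- The model, conjugated by `jumpScale`, has exactly the special jump on the positive real axis;
the next three identities treat the other half-axes. -/
theorem pcfK₄_jump : pcfK₄ ν * jumpScale k * lowerTri (stokes₁ (-(k / 2)) (ν + k / 2)) =
    pcfK₁ * jumpScale k := by
  have h3 := cis_neg_mul_self (k / 2)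
  rw [stokes₁_eq]
  ext i j
  fin_cases i <;> fin_cases j <;>
    simp [pcfK₄, pcfK₁, lowerTri, jumpScale_eq, Matrix.mul_apply, Fin.sum_univ_two]
  linear_combination (cis (2 * ν) - 1) * h3

theorem pcfK₁_jump : pcfK₁ * jumpScale k * upperTri (stokes₂ (-(k / 2))) =
    pcfK₂ * jumpScale k := by
  rw [stokes₂_eq]
  ext i j
  fin_cases i <;> fin_cases j <;>
    simp [pcfK₂, pcfK₁, upperTri, jumpScale_eq, Matrix.mul_apply, Fin.sum_univ_two]

theorem pcfK₂_jump : pcfK₂ * jumpScale k * lowerTri (stokes₃ (-(k / 2)) (ν + k / 2)) =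
    pcfK₃ ν * jumpScale k := by
  have h3 := cis_neg_mul_self (k / 2)
  rw [stokes₃_eq]
  ext i j
  fin_cases i <;> fin_cases j <;>
    simp [pcfK₂, pcfK₃, lowerTri, jumpScale_eq, Matrix.mul_apply, Fin.sum_univ_two]
  linear_combination (cis (-(2 * ν)) - 1) * h3

/-- Across the cut the sign cis k = (-1)^k is left over; the scalar λ^{∓k/2} changes by the same
sign there. -/
theorem pcfK₃_jump : pcfK₃ ν * jumpScale k * (upperTri (stokes₄ (-(k / 2)) (ν + k / 2)) *
    expSigma (2 * Real.pi * Complex.I * (ν + k / 2))) = cis k • (pcfK₄ ν * jumpScale k) := by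
  have h3 := cis_neg_mul_self (2 * ν)
  rw [stokes₄_eq, expSigma_two_pi]
  ext i j
  fin_cases i <;> fin_cases j <;>
    simp [pcfK₄, pcfK₃, upperTri, jumpScale_eq, Matrix.mul_apply, Fin.sum_univ_two]
  · linear_combination cis k * h3
  · linear_combination (-(cis k) * cis (-(2 * ν)) * cis (k / 2)) * h3
  · linear_combination (cis k) * cis (k / 2) * h3

/-- The connection matrix is the fourth-quadrant factor of the model up to conjugation, so near 0
the inverse of C undoes the same constants that remove the jumps. -/
theorem jumpScale_mul_connection : jumpScale k * connection (-(k / 2)) (ν + k / 2) =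
    pcfK₄ ν * jumpScale k := by
  have h3 := cis_neg_mul_self (k / 2)
  rw [connection_eq]
  ext i j
  fin_cases i <;> fin_cases j <;>
    simp [pcfK₄, lowerTri, jumpScale_eq, Matrix.mul_apply, Fin.sum_univ_two]
  linear_combination (cis (2 * ν)) * h3

end

/-! ### Matrix-valued functions -/

section
variable {M M' : ℂ → Mat} {S : Set ℂ} {F : Filter ℂ}

theorem differentiableOn_mul (h : ∀ i j, DifferentiableOn ℂ (fun l => M l i j) S)
    (h' : ∀ i j, DifferentiableOn ℂ (fun l => M' l i j) S) (i j : Fin 2) :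
    DifferentiableOn ℂ (fun l => (M l * M' l) i j) S := by
  simp only [Matrix.mul_apply, Fin.sum_univ_two]
  exact ((h i 0).mul (h' 0 j)).add ((h i 1).mul (h' 1 j))

theorem isBigO_const_mul_mat {g : Fin 2 → ℂ → ℂ} (C : Mat)
    (h : ∀ i j, (fun l => M l i j) =O[F] g j) (i j : Fin 2) :
    (fun l => (C * M l) i j) =O[F] g j := by
  simp only [Matrix.mul_apply, Fin.sum_univ_two]
  exact ((h 0 j).const_mul_left _).add ((h 1 j).const_mul_left _)

theorem isBigO_mul_mat {g g' : ℂ → ℂ} (h : ∀ i j, (fun l => M l i j) =O[F] g)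
    (h' : ∀ i j, (fun l => M' l i j) =O[F] g') (i j : Fin 2) :
    (fun l => (M l * M' l) i j) =O[F] fun l => g l * g' l := by
  simp only [Matrix.mul_apply, Fin.sum_univ_two]
  exact ((h i 0).mul (h' 0 j)).add ((h i 1).mul (h' 1 j))

theorem tendsto_mat_iff {A : Mat} :
    Tendsto M F (𝓝 A) ↔ ∀ i j, Tendsto (fun l => M l i j) F (𝓝 (A i j)) :=
  ⟨fun h i j => ((continuous_id.matrix_elem i j).tendsto A).comp h,
    fun h => tendsto_pi_nhds.2 fun i => tendsto_pi_nhds.2 fun j => h i j⟩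

theorem adjugate_apply_mem {p : (ℂ → ℂ) → Prop} (hneg : ∀ f, p f → p fun l => -f l)
    (h : ∀ i j, p fun l => M l i j) (i j : Fin 2) : p fun l => (M l).adjugate i j := by
  simp only [Matrix.adjugate_fin_two]
  fin_cases i <;> fin_cases j <;> simp
  exacts [h 1 1, hneg _ (h 0 1), hneg _ (h 1 0), h 0 0]

end

theorem jump_inv {K K' σ σ' J : Mat} {τ : ℂ} (hσ : σ * σ' = 1) (hK : K.det = 1) (hK' : K'.det = 1)
    (h : K' * σ * J = τ • (K * σ)) : J * (σ' * K⁻¹) = τ • (σ' * K'⁻¹) := by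
  have hσ' : σ' * σ = 1 := mul_eq_one_comm.1 hσ
  have h1 : K * K⁻¹ = 1 := Matrix.mul_nonsing_inv K (by simp [hK])
  have h2 : K'⁻¹ * K' = 1 := Matrix.nonsing_inv_mul K' (by simp [hK'])
  calc J * (σ' * K⁻¹) = (σ' * (K'⁻¹ * K') * σ) * J * (σ' * K⁻¹) := by
        rw [h2, mul_one, hσ', one_mul]
    _ = σ' * K'⁻¹ * (K' * σ * J) * (σ' * K⁻¹) := by simp only [mul_assoc]
    _ = τ • (σ' * K'⁻¹ * (K * (σ * σ') * K⁻¹)) := by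
        rw [h]; simp only [mul_assoc, Matrix.mul_smul, Matrix.smul_mul]
    _ = _ := by rw [hσ, mul_one, h1, mul_one]

/-! ### Continuity of the scalar factor -/

theorem differentiableAt_cutLog {l : ℂ} (h : l.re ≠ 0 ∨ 0 < l.im) : DifferentiableAt ℂ cutLog l := by
  have : -Complex.I * l ∈ Complex.slitPlane := by
    rw [Complex.mem_slitPlane_iff]
    rcases h with h | h
    · right; simpa using h
    · left; simpa using h
  exact ((Complex.differentiableAt_log this).comp l (by fun_prop)).add_const _

theorem differentiableAt_exp_cutLog {l : ℂ} (h : l.re ≠ 0 ∨ 0 < l.im) (a : ℂ) :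
    DifferentiableAt ℂ (fun l => Complex.exp (a * cutLog l)) l :=
  ((differentiableAt_cutLog h).const_mul a).cexp

theorem tendsto_cpow_neg_im {x : ℝ} (hx : 0 < x) (a : ℂ) (S : Set ℂ) :
    Tendsto (fun l => (Complex.I * l) ^ a) (𝓝[S] (-x * Complex.I)) (𝓝 ((x : ℂ) ^ a)) := by
  have h : Complex.I * (-x * Complex.I) = x := by linear_combination (-x : ℂ) * Complex.I_mul_I
  have : ContinuousAt (fun l => (Complex.I * l) ^ a) (-x * Complex.I) := by
    refine ContinuousAt.comp (g := fun z : ℂ => z ^ a) (continuousAt_cpow_const ?_) (by fun_prop)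
    rw [h]
    exact Complex.ofReal_mem_slitPlane.2 hx
  have := this.tendsto
  rw [h] at this
  exact this.mono_left nhdsWithin_le_nhds

theorem tendsto_exp_cutLog_quad3 {x : ℝ} (hx : 0 < x) (a : ℂ) :
    Tendsto (fun l => Complex.exp (a * cutLog l)) (𝓝[quad3] (-x * Complex.I))
      (𝓝 (cis (3 * a / 2) * (x : ℂ) ^ a)) :=
  ((tendsto_cpow_neg_im hx a _).const_mul _).congr' (by
    filter_upwards [self_mem_nhdsWithin] with l hl
    rw [exp_mul_cutLog_of_mem_quad3 hl])

theorem tendsto_exp_cutLog_quad4 {x : ℝ} (hx : 0 < x) (a : ℂ) :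
    Tendsto (fun l => Complex.exp (a * cutLog l)) (𝓝[quad4] (-x * Complex.I))
      (𝓝 (cis (-a / 2) * (x : ℂ) ^ a)) :=
  ((tendsto_cpow_neg_im hx a _).const_mul _).congr' (by
    filter_upwards [self_mem_nhdsWithin] with l hl
    rw [exp_mul_cutLog_of_mem_quad4 hl])

theorem tendsto_exp_cutLog {p : ℂ} (h : p.re ≠ 0 ∨ 0 < p.im) (a : ℂ) (S : Set ℂ) :
    Tendsto (fun l => Complex.exp (a * cutLog l)) (𝓝[S] p) (𝓝 (Complex.exp (a * cutLog p))) :=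
  (differentiableAt_exp_cutLog h a).continuousAt.tendsto.mono_left nhdsWithin_le_nhds

theorem isOpen_quad1 : IsOpen quad1 :=
  (isOpen_lt continuous_const Complex.continuous_re).inter
    (isOpen_lt continuous_const Complex.continuous_im)

theorem isOpen_quad2 : IsOpen quad2 :=
  (isOpen_lt Complex.continuous_re continuous_const).inter
    (isOpen_lt continuous_const Complex.continuous_im)

theorem isOpen_quad3 : IsOpen quad3 :=
  (isOpen_lt Complex.continuous_re continuous_const).inter
    (isOpen_lt Complex.continuous_im continuous_const)

theorem isOpen_quad4 : IsOpen quad4 :=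
  (isOpen_lt continuous_const Complex.continuous_re).inter
    (isOpen_lt Complex.continuous_im continuous_const)

theorem differentiableOn_onQuadrants (A₁ A₂ A₃ A₄ : Mat) (i j : Fin 2) :
    DifferentiableOn ℂ (fun l => onQuadrants A₁ A₂ A₃ A₄ l i j) offAxes := by
  have key : ∀ {S : Set ℂ} {A : Mat}, IsOpen S → (∀ l ∈ S, onQuadrants A₁ A₂ A₃ A₄ l = A) →
      DifferentiableOn ℂ (fun l => onQuadrants A₁ A₂ A₃ A₄ l i j) S := fun _ h =>
    (differentiableOn_const _).congr fun l hl => by rw [h l hl]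
  have h1 := key isOpen_quad1 fun l hl => onQuadrants_of_mem_quad1 hl
  have h2 := key isOpen_quad2 fun l hl => onQuadrants_of_mem_quad2 hl
  have h3 := key isOpen_quad3 fun l hl => onQuadrants_of_mem_quad3 hl
  have h4 := key isOpen_quad4 fun l hl => onQuadrants_of_mem_quad4 hl
  rw [offAxes_eq]
  exact (h1.union_of_isOpen h2 isOpen_quad1 isOpen_quad2).union_of_isOpen
    (h3.union_of_isOpen h4 isOpen_quad3 isOpen_quad4) (isOpen_quad1.union isOpen_quad2)
    (isOpen_quad3.union isOpen_quad4)

theorem isBigO_offAxes {f : ℂ → ℂ} {g : ℂ → ℂ} {p : ℂ} (h1 : f =O[𝓝[quad1] p] g)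
    (h2 : f =O[𝓝[quad2] p] g) (h3 : f =O[𝓝[quad3] p] g) (h4 : f =O[𝓝[quad4] p] g) :
    f =O[𝓝[offAxes] p] g := by
  rw [offAxes_eq, nhdsWithin_union, nhdsWithin_union, nhdsWithin_union]
  exact (h1.sup h2).sup (h3.sup h4)

/-! ### Reduction to polynomials -/

/-- The orders of vanishing at `0` of the two columns. -/
def exps (k : ℤ) : Fin 2 → ℕ := ![(-k).toNat, k.toNat]

/-- Entrywise evaluation of a matrix of polynomials. -/
def polyEval (P : Matrix (Fin 2) (Fin 2) (Polynomial ℂ)) (l : ℂ) : Mat := P.map fun p => p.eval l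

/-- The row normalisation of the polynomial matrix. -/
def rowScale (k : ℤ) (s : ℂ) : Fin 2 → ℂ :=
  ![Complex.exp (s ^ 2 / 2), Complex.exp (-(s ^ 2 / 2)) * cis (k / 2)]

theorem rowScale_ne_zero (k : ℤ) (s : ℂ) (i : Fin 2) : rowScale k s i ≠ 0 := by
  fin_cases i <;> simp [rowScale, cis_ne_zero]

/-- The polynomial matrix that solves the Riemann-Hilbert problem after division by the model. -/
structure IsPolyReduction (ν : ℝ) (k : ℤ) (s : ℂ) (P : Matrix (Fin 2) (Fin 2) (Polynomial ℂ))
    (A : Mat) : Prop where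
  natDegree : ∀ i j, (P i j).natDegree ≤ k.natAbs
  atZero : ∀ i j, (fun l => (polyEval P l * pcfB ν s l) i j) =O[𝓝 0] fun l => l ^ exps k j
  atInfty : ∃ A₂ : Mat, ∀ i j, (fun l => (polyEval P l * pcfW ν s l) i j -
    l ^ exps k j * (1 + l⁻¹ • A + (l ^ 2)⁻¹ • A₂) i j) =O[infty] fun l => l ^ exps k j * (l ^ 3)⁻¹

/-- This is k⁺ - k = k⁻. Multiplying by λ^{k⁺} leaves nonnegative integer powers in both columns,
whatever the sign of k. -/
theorem pow_mul_exp_cutLog {l : ℂ} (hl : l ≠ 0) (k : ℤ) :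
    l ^ k.toNat * Complex.exp (-k * cutLog l) = l ^ (-k).toNat := by
  have h : Complex.exp (-k * cutLog l) = l ^ (-k) := by
    rw [← Int.cast_neg, Complex.exp_int_mul, exp_cutLog hl]
  rw [h, ← zpow_natCast, ← zpow_natCast, ← zpow_add₀ hl]
  congr 1
  omega

/-- The right factor that removes the jumps of a solution of the Riemann-Hilbert problem. -/
def unjump (ν : ℝ) (k : ℤ) (l : ℂ) : Mat :=
  Complex.exp (-(k / 2) * cutLog l) • (jumpScaleInv k * (pcfK ν l)⁻¹)

theorem det_pcfK₁ : pcfK₁.det = 1 := by simp [pcfK₁, Matrix.det_fin_two]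

theorem det_pcfK₂ : pcfK₂.det = 1 := by simp [pcfK₂, Matrix.det_fin_two]

theorem det_pcfK₃ (ν : ℝ) : (pcfK₃ ν).det = 1 := by simp [pcfK₃, Matrix.det_fin_two]

theorem det_pcfK₄ (ν : ℝ) : (pcfK₄ ν).det = 1 := by simp [pcfK₄, Matrix.det_fin_two]

theorem tendsto_smul_const_of_mem {f : ℂ → ℂ} {N : ℂ → Mat} {p a : ℂ} {S : Set ℂ} {A : Mat}
    (hf : Tendsto f (𝓝[S] p) (𝓝 a)) (hN : ∀ l ∈ S, N l = A) :
    Tendsto (fun l => f l • N l) (𝓝[S] p) (𝓝 (a • A)) := by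
  refine (hf.smul_const A).congr' ?_
  filter_upwards [self_mem_nhdsWithin] with l hl
  rw [hN l hl]

theorem HasJump.glues {Ψ G N : ℂ → Mat} {p : ℂ} {S T : Set ℂ} {J G₁ G₂ : Mat} {c : ℂ → ℂ}
    (h : HasJump Ψ p S T J) (hS : Tendsto G (𝓝[S] p) (𝓝 G₁)) (hT : Tendsto G (𝓝[T] p) (𝓝 G₂))
    (hJ : J * G₁ = G₂) (hc : Continuous c) (hN : ∀ i j, Continuous fun l => N l i j) (D : Mat)
    (i j : Fin 2) : Glues (fun l => c l * (D * (Ψ l * G l) * N l) i j) p S T := by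
  obtain ⟨A, B, hA, hB, hAB⟩ := h
  have hN' : ∀ U, Tendsto N (𝓝[U] p) (𝓝 (N p)) := fun U =>
    tendsto_mat_iff.2 fun i j => ((hN i j).tendsto p).mono_left nhdsWithin_le_nhds
  have hc' : ∀ U, Tendsto c (𝓝[U] p) (𝓝 (c p)) := fun U =>
    (hc.tendsto p).mono_left nhdsWithin_le_nhds
  refine ⟨c p * (D * (A * G₁) * N p) i j, ?_, ?_⟩
  · exact (hc' _).mul (tendsto_mat_iff.1 (((hA.mul hS).const_mul D).mul (hN' _)) i j)
  · rw [hAB, mul_assoc B, hJ]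
    exact (hc' _).mul (tendsto_mat_iff.1 (((hB.mul hT).const_mul D).mul (hN' _)) i j)

theorem differentiableOn_unjump (ν : ℝ) (k : ℤ) (i j : Fin 2) :
    DifferentiableOn ℂ (fun l => unjump ν k l i j) offAxes := by
  have h1 : DifferentiableOn ℂ (fun l => Complex.exp (-(k / 2) * cutLog l)) offAxes := fun l hl =>
    (differentiableAt_exp_cutLog (Or.inl hl.1) _).differentiableWithinAt
  have h2 : ∀ l, (pcfK ν l)⁻¹ = onQuadrants pcfK₁⁻¹ pcfK₂⁻¹ (pcfK₃ ν)⁻¹ (pcfK₄ ν)⁻¹ l := by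
    intro l
    rw [pcfK_eq, onQuadrants, onQuadrants]
    split_ifs <;> rfl
  simp only [unjump, Matrix.smul_apply, smul_eq_mul, h2]
  exact h1.mul (differentiableOn_mul (M := fun _ => jumpScaleInv k)
    (M' := onQuadrants pcfK₁⁻¹ pcfK₂⁻¹ (pcfK₃ ν)⁻¹ (pcfK₄ ν)⁻¹)
    (fun i j => differentiableOn_const _) (differentiableOn_onQuadrants _ _ _ _) i j)

/-- The jumps of `Ψ` are removed by `unjump`. -/
theorem gluesOnAxes_of_jumps {ν : ℝ} {k : ℤ} {s : ℂ} {Ψ : ℂ → Mat} {Ψ₁ : Mat}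
    (h : IsSpecialPsi (-(k / 2)) (ν + k / 2) s Ψ Ψ₁) {c : ℂ → ℂ} (hc : Differentiable ℂ c)
    {N : ℂ → Mat} (hN : ∀ i j, Differentiable ℂ fun l => N l i j) (D : Mat) (i j : Fin 2) :
    GluesOnAxes fun l => c l * (D * (Ψ l * unjump ν k l) * N l) i j := by
  have hN' := fun i j => (hN i j).continuous
  have hc' := hc.continuous
  have hσ := jumpScale_mul_inv k
  have hJ : ∀ {K K' J : Mat} {ε ε' τ : ℂ}, K.det = 1 → K'.det = 1 →
      K' * jumpScale k * J = τ • (K * jumpScale k) → ε * τ = ε' →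
      J * (ε • (jumpScaleInv k * K⁻¹)) = ε' • (jumpScaleInv k * K'⁻¹) := by
    intro K K' J ε ε' τ hK hK' hKJ hε
    rw [Matrix.mul_smul, jump_inv hσ hK hK' hKJ, smul_smul, hε]
  have hq1 : ∀ l ∈ quad1, jumpScaleInv k * (pcfK ν l)⁻¹ = jumpScaleInv k * pcfK₁⁻¹ :=
    fun l hl => by rw [pcfK_eq, onQuadrants_of_mem_quad1 hl]
  have hq2 : ∀ l ∈ quad2, jumpScaleInv k * (pcfK ν l)⁻¹ = jumpScaleInv k * pcfK₂⁻¹ :=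
    fun l hl => by rw [pcfK_eq, onQuadrants_of_mem_quad2 hl]
  have hq3 : ∀ l ∈ quad3, jumpScaleInv k * (pcfK ν l)⁻¹ = jumpScaleInv k * (pcfK₃ ν)⁻¹ :=
    fun l hl => by rw [pcfK_eq, onQuadrants_of_mem_quad3 hl]
  have hq4 : ∀ l ∈ quad4, jumpScaleInv k * (pcfK ν l)⁻¹ = jumpScaleInv k * (pcfK₄ ν)⁻¹ :=
    fun l hl => by rw [pcfK_eq, onQuadrants_of_mem_quad4 hl]
  refine ⟨?_, fun x hx => ?_, fun x hx => ?_, fun x hx => ?_, fun x hx => ?_⟩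
  · have h1 := differentiableOn_mul h.analytic (differentiableOn_unjump ν k)
    have h2 := differentiableOn_mul (M := fun _ => D) (fun i j => differentiableOn_const _) h1
    have h3 := differentiableOn_mul h2 (fun i j => (hN i j).differentiableOn (s := offAxes))
    exact hc.differentiableOn.mul (h3 i j)
  · have hp : (x : ℂ).re ≠ 0 ∨ 0 < (x : ℂ).im := Or.inl (by simpa using hx.ne')
    exact (h.jump₁ x hx).glues (tendsto_smul_const_of_mem (tendsto_exp_cutLog hp _ _) hq1)
      (tendsto_smul_const_of_mem (tendsto_exp_cutLog hp _ _) hq4)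
      (hJ det_pcfK₁ (det_pcfK₄ ν) ((pcfK₄_jump ν k).trans (one_smul _ _).symm) (mul_one _))
      hc' hN' D i j
  · have hp : (x * Complex.I : ℂ).re ≠ 0 ∨ 0 < (x * Complex.I : ℂ).im := Or.inr (by simpa using hx)
    exact (h.jump₂ x hx).glues (tendsto_smul_const_of_mem (tendsto_exp_cutLog hp _ _) hq2)
      (tendsto_smul_const_of_mem (tendsto_exp_cutLog hp _ _) hq1)
      (hJ det_pcfK₂ det_pcfK₁ ((pcfK₁_jump k).trans (one_smul _ _).symm) (mul_one _))
      hc' hN' D i j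
  · have hp : (-x : ℂ).re ≠ 0 ∨ 0 < (-x : ℂ).im := Or.inl (by simpa using hx.ne')
    exact (h.jump₃ x hx).glues (tendsto_smul_const_of_mem (tendsto_exp_cutLog hp _ _) hq3)
      (tendsto_smul_const_of_mem (tendsto_exp_cutLog hp _ _) hq2)
      (hJ (det_pcfK₃ ν) det_pcfK₂ ((pcfK₂_jump ν k).trans (one_smul _ _).symm) (mul_one _))
      hc' hN' D i j
  · refine (h.jump₄ x hx).glues
      (tendsto_smul_const_of_mem (tendsto_exp_cutLog_quad4 hx _) hq4)
      (tendsto_smul_const_of_mem (tendsto_exp_cutLog_quad3 hx _) hq3)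
      (hJ (det_pcfK₄ ν) (det_pcfK₃ ν) (pcfK₃_jump ν k) ?_) hc' hN' D i j
    -- The phases of λ^{-k/2} on the two sides of the cut differ by cis k, the sign left over in
    -- `pcfK₃_jump`.
    have h1 : cis (-(-(k / 2)) / 2 : ℂ) * cis k = cis (3 * -(k / 2) / 2) := by
      have h2 : cis (-(-(k / 2)) / 2 : ℂ) * cis k = cis (3 * -(k / 2) / 2) * (cis k * cis k) := by
        rw [← cis_add, ← cis_add, ← cis_add]; ring_nf
      rw [h2, cis_int_sq, mul_one]
    linear_combination (x : ℂ) ^ (-(k / 2) : ℂ) * h1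

theorem isBigO_nhds_of_offAxes {f g : ℂ → ℂ} (hf : Continuous f) (hg : Continuous g) {p : ℂ}
    (h : f =O[𝓝[offAxes] p] g) : f =O[𝓝 p] g := by
  obtain ⟨C, hC⟩ := h.bound
  obtain ⟨s, hs, hso, hps⟩ := mem_nhds_iff.1 (mem_nhdsWithin_iff_eventually.1 hC)
  refine IsBigO.of_bound C ?_
  filter_upwards [hso.mem_nhds hps] with l hl
  refine le_of_tendsto_of_tendsto (b := 𝓝[offAxes] l)
    ((hf.norm.tendsto l).mono_left nhdsWithin_le_nhds)
    (((hg.norm.tendsto l).const_mul C).mono_left nhdsWithin_le_nhds) ?_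
  filter_upwards [self_mem_nhdsWithin, mem_nhdsWithin_of_mem_nhds (hso.mem_nhds hl)] with z hz hz'
  exact hs hz' hz

theorem eventually_mem_infty : ∀ᶠ l in infty, l ∈ offAxes :=
  mem_inf_of_right (mem_principal_self offAxes)

theorem ne_zero_of_mem_offAxes {l : ℂ} (hl : l ∈ offAxes) : l ≠ 0 := by
  rintro rfl
  exact hl.1 rfl

theorem isBigO_pow_infty {m n : ℕ} (h : m ≤ n) :
    (fun l : ℂ => l ^ m) =O[infty] fun l => l ^ n := by
  refine IsBigO.of_bound 1 (eventually_infty.2 ⟨1, fun l _ hl => ?_⟩)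
  rw [norm_pow, norm_pow, one_mul]
  exact pow_le_pow_right₀ hl.le h

theorem exps_le (k : ℤ) (j : Fin 2) : exps k j ≤ k.natAbs := by
  fin_cases j
  · change (-k).toNat ≤ _
    omega
  · change k.toNat ≤ _
    omega

theorem exps_add (k : ℤ) : exps k 0 + exps k 1 = k.natAbs := by
  change (-k).toNat + k.toNat = _
  omega

theorem conj_inv {K σ σ' C : Mat} (hσ : σ * σ' = 1) (hK : K.det = 1) (h : σ * C = K * σ) :
    C⁻¹ = σ' * K⁻¹ * σ := by
  have hσ' : σ' * σ = 1 := mul_eq_one_comm.1 hσ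
  have h1 : K * K⁻¹ = 1 := Matrix.mul_nonsing_inv K (by simp [hK])
  refine Matrix.inv_eq_right_inv ?_
  calc C * (σ' * K⁻¹ * σ) = σ' * (σ * C) * σ' * K⁻¹ * σ := by
        rw [← mul_assoc σ' σ C, hσ', one_mul]; simp only [mul_assoc]
    _ = σ' * (K * (σ * σ') * K⁻¹) * σ := by rw [h]; simp only [mul_assoc]
    _ = 1 := by rw [hσ, mul_one, h1, mul_one, hσ']

section
variable {ν : ℝ} {k : ℤ} {s : ℂ} {Ψ : ℂ → Mat} {Ψ₁ : Mat}

theorem unjump_mul_pcfK (ν : ℝ) (k : ℤ) (l : ℂ) :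
    unjump ν k l * pcfK ν l = Complex.exp (-(k / 2) * cutLog l) • jumpScaleInv k := by
  rw [unjump, Matrix.smul_mul, mul_assoc, Matrix.nonsing_inv_mul _ (by simp [det_pcfK]), mul_one]

theorem expSigma_eq (x : ℂ) : expSigma x = Matrix.diagonal ![Complex.exp x, Complex.exp (-x)] := by
  ext i j
  fin_cases i <;> fin_cases j <;> simp [expSigma]

/-- The model exponent (λ+s)²/2 exceeds λ²/2 + sλ by s²/2, which goes into `rowScale`; the powers of
λ combine to λ^{k⁻} and λ^{k⁺}. -/
theorem scale_at_infty {l : ℂ} (hl : l ≠ 0) (ν : ℝ) (k : ℤ) (s : ℂ) :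
    (l ^ k.toNat * Complex.exp (-(k / 2) * cutLog l)) •
      (jumpScaleInv k * expSigma (-((l + s) ^ 2 / 2 - ν * cutLog l))) =
    expSigma (-(l ^ 2 / 2 + s * l - (ν + k / 2) * cutLog l)) *
      Matrix.diagonal fun j => l ^ exps k j * (rowScale k s j)⁻¹ := by
  rw [expSigma_eq, expSigma_eq, jumpScaleInv, Matrix.diagonal_mul_diagonal,
    Matrix.diagonal_mul_diagonal, ← Matrix.diagonal_smul]
  congr 1
  ext j
  have h := pow_mul_exp_cutLog hl k
  fin_cases j
  · simp only [Pi.smul_apply, smul_eq_mul, exps, rowScale, Fin.zero_eta, Matrix.cons_val_zero,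
      one_mul, ← h, ← Complex.exp_neg]
    simp only [mul_assoc, mul_left_comm _ (l ^ k.toNat), ← Complex.exp_add]
    ring_nf
  · simp only [Pi.smul_apply, smul_eq_mul, exps, rowScale, Fin.mk_one, Matrix.cons_val_one,
      Matrix.cons_val_zero, mul_inv, ← Complex.exp_neg, cis]
    simp only [mul_assoc, mul_left_comm _ (l ^ k.toNat), ← Complex.exp_add]
    ring_nf

theorem scale_at_zero {l : ℂ} (hl : l ≠ 0) (k : ℤ) :
    (l ^ k.toNat * Complex.exp (-(k / 2) * cutLog l)) • jumpScaleInv k =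
    expSigma (-(-(k / 2)) * cutLog l) *
      Matrix.diagonal fun j => l ^ exps k j * ![1, cis (-(k / 2))] j := by
  rw [expSigma_eq, jumpScaleInv, Matrix.diagonal_mul_diagonal, ← Matrix.diagonal_smul]
  congr 1
  ext j
  have h := pow_mul_exp_cutLog hl k
  fin_cases j
  · simp only [Pi.smul_apply, smul_eq_mul, exps, Fin.zero_eta, Matrix.cons_val_zero, ← h]
    simp only [mul_left_comm _ (l ^ k.toNat), mul_one, ← Complex.exp_add]
    ring_nf
  · simp only [Pi.smul_apply, smul_eq_mul, exps, Fin.mk_one, Matrix.cons_val_one,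
      Matrix.cons_val_zero]
    ring_nf

theorem isBigO_unjump_quadrant {q : Set ℂ} (hq : q ⊆ offAxes) {K X : Mat}
    (hK : ∀ l ∈ q, pcfK ν l = K) (hX : X = jumpScaleInv k * K⁻¹ * jumpScale k)
    (h : ∀ i j, (fun l : ℂ => (Ψ l * X * expSigma (-(-(k / 2)) * cutLog l)) i j)
      =O[𝓝[q] 0] fun _ => (1 : ℂ)) (i j : Fin 2) :
    (fun l => (l ^ k.toNat • (Ψ l * unjump ν k l)) i j) =O[𝓝[q] 0] fun l => l ^ exps k j := by
  have h1 := (((h i j).mul (isBigO_refl (fun l : ℂ => l ^ exps k j) _)).const_mul_left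
    (![1, cis (-(k / 2))] j))
  refine h1.congr' ?_ (by simp)
  filter_upwards [self_mem_nhdsWithin] with l hl
  have hl0 := ne_zero_of_mem_offAxes (hq hl)
  have h2 : l ^ k.toNat • (Ψ l * unjump ν k l) = Ψ l * X * expSigma (-(-(k / 2)) * cutLog l) *
      Matrix.diagonal fun j => l ^ exps k j * ![1, cis (-(k / 2))] j := by
    rw [mul_assoc (Ψ l * X), ← scale_at_zero hl0, unjump, hK l hl, Matrix.mul_smul, Matrix.mul_smul,
      smul_smul, hX]
    simp only [mul_assoc, jumpScale_mul_inv, mul_one]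
  rw [h2, Matrix.mul_diagonal]
  ring

theorem isBigO_unjump (h : IsSpecialPsi (-(k / 2)) (ν + k / 2) s Ψ Ψ₁) (i j : Fin 2) :
    (fun l => (l ^ k.toNat • (Ψ l * unjump ν k l)) i j) =O[𝓝[offAxes] 0]
      fun l => l ^ exps k j := by
  have hσ := jumpScale_mul_inv k
  have e4 := jumpScale_mul_connection ν k
  have e1 : jumpScale k * (connection (-(k / 2)) (ν + k / 2) *
      lowerTri (stokes₁ (-(k / 2)) (ν + k / 2))) = pcfK₁ * jumpScale k := by
    rw [← mul_assoc, e4, pcfK₄_jump]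
  have e2 : jumpScale k * (connection (-(k / 2)) (ν + k / 2) *
      (lowerTri (stokes₁ (-(k / 2)) (ν + k / 2)) * upperTri (stokes₂ (-(k / 2))))) =
      pcfK₂ * jumpScale k := by
    rw [← mul_assoc, ← mul_assoc, mul_assoc (jumpScale k), e1, pcfK₁_jump]
  have e3 : jumpScale k * (connection (-(k / 2)) (ν + k / 2) *
      (lowerTri (stokes₁ (-(k / 2)) (ν + k / 2)) * upperTri (stokes₂ (-(k / 2))) *
        lowerTri (stokes₃ (-(k / 2)) (ν + k / 2)))) = pcfK₃ ν * jumpScale k := by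
    rw [← mul_assoc, ← mul_assoc, mul_assoc (jumpScale k), e2, pcfK₂_jump]
  have x1 := conj_inv hσ det_pcfK₁ e1
  have x2 := conj_inv hσ det_pcfK₂ e2
  have x3 := conj_inv hσ (det_pcfK₃ ν) e3
  have x4 := conj_inv hσ (det_pcfK₄ ν) e4
  rw [Matrix.mul_inv_rev] at x1 x2 x3
  have z1 := h.atZero₁
  have z2 := h.atZero₂
  have z3 := h.atZero₃
  simp only [mul_assoc (Ψ _) (_⁻¹) (_⁻¹)] at z1 z2 z3
  have hsub := offAxes_eq
  refine isBigO_offAxes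
    (isBigO_unjump_quadrant ?_ (fun l hl => by rw [pcfK_eq, onQuadrants_of_mem_quad1 hl]) x1 z1 i j)
    (isBigO_unjump_quadrant ?_ (fun l hl => by rw [pcfK_eq, onQuadrants_of_mem_quad2 hl]) x2 z2 i j)
    (isBigO_unjump_quadrant ?_ (fun l hl => by rw [pcfK_eq, onQuadrants_of_mem_quad3 hl]) x3 z3 i j)
    (isBigO_unjump_quadrant ?_ (fun l hl => by rw [pcfK_eq, onQuadrants_of_mem_quad4 hl]) x4
      h.atZero₄ i j)
  all_goals rw [offAxes_eq]; intro l hl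
  exacts [Or.inl (Or.inl hl), Or.inl (Or.inr hl), Or.inr (Or.inl hl), Or.inr (Or.inr hl)]

theorem isBigO_one_pcfW (hν : ∀ n : ℕ, ν ≠ n) (s : ℂ) (i j : Fin 2) :
    (fun l => (pcfW ν s l).adjugate i j) =O[infty] fun _ => (1 : ℂ) :=
  adjugate_apply_mem (p := fun f => f =O[infty] fun _ => (1 : ℂ)) (fun _ hf => hf.neg_left)
    (fun i j => (hasExpansion_pcfW hν s i j).isBigO_one) i j

theorem differentiable_adjugate_pcfB (ν : ℝ) (s : ℂ) (i j : Fin 2) :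
    Differentiable ℂ fun l => (pcfB ν s l).adjugate i j :=
  adjugate_apply_mem (p := fun f => Differentiable ℂ f) (fun _ hf => hf.neg)
    (differentiable_pcfB ν s) i j

/-- The quotient of Ψ by the model has no jumps and is bounded at 0, hence is entire; its growth at
infinity makes it polynomial. -/
theorem exists_isPolyReduction (hν : ∀ n : ℕ, ν ≠ n)
    (h : IsSpecialPsi (-(k / 2)) (ν + k / 2) s Ψ Ψ₁) : ∃ P, IsPolyReduction ν k s P
      (Matrix.of fun i j => rowScale k s i * Ψ₁ i j * (rowScale k s j)⁻¹) := by
  set D : Mat := Matrix.diagonal (rowScale k s)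
  -- Since det `pcfB` = 1, its adjugate is its inverse and is entire, so Y inherits regularity from
  -- the unjumped Ψ. The factor D makes the leading matrix at infinity the identity.
  set Y : ℂ → Mat := fun l =>
    l ^ k.toNat • (D * (Ψ l * unjump ν k l) * (pcfB ν s l).adjugate) with hY
  have hYB : ∀ l, Y l * pcfB ν s l = D * (l ^ k.toNat • (Ψ l * unjump ν k l)) := by
    intro l
    rw [hY]
    simp only [Matrix.smul_mul, Matrix.mul_smul]
    rw [mul_assoc (D * _), Matrix.adjugate_mul, det_pcfB hν, one_smul, mul_one]
  have hYW : ∀ l ≠ 0, ∀ i j, (Y l * pcfW ν s l) i j = rowScale k s i *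
      (Ψ l * expSigma (-(l ^ 2 / 2 + s * l - (ν + k / 2) * cutLog l))) i j *
        (l ^ exps k j * (rowScale k s j)⁻¹) := by
    intro l hl i j
    have h1 : Y l * pcfW ν s l = D * ((Ψ l * expSigma (-(l ^ 2 / 2 + s * l -
        (ν + k / 2) * cutLog l))) * Matrix.diagonal fun j => l ^ exps k j * (rowScale k s j)⁻¹) := by
      rw [pcfW, ← mul_assoc, ← mul_assoc, hYB, mul_assoc (Ψ l), ← scale_at_infty hl, mul_smul,
        ← Matrix.smul_mul (Complex.exp _), ← unjump_mul_pcfK ν]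
      simp only [mul_assoc, Matrix.mul_smul, Matrix.smul_mul]
    rw [h1, Matrix.diagonal_mul, Matrix.mul_diagonal]
    ring
  have hglue : ∀ i j, GluesOnAxes fun l => Y l i j := fun i j =>
    gluesOnAxes_of_jumps h (c := fun l => l ^ k.toNat) (by fun_prop)
      (differentiable_adjugate_pcfB ν s) D i j
  have hzero : ∀ i j, (fun l => (Y l * pcfB ν s l) i j) =O[𝓝[offAxes] 0] fun l => l ^ exps k j := by
    simp only [hYB]
    exact isBigO_const_mul_mat (g := fun j l => l ^ exps k j) D (isBigO_unjump h)
  have hpow : ∀ j, (fun l : ℂ => l ^ exps k j) =O[𝓝[offAxes] 0] fun _ => (1 : ℂ) := fun j =>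
    ((by fun_prop : Continuous fun l : ℂ => l ^ exps k j).tendsto 0).isBigO_one ℂ |>.mono
      nhdsWithin_le_nhds
  have hYbdd : ∀ i j, (fun l => Y l i j) =O[𝓝[offAxes] 0] fun _ => (1 : ℂ) := by
    intro i j
    have h1 := isBigO_mul_mat (fun i j => (hzero i j).trans (hpow j))
      (M' := fun l => (pcfB ν s l).adjugate) (g' := fun _ => (1 : ℂ)) (fun i j =>
        (((differentiable_adjugate_pcfB ν s i j).continuous.tendsto 0).isBigO_one ℂ).mono
          nhdsWithin_le_nhds) i j
    simpa only [mul_assoc, Matrix.mul_adjugate, det_pcfB hν, one_smul, mul_one] using h1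
  choose g hg hgY using fun i j => (hglue i j).exists_entire (hYbdd i j)
  obtain ⟨Ψ₂, hinf⟩ := h.atInfinity
  set A : Mat := Matrix.of fun i j => rowScale k s i * Ψ₁ i j * (rowScale k s j)⁻¹
  set A₂ : Mat := Matrix.of fun i j => rowScale k s i * Ψ₂ i j * (rowScale k s j)⁻¹
  have hinf' : ∀ i j, (fun l => (Y l * pcfW ν s l) i j -
      l ^ exps k j * (1 + l⁻¹ • A + (l ^ 2)⁻¹ • A₂) i j) =O[infty]
        fun l => l ^ exps k j * (l ^ 3)⁻¹ := by
    intro i j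
    have h1 := ((isBigO_refl (fun l : ℂ => l ^ exps k j) infty).mul (hinf i j)).const_mul_left
      (rowScale k s i * (rowScale k s j)⁻¹)
    refine h1.congr' ?_ EventuallyEq.rfl
    filter_upwards [eventually_mem_infty] with l hl
    rw [hYW l (ne_zero_of_mem_offAxes hl)]
    have h2 : rowScale k s i * (1 : Mat) i j * (rowScale k s j)⁻¹ = (1 : Mat) i j := by
      by_cases hij : i = j
      · subst hij
        simp [rowScale_ne_zero]
      · simp [hij]
    simp only [Matrix.sub_apply, Matrix.add_apply, Matrix.smul_apply, smul_eq_mul, A, A₂,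
      Matrix.of_apply]
    linear_combination (-l ^ exps k j) * h2
  -- Each column grows like λ to the order `exps k j`, at most |k|; multiplication by the bounded
  -- inverse of `pcfW` keeps this bound for Y.
  have hYWO : ∀ i j, (fun l => (Y l * pcfW ν s l) i j) =O[infty] fun l => l ^ k.natAbs := by
    intro i j
    have hx := tendsto_inv_infty
    have h1 : (fun l : ℂ => (1 + l⁻¹ • A + (l ^ 2)⁻¹ • A₂) i j) =O[infty] fun _ => (1 : ℂ) := by
      have : Tendsto (fun l : ℂ => (1 : Mat) i j + l⁻¹ * A i j + l⁻¹ ^ 2 * A₂ i j) infty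
          (𝓝 ((1 : Mat) i j + 0 * A i j + 0 ^ 2 * A₂ i j)) :=
        ((hx.mul_const _).const_add _).add ((hx.pow 2).mul_const _)
      simpa using this.isBigO_one ℂ
    have h2 : (fun l : ℂ => (l ^ 3)⁻¹) =O[infty] fun _ => (1 : ℂ) := by
      simpa using (hx.pow 3).isBigO_one ℂ
    have h3 := ((hinf' i j).trans ((isBigO_refl _ _).mul h2)).add
      ((isBigO_refl (fun l : ℂ => l ^ exps k j) infty).mul h1)
    simp only [sub_add_cancel, mul_one] at h3
    exact h3.trans (isBigO_pow_infty (exps_le k j))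
  have hYO : ∀ i j, (fun l => Y l i j) =O[infty] fun l => l ^ k.natAbs := by
    intro i j
    have h1 := isBigO_mul_mat hYWO (isBigO_one_pcfW hν s) i j
    simpa only [mul_assoc, Matrix.mul_adjugate, det_pcfW, det_pcfB hν, one_smul, mul_one] using h1
  have hgO : ∀ i j, g i j =O[infty] fun l => l ^ k.natAbs := fun i j =>
    (hYO i j).congr' (by
      filter_upwards [eventually_mem_infty] with l hl
      rw [hgY i j l hl]) EventuallyEq.rfl
  choose P hP hPg using fun i j => exists_polynomial_of_isBigO (hg i j) (hgO i j)
  have hPY : ∀ l ∈ offAxes, polyEval (Matrix.of P) l = Y l := by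
    intro l hl
    ext i j
    simp only [polyEval, Matrix.map_apply, Matrix.of_apply, ← hPg, hgY i j l hl]
  refine ⟨Matrix.of P, hP, fun i j => ?_, A₂, fun i j => ?_⟩
  · refine isBigO_nhds_of_offAxes ?_ (by fun_prop) ((hzero i j).congr' ?_ EventuallyEq.rfl)
    · simp only [Matrix.mul_apply, Fin.sum_univ_two, polyEval, Matrix.map_apply, Matrix.of_apply]
      exact ((Polynomial.continuous _).mul (differentiable_pcfB ν s 0 j).continuous).add
        ((Polynomial.continuous _).mul (differentiable_pcfB ν s 1 j).continuous)
    · filter_upwards [self_mem_nhdsWithin] with l hl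
      rw [hPY l hl]
  · refine (hinf' i j).congr' ?_ EventuallyEq.rfl
    filter_upwards [eventually_mem_infty] with l hl
    rw [hPY l hl]

end

/-! ### From polynomial matrices back to the Riemann-Hilbert problem -/

theorem HasJump.of_tendsto {N G : ℂ → Mat} {p : ℂ} {S T : Set ℂ} {G₁ G₂ J : Mat}
    (hN : ContinuousAt N p) (hS : Tendsto G (𝓝[S] p) (𝓝 G₁)) (hT : Tendsto G (𝓝[T] p) (𝓝 G₂))
    (hJ : G₁ = G₂ * J) : HasJump (fun l => N l * G l) p S T J :=
  ⟨N p * G₁, N p * G₂, (hN.mono_left nhdsWithin_le_nhds).mul hS,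
    (hN.mono_left nhdsWithin_le_nhds).mul hT, by rw [hJ, mul_assoc]⟩

section
variable {ν : ℝ} {k : ℤ} {s : ℂ}

/-- The factor that has the jumps of the Riemann-Hilbert problem. -/
def rejump (ν : ℝ) (k : ℤ) (l : ℂ) : Mat :=
  Complex.exp (k / 2 * cutLog l) • (pcfK ν l * jumpScale k)

/-- The solution of the Riemann-Hilbert problem that belongs to a matrix of polynomials. -/
def psiOf (ν : ℝ) (k : ℤ) (s : ℂ) (P : Matrix (Fin 2) (Fin 2) (Polynomial ℂ)) (l : ℂ) : Mat :=
  (Matrix.diagonal fun i => (rowScale k s i)⁻¹) *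
    ((l ^ k.toNat)⁻¹ • (polyEval P l * pcfB ν s l)) * rejump ν k l

theorem expSigma_mul_neg (x : ℂ) : expSigma x * expSigma (-x) = 1 := by
  rw [expSigma_eq, expSigma_eq, Matrix.diagonal_mul_diagonal, ← Matrix.diagonal_one]
  congr 1
  ext i
  fin_cases i <;> simp [← Complex.exp_add]

theorem diagonal_mul_diagonal_inv {d : Fin 2 → ℂ} (h : ∀ i, d i ≠ 0) :
    Matrix.diagonal d * Matrix.diagonal (fun i => (d i)⁻¹) = 1 := by
  rw [Matrix.diagonal_mul_diagonal, ← Matrix.diagonal_one]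
  congr 1
  ext i
  simp [h i]

theorem rescale_at_infty {l : ℂ} (hl : l ≠ 0) (ν : ℝ) (k : ℤ) (s : ℂ) :
    (l ^ k.toNat)⁻¹ • (Complex.exp (k / 2 * cutLog l) •
      (expSigma ((l + s) ^ 2 / 2 - ν * cutLog l) * jumpScale k *
        expSigma (-(l ^ 2 / 2 + s * l - (ν + k / 2) * cutLog l)))) =
    Matrix.diagonal fun j => (l ^ exps k j * (rowScale k s j)⁻¹)⁻¹ := by
  have h := scale_at_infty hl ν k s
  have hd := diagonal_mul_diagonal_inv (d := fun j => l ^ exps k j * (rowScale k s j)⁻¹)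
    fun j => mul_ne_zero (pow_ne_zero _ hl) (inv_ne_zero (rowScale_ne_zero k s j))
  set d := Matrix.diagonal fun j => l ^ exps k j * (rowScale k s j)⁻¹
  set d' := Matrix.diagonal fun j => (l ^ exps k j * (rowScale k s j)⁻¹)⁻¹
  set E2 := expSigma (-(l ^ 2 / 2 + s * l - (ν + k / 2) * cutLog l))
  have h1 : E2 = (l ^ k.toNat * Complex.exp (-(k / 2) * cutLog l)) •
      (jumpScaleInv k * expSigma (-((l + s) ^ 2 / 2 - ν * cutLog l))) * d' := by
    rw [h, mul_assoc, hd, mul_one]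
  rw [h1]
  have h2 : Complex.exp (k / 2 * cutLog l) * Complex.exp (-(k / 2) * cutLog l) = 1 := by
    rw [← Complex.exp_add]; simp
  have h3 : expSigma ((l + s) ^ 2 / 2 - ν * cutLog l) * jumpScale k *
      (jumpScaleInv k * expSigma (-((l + s) ^ 2 / 2 - ν * cutLog l))) = 1 := by
    rw [mul_assoc, ← mul_assoc (jumpScale k), jumpScale_mul_inv, one_mul, expSigma_mul_neg]
  rw [Matrix.smul_mul, Matrix.mul_smul, ← mul_assoc, h3, one_mul, smul_smul, smul_smul]
  rw [show (l ^ k.toNat)⁻¹ * Complex.exp (k / 2 * cutLog l) *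
    (l ^ k.toNat * Complex.exp (-(k / 2) * cutLog l)) = ((l ^ k.toNat)⁻¹ * l ^ k.toNat) *
    (Complex.exp (k / 2 * cutLog l) * Complex.exp (-(k / 2) * cutLog l)) by ring, h2,
    inv_mul_cancel₀ (pow_ne_zero _ hl), one_mul, one_smul]

theorem rescale_at_zero {l : ℂ} (hl : l ≠ 0) (k : ℤ) :
    (l ^ k.toNat)⁻¹ • (Complex.exp (k / 2 * cutLog l) •
      (jumpScale k * expSigma (-(-(k / 2)) * cutLog l))) =
    Matrix.diagonal fun j => (l ^ exps k j * ![1, cis (-(k / 2))] j)⁻¹ := by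
  have h := scale_at_zero hl k
  have hd := diagonal_mul_diagonal_inv (d := fun j => l ^ exps k j * ![1, cis (-(k / 2))] j)
    fun j => mul_ne_zero (pow_ne_zero _ hl) (by fin_cases j <;> simp [cis_ne_zero])
  set d := Matrix.diagonal fun j => l ^ exps k j * ![1, cis (-(k / 2))] j
  set d' := Matrix.diagonal fun j => (l ^ exps k j * ![1, cis (-(k / 2))] j)⁻¹
  have h1 : expSigma (-(-(k / 2)) * cutLog l) =
      (l ^ k.toNat * Complex.exp (-(k / 2) * cutLog l)) • jumpScaleInv k * d' := by
    rw [h, mul_assoc, hd, mul_one]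
  have h2 : Complex.exp (k / 2 * cutLog l) * Complex.exp (-(k / 2) * cutLog l) = 1 := by
    rw [← Complex.exp_add]; simp
  rw [h1, Matrix.smul_mul, Matrix.mul_smul, ← mul_assoc, jumpScale_mul_inv, one_mul, smul_smul,
    smul_smul]
  rw [show (l ^ k.toNat)⁻¹ * Complex.exp (k / 2 * cutLog l) *
    (l ^ k.toNat * Complex.exp (-(k / 2) * cutLog l)) = ((l ^ k.toNat)⁻¹ * l ^ k.toNat) *
    (Complex.exp (k / 2 * cutLog l) * Complex.exp (-(k / 2) * cutLog l)) by ring, h2,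
    inv_mul_cancel₀ (pow_ne_zero _ hl), one_mul, one_smul]

theorem differentiable_polyEval (P : Matrix (Fin 2) (Fin 2) (Polynomial ℂ)) (i j : Fin 2) :
    Differentiable ℂ fun l => polyEval P l i j := (P i j).differentiable

theorem continuousAt_psiOf_factor (P : Matrix (Fin 2) (Fin 2) (Polynomial ℂ)) {p : ℂ} (hp : p ≠ 0) :
    ContinuousAt (fun l => (Matrix.diagonal fun i => (rowScale k s i)⁻¹) *
      ((l ^ k.toNat)⁻¹ • (polyEval P l * pcfB ν s l))) p := by
  have h1 : ContinuousAt (polyEval P) p :=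
    tendsto_mat_iff.2 fun i j => (differentiable_polyEval P i j).continuous.tendsto p
  have h2 : ContinuousAt (pcfB ν s) p :=
    tendsto_mat_iff.2 fun i j => (differentiable_pcfB ν s i j).continuous.tendsto p
  have h3 : ContinuousAt (fun l : ℂ => (l ^ k.toNat)⁻¹) p :=
    (by fun_prop : ContinuousAt (fun l : ℂ => l ^ k.toNat) p).inv₀ (pow_ne_zero _ hp)
  have h4 : Tendsto (fun l => polyEval P l * pcfB ν s l) (𝓝 p)
    (𝓝 (polyEval P p * pcfB ν s p)) := Tendsto.mul h1 h2
  exact Tendsto.const_mul _ (Tendsto.smul h3 h4)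

theorem isBigO_psiOf_quadrant {P : Matrix (Fin 2) (Fin 2) (Polynomial ℂ)} {A : Mat}
    (h : IsPolyReduction ν k s P A) {q : Set ℂ} (hq : q ⊆ offAxes) {K X : Mat} (hdet : K.det = 1)
    (hK : ∀ l ∈ q, pcfK ν l = K) (hX : X = jumpScaleInv k * K⁻¹ * jumpScale k) (i j : Fin 2) :
    (fun l : ℂ => (psiOf ν k s P l * X * expSigma (-(-(k / 2)) * cutLog l)) i j)
      =O[𝓝[q] 0] fun _ => (1 : ℂ) := by
  have h1 := (((h.atZero i j).mono (nhdsWithin_le_nhds (s := q))).mul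
    (isBigO_refl (fun l : ℂ => (l ^ exps k j)⁻¹) _)).const_mul_left
    ((rowScale k s i)⁻¹ * (![1, cis (-(k / 2))] j)⁻¹)
  refine h1.congr' ?_ ?_
  · filter_upwards [self_mem_nhdsWithin] with l hl
    have hl0 := ne_zero_of_mem_offAxes (hq hl)
    have hKK : K * K⁻¹ = 1 := Matrix.mul_nonsing_inv K (by simp [hdet])
    have h2 : psiOf ν k s P l * X * expSigma (-(-(k / 2)) * cutLog l) =
        (Matrix.diagonal fun i => (rowScale k s i)⁻¹) * ((polyEval P l * pcfB ν s l) *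
          Matrix.diagonal fun j => (l ^ exps k j * ![1, cis (-(k / 2))] j)⁻¹) := by
      have h3 : K * jumpScale k * (jumpScaleInv k * K⁻¹ * jumpScale k) = jumpScale k := by
        rw [show K * jumpScale k * (jumpScaleInv k * K⁻¹ * jumpScale k) =
          K * (jumpScale k * jumpScaleInv k) * K⁻¹ * jumpScale k by simp only [mul_assoc],
          jumpScale_mul_inv, mul_one, hKK, one_mul]
      rw [← rescale_at_zero hl0, psiOf, rejump, hK l hl, hX]
      simp only [Matrix.mul_smul, Matrix.smul_mul]
      have h4 := congrArg (· * expSigma (-(-(k / 2)) * cutLog l)) h3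
      simp only [mul_assoc] at h4 ⊢
      rw [h4, smul_comm]
    rw [h2, Matrix.diagonal_mul, Matrix.mul_diagonal, mul_inv]
    ring
  · filter_upwards [self_mem_nhdsWithin] with l hl
    exact mul_inv_cancel₀ (pow_ne_zero _ (ne_zero_of_mem_offAxes (hq hl)))

/-- All jumps sit in the factor `rejump`, the rest being continuous away from 0. The two vanishing
orders in `exps` cancel the powers of λ produced at 0 and at infinity. -/
theorem IsPolyReduction.isSpecialPsi {P : Matrix (Fin 2) (Fin 2) (Polynomial ℂ)} {A : Mat}
    (h : IsPolyReduction ν k s P A) : IsSpecialPsi (-(k / 2)) (ν + k / 2) s (psiOf ν k s P)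
      (Matrix.of fun i j => (rowScale k s i)⁻¹ * A i j * rowScale k s j) := by
  have hσ := jumpScale_mul_inv k
  have hJ : ∀ {K K' J : Mat} {ε ε' τ : ℂ}, K' * jumpScale k * J = τ • (K * jumpScale k) →
      ε' * τ = ε → ε • (K * jumpScale k) = (ε' • (K' * jumpScale k)) * J := by
    intro K K' J ε ε' τ hKJ hε
    rw [Matrix.smul_mul, hKJ, smul_smul, hε]
  have hq1 : ∀ l ∈ quad1, pcfK ν l = pcfK₁ := fun l hl => onQuadrants_of_mem_quad1 hl
  have hq2 : ∀ l ∈ quad2, pcfK ν l = pcfK₂ := fun l hl => onQuadrants_of_mem_quad2 hl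
  have hq3 : ∀ l ∈ quad3, pcfK ν l = pcfK₃ ν := fun l hl => onQuadrants_of_mem_quad3 hl
  have hq4 : ∀ l ∈ quad4, pcfK ν l = pcfK₄ ν := fun l hl => onQuadrants_of_mem_quad4 hl
  have hσ1 : ∀ {S : Set ℂ} {K : Mat}, (∀ l ∈ S, pcfK ν l = K) →
      ∀ l ∈ S, pcfK ν l * jumpScale k = K * jumpScale k := fun hK l hl => by rw [hK l hl]
  have e4 := jumpScale_mul_connection ν k
  have e1 : jumpScale k * (connection (-(k / 2)) (ν + k / 2) *
      lowerTri (stokes₁ (-(k / 2)) (ν + k / 2))) = pcfK₁ * jumpScale k := by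
    rw [← mul_assoc, e4, pcfK₄_jump]
  have e2 : jumpScale k * (connection (-(k / 2)) (ν + k / 2) *
      (lowerTri (stokes₁ (-(k / 2)) (ν + k / 2)) * upperTri (stokes₂ (-(k / 2))))) =
      pcfK₂ * jumpScale k := by
    rw [← mul_assoc, ← mul_assoc, mul_assoc (jumpScale k), e1, pcfK₁_jump]
  have e3 : jumpScale k * (connection (-(k / 2)) (ν + k / 2) *
      (lowerTri (stokes₁ (-(k / 2)) (ν + k / 2)) * upperTri (stokes₂ (-(k / 2))) *
        lowerTri (stokes₃ (-(k / 2)) (ν + k / 2)))) = pcfK₃ ν * jumpScale k := by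
    rw [← mul_assoc, ← mul_assoc, mul_assoc (jumpScale k), e2, pcfK₂_jump]
  have x1 := conj_inv hσ det_pcfK₁ e1
  have x2 := conj_inv hσ det_pcfK₂ e2
  have x3 := conj_inv hσ (det_pcfK₃ ν) e3
  have x4 := conj_inv hσ (det_pcfK₄ ν) e4
  rw [Matrix.mul_inv_rev] at x1 x2 x3
  have s1 : quad1 ⊆ offAxes := offAxes_eq ▸ fun l hl => Or.inl (Or.inl hl)
  have s2 : quad2 ⊆ offAxes := offAxes_eq ▸ fun l hl => Or.inl (Or.inr hl)
  have s3 : quad3 ⊆ offAxes := offAxes_eq ▸ fun l hl => Or.inr (Or.inl hl)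
  have s4 : quad4 ⊆ offAxes := offAxes_eq ▸ fun l hl => Or.inr (Or.inr hl)
  refine ⟨fun i j => ?_, fun x hx => ?_, fun x hx => ?_, fun x hx => ?_, fun x hx => ?_, ?_,
    fun i j => ?_, fun i j => ?_, fun i j => ?_, fun i j => ?_⟩
  · have h1 : DifferentiableOn ℂ (fun l : ℂ => (l ^ k.toNat)⁻¹) offAxes :=
      DifferentiableOn.inv (by fun_prop) fun l hl => pow_ne_zero _ (ne_zero_of_mem_offAxes hl)
    have h2 := differentiableOn_mul (S := offAxes)
      (fun i j => (differentiable_polyEval P i j).differentiableOn)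
      (fun i j => (differentiable_pcfB ν s i j).differentiableOn)
    have h3 : ∀ i j, DifferentiableOn ℂ
        (fun l => ((l ^ k.toNat)⁻¹ • (polyEval P l * pcfB ν s l)) i j) offAxes :=
      fun i j => h1.mul (h2 i j)
    have h4 := differentiableOn_mul (M := fun _ => Matrix.diagonal fun i => (rowScale k s i)⁻¹)
      (fun i j => differentiableOn_const _) h3
    have h5 := differentiableOn_mul (S := offAxes) (M := pcfK ν) (M' := fun _ => jumpScale k)
      (differentiableOn_onQuadrants _ _ _ _) (fun i j => differentiableOn_const _)
    have h6 : ∀ i j, DifferentiableOn ℂ (fun l => rejump ν k l i j) offAxes := fun i j =>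
      DifferentiableOn.mul (fun l hl =>
        (differentiableAt_exp_cutLog (Or.inl hl.1) _).differentiableWithinAt) (h5 i j)
    exact differentiableOn_mul h4 h6 i j
  · have hp : (x : ℂ).re ≠ 0 ∨ 0 < (x : ℂ).im := Or.inl (by simpa using hx.ne')
    exact .of_tendsto (continuousAt_psiOf_factor P (by simpa using hx.ne'))
      (tendsto_smul_const_of_mem (tendsto_exp_cutLog hp _ _) (hσ1 hq1))
      (tendsto_smul_const_of_mem (tendsto_exp_cutLog hp _ _) (hσ1 hq4))
      (hJ ((pcfK₄_jump ν k).trans (one_smul _ _).symm) (mul_one _))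
  · have hp : (x * Complex.I : ℂ).re ≠ 0 ∨ 0 < (x * Complex.I : ℂ).im := Or.inr (by simpa using hx)
    exact .of_tendsto (continuousAt_psiOf_factor P (by simpa using hx.ne'))
      (tendsto_smul_const_of_mem (tendsto_exp_cutLog hp _ _) (hσ1 hq2))
      (tendsto_smul_const_of_mem (tendsto_exp_cutLog hp _ _) (hσ1 hq1))
      (hJ ((pcfK₁_jump k).trans (one_smul _ _).symm) (mul_one _))
  · have hp : (-x : ℂ).re ≠ 0 ∨ 0 < (-x : ℂ).im := Or.inl (by simpa using hx.ne')
    exact .of_tendsto (continuousAt_psiOf_factor P (by simpa using hx.ne'))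
      (tendsto_smul_const_of_mem (tendsto_exp_cutLog hp _ _) (hσ1 hq3))
      (tendsto_smul_const_of_mem (tendsto_exp_cutLog hp _ _) (hσ1 hq2))
      (hJ ((pcfK₂_jump ν k).trans (one_smul _ _).symm) (mul_one _))
  · refine .of_tendsto (continuousAt_psiOf_factor P (by simpa using hx.ne'))
      (tendsto_smul_const_of_mem (tendsto_exp_cutLog_quad4 hx _) (hσ1 hq4))
      (tendsto_smul_const_of_mem (tendsto_exp_cutLog_quad3 hx _) (hσ1 hq3))
      (hJ (pcfK₃_jump ν k) ?_)
    have h1 : cis (3 * (k / 2) / 2 : ℂ) * cis k = cis (-(k / 2) / 2) := by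
      have h2 : cis (3 * (k / 2) / 2 : ℂ) * cis k = cis (-(k / 2) / 2) * (cis k * cis k) := by
        rw [← cis_add, ← cis_add, ← cis_add]; ring_nf
      rw [h2, cis_int_sq, mul_one]
    linear_combination (x : ℂ) ^ (k / 2 : ℂ) * h1
  · obtain ⟨A₂, hA₂⟩ := h.atInfty
    refine ⟨Matrix.of fun i j => (rowScale k s i)⁻¹ * A₂ i j * rowScale k s j, fun i j => ?_⟩
    have h1 := ((hA₂ i j).mul (isBigO_refl (fun l : ℂ => (l ^ exps k j)⁻¹) _)).const_mul_left
      ((rowScale k s i)⁻¹ * rowScale k s j)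
    refine h1.congr' ?_ ?_
    · filter_upwards [eventually_mem_infty] with l hl
      have hl0 := ne_zero_of_mem_offAxes hl
      have h2 : psiOf ν k s P l *
          expSigma (-(l ^ 2 / 2 + s * l - (ν + k / 2) * cutLog l)) =
          (Matrix.diagonal fun i => (rowScale k s i)⁻¹) * ((polyEval P l * pcfW ν s l) *
            Matrix.diagonal fun j => (l ^ exps k j * (rowScale k s j)⁻¹)⁻¹) := by
        have h3 : expSigma (-((l + s) ^ 2 / 2 - ν * cutLog l)) *
            (expSigma ((l + s) ^ 2 / 2 - ν * cutLog l) * jumpScale k *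
            expSigma (-(l ^ 2 / 2 + s * l - (ν + k / 2) * cutLog l))) = jumpScale k *
            expSigma (-(l ^ 2 / 2 + s * l - (ν + k / 2) * cutLog l)) := by
          rw [← mul_assoc, ← mul_assoc, mul_eq_one_comm.1 (expSigma_mul_neg _), one_mul]
        rw [← rescale_at_infty hl0 ν, psiOf, rejump, pcfW]
        simp only [Matrix.mul_smul, Matrix.smul_mul]
        simp only [mul_assoc] at h3 ⊢
        rw [h3, smul_comm]
      have h4 : (rowScale k s i)⁻¹ * (1 : Mat) i j * rowScale k s j = (1 : Mat) i j := by
        by_cases hij : i = j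
        · subst hij
          simp [rowScale_ne_zero]
        · simp [hij]
      rw [h2]
      simp only [Matrix.sub_apply, Matrix.add_apply, Matrix.smul_apply, smul_eq_mul,
        Matrix.of_apply, Matrix.diagonal_mul, Matrix.mul_diagonal, mul_inv, inv_inv]
      have h5 : l ^ exps k j * (l ^ exps k j)⁻¹ = 1 := mul_inv_cancel₀ (pow_ne_zero _ hl0)
      linear_combination (-(rowScale k s i)⁻¹ * rowScale k s j * ((1 : Mat) i j + l⁻¹ * A i j +
        (l ^ 2)⁻¹ * A₂ i j)) * h5 - h4
    · filter_upwards [eventually_mem_infty] with l hl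
      have h5 : l ^ exps k j * (l ^ exps k j)⁻¹ = 1 :=
        mul_inv_cancel₀ (pow_ne_zero _ (ne_zero_of_mem_offAxes hl))
      linear_combination (l ^ 3)⁻¹ * h5
  · exact isBigO_psiOf_quadrant h s4 (det_pcfK₄ ν) hq4 x4 i j
  · simp only [mul_assoc (psiOf ν k s P _) (_⁻¹) (_⁻¹)]
    exact isBigO_psiOf_quadrant h s1 det_pcfK₁ hq1 x1 i j
  · simp only [mul_assoc (psiOf ν k s P _) (_⁻¹) (_⁻¹)]
    exact isBigO_psiOf_quadrant h s2 det_pcfK₂ hq2 x2 i j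
  · simp only [mul_assoc (psiOf ν k s P _) (_⁻¹) (_⁻¹)]
    exact isBigO_psiOf_quadrant h s3 (det_pcfK₃ ν) hq3 x3 i j

end

/-! ### Uniqueness for the polynomial problem -/

/-- The first bound makes q divisible by X^N; the quotient then tends to 0 at infinity and vanishes
by Liouville. -/
theorem polynomial_eq_zero_of_isBigO {q : Polynomial ℂ} {N : ℕ}
    (h0 : (fun l => q.eval l) =O[𝓝 0] fun l => l ^ N)
    (hi : (fun l => q.eval l) =O[infty] fun l => l ^ N * l⁻¹) : q = 0 := by
  have hx : Tendsto (fun l : ℂ => l) (𝓝[≠] 0) (𝓝[≠] 0) := tendsto_id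
  have h1 := (HasExpansion.polynomial (x := fun l : ℂ => l) (l := 𝓝[≠] 0)
    nhdsWithin_le_nhds q).coeff_eq_zero hx (h0.mono nhdsWithin_le_nhds)
  simp only [Polynomial.coeff_coe] at h1
  obtain ⟨r, rfl⟩ := Polynomial.X_pow_dvd_iff.2 h1
  have h2 : (fun l => r.eval l) =O[infty] fun l => l⁻¹ := by
    have h3 := (isBigO_refl (fun l : ℂ => (l ^ N)⁻¹) infty).mul hi
    simp only [Polynomial.eval_mul, Polynomial.eval_pow, Polynomial.eval_X] at h3
    refine h3.congr' ?_ ?_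
    all_goals
      filter_upwards [eventually_mem_infty] with l hl
      rw [inv_mul_cancel_left₀ (pow_ne_zero _ (ne_zero_of_mem_offAxes hl))]
  have h4 : Tendsto (fun l => r.eval l) infty (𝓝 0) := h2.trans_tendsto tendsto_inv_infty
  obtain ⟨p, hp, hpr⟩ := exists_polynomial_of_isBigO (N := 0) r.differentiable
    (by simpa using h4.isBigO_one ℂ)
  obtain ⟨c, rfl⟩ := Polynomial.natDegree_eq_zero.1 (Nat.le_zero.1 hp)
  simp only [Polynomial.eval_C] at hpr
  simp only [hpr] at h4
  have hc : c = 0 := tendsto_nhds_unique tendsto_const_nhds h4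
  have : r = 0 := Polynomial.funext fun l => by rw [hpr, hc, Polynomial.eval_zero]
  rw [this, mul_zero]

section
variable {ν : ℝ} {k : ℤ} {s : ℂ} {P : Matrix (Fin 2) (Fin 2) (Polynomial ℂ)} {A : Mat}

/-- The product of a row of polynomials with a matrix function. -/
def rowMul (p : Fin 2 → Polynomial ℂ) (M : ℂ → Mat) (j : Fin 2) (l : ℂ) : ℂ :=
  (p 0).eval l * M l 0 j + (p 1).eval l * M l 1 j

theorem polyEval_mul_apply (P : Matrix (Fin 2) (Fin 2) (Polynomial ℂ)) (M : ℂ → Mat) (i j : Fin 2)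
    (l : ℂ) : (polyEval P l * M l) i j = rowMul (P i) M j l := by
  rw [Matrix.mul_apply, Fin.sum_univ_two]
  rfl

theorem IsPolyReduction.isBigO_sub (h : IsPolyReduction ν k s P A) (i j : Fin 2) :
    (fun l => rowMul (P i) (pcfW ν s) j l - l ^ exps k j * ((1 : Mat) i j + l⁻¹ * A i j)) =O[infty]
      fun l => l ^ exps k j * l⁻¹ ^ 2 := by
  obtain ⟨A₂, hA₂⟩ := h.atInfty
  have h1 : (fun l : ℂ => l ^ exps k j * (l ^ 3)⁻¹) =O[infty] fun l => l ^ exps k j * l⁻¹ ^ 2 := by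
    simp only [← inv_pow]
    exact (isBigO_refl _ _).mul (HasExpansion.isBigO_pow_of_le tendsto_inv_infty (by norm_num))
  have h2 : (fun l : ℂ => l ^ exps k j * (l⁻¹ ^ 2 * A₂ i j)) =O[infty]
      fun l => l ^ exps k j * l⁻¹ ^ 2 :=
    (isBigO_refl _ _).mul ((isBigO_refl _ _).mul (isBigO_const_const (A₂ i j) one_ne_zero infty)
      |>.congr_right fun l => mul_one _)
  refine (((hA₂ i j).trans h1).add h2).congr_left fun l => ?_
  rw [polyEval_mul_apply]
  simp only [Matrix.add_apply, Matrix.smul_apply, smul_eq_mul, inv_pow]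
  ring

theorem IsPolyReduction.tendsto (h : IsPolyReduction ν k s P A) (i j : Fin 2) :
    Tendsto (fun l => rowMul (P i) (pcfW ν s) j l * (l ^ exps k j)⁻¹) infty
      (𝓝 ((1 : Mat) i j)) := by
  have h1 := (h.isBigO_sub i j).mul (isBigO_refl (fun l : ℂ => (l ^ exps k j)⁻¹) infty)
  have h2 : Tendsto (fun l : ℂ => l⁻¹ ^ 2) infty (𝓝 0) := by
    simpa using tendsto_inv_infty.pow 2
  have h3 : (fun l : ℂ => l ^ exps k j * l⁻¹ ^ 2 * (l ^ exps k j)⁻¹) =ᶠ[infty]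
      fun l => l⁻¹ ^ 2 := by
    filter_upwards [eventually_mem_infty] with l hl
    have := ne_zero_of_mem_offAxes hl
    field_simp
  have h4 := (h1.trans_eventuallyEq h3).trans_tendsto h2
  have h5 : Tendsto (fun l : ℂ => (1 : Mat) i j + l⁻¹ * A i j) infty
      (𝓝 ((1 : Mat) i j + 0 * A i j)) := (tendsto_inv_infty.mul_const _).const_add _
  have h6 := h4.add h5
  rw [zero_mul, add_zero, zero_add] at h6
  refine h6.congr' ?_
  filter_upwards [eventually_mem_infty] with l hl
  have := ne_zero_of_mem_offAxes hl
  field_simp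
  ring

theorem IsPolyReduction.isBigO (h : IsPolyReduction ν k s P A) (i j : Fin 2) :
    rowMul (P i) (pcfW ν s) j =O[infty] fun l => l ^ exps k j := by
  have h1 := ((h.tendsto i j).isBigO_one ℂ).mul (isBigO_refl (fun l : ℂ => l ^ exps k j) infty)
  simp only [one_mul] at h1
  refine h1.congr' ?_ EventuallyEq.rfl
  filter_upwards [eventually_mem_infty] with l hl
  rw [inv_mul_cancel_right₀ (pow_ne_zero _ (ne_zero_of_mem_offAxes hl))]

/-- If det P were zero, so would be the determinant of P times the model with its columns divided by
powers of λ; but that matrix tends to the identity. -/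
theorem IsPolyReduction.det_ne_zero (h : IsPolyReduction ν k s P A) :
    P 0 0 * P 1 1 - P 0 1 * P 1 0 ≠ 0 := by
  intro h0
  have h1 := ((h.tendsto 0 0).mul (h.tendsto 1 1)).sub ((h.tendsto 0 1).mul (h.tendsto 1 0))
  have h2 : ∀ l, rowMul (P 0) (pcfW ν s) 0 l * (l ^ exps k 0)⁻¹ *
      (rowMul (P 1) (pcfW ν s) 1 l * (l ^ exps k 1)⁻¹) - rowMul (P 0) (pcfW ν s) 1 l *
      (l ^ exps k 1)⁻¹ * (rowMul (P 1) (pcfW ν s) 0 l * (l ^ exps k 0)⁻¹) = 0 := by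
    intro l
    have h3 := congrArg (Polynomial.eval l) h0
    simp only [Polynomial.eval_sub, Polynomial.eval_mul, Polynomial.eval_zero] at h3
    simp only [rowMul]
    linear_combination (pcfW ν s l 0 0 * pcfW ν s l 1 1 - pcfW ν s l 0 1 * pcfW ν s l 1 0) *
      (l ^ exps k 0)⁻¹ * (l ^ exps k 1)⁻¹ * h3
  simp only [h2] at h1
  have := tendsto_nhds_unique tendsto_const_nhds h1
  simp at this

/-- Rows of polynomials that satisfy the homogeneous conditions vanish when the problem is
solvable. -/
theorem IsPolyReduction.eq_zero (hν : ∀ n : ℕ, ν ≠ n) (h : IsPolyReduction ν k s P A)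
    {p : Fin 2 → Polynomial ℂ} (h0 : ∀ j, rowMul p (pcfB ν s) j =O[𝓝 0] fun l => l ^ exps k j)
    (hi : ∀ j, rowMul p (pcfW ν s) j =O[infty] fun l => l ^ exps k j * l⁻¹) : p = 0 := by
  -- Right multiplication by a matrix of determinant 1 preserves the 2 × 2 determinant of p and the
  -- i-th row. Computed with `pcfB` it vanishes at 0 to order |k|; computed with `pcfW` it is
  -- O(λ^{|k|-1}).
  have hΩ : ∀ i, p 0 * P i 1 - p 1 * P i 0 = 0 := by
    intro i
    have hM : ∀ (M : ℂ → Mat) (l : ℂ), (M l).det = 1 →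
        rowMul p M 0 l * rowMul (P i) M 1 l - rowMul p M 1 l * rowMul (P i) M 0 l =
          (p 0 * P i 1 - p 1 * P i 0).eval l := by
      intro M l hl
      rw [Matrix.det_fin_two] at hl
      simp only [rowMul, Polynomial.eval_sub, Polynomial.eval_mul]
      linear_combination ((p 0).eval l * (P i 1).eval l - (p 1).eval l * (P i 0).eval l) * hl
    have hz : ∀ j, rowMul (P i) (pcfB ν s) j =O[𝓝 0] fun l => l ^ exps k j := fun j =>
      (h.atZero i j).congr_left fun l => polyEval_mul_apply _ _ _ _ _
    refine polynomial_eq_zero_of_isBigO (N := k.natAbs) ?_ ?_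
    · have h1 := (((h0 0).mul (hz 1)).congr_right fun l => (pow_add l _ _).symm).sub
        (((h0 1).mul (hz 0)).congr_right fun l => by rw [mul_comm, ← pow_add])
      rw [exps_add] at h1
      exact h1.congr_left fun l => hM _ _ (det_pcfB hν s l)
    · have h1 := (((hi 0).mul (h.isBigO i 1)).congr_right (g₂ := fun l => l ^ (exps k 0 + exps k 1)
        * l⁻¹) fun l => by ring).sub
        (((hi 1).mul (h.isBigO i 0)).congr_right (g₂ := fun l => l ^ (exps k 0 + exps k 1)
        * l⁻¹) fun l => by ring)
      rw [exps_add] at h1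
      exact h1.congr_left fun l => hM _ _ (by rw [det_pcfW, det_pcfB hν])
  have hδ := h.det_ne_zero
  have e0 : p 0 * (P 0 0 * P 1 1 - P 0 1 * P 1 0) = 0 := by
    linear_combination P 0 0 * hΩ 1 - P 1 0 * hΩ 0
  have e1 : p 1 * (P 0 0 * P 1 1 - P 0 1 * P 1 0) = 0 := by
    linear_combination P 0 1 * hΩ 1 - P 1 1 * hΩ 0
  ext1 i
  fin_cases i
  · exact (mul_eq_zero.1 e0).resolve_right hδ
  · exact (mul_eq_zero.1 e1).resolve_right hδ

/-- The rows of the polynomial matrix are unique. -/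
theorem IsPolyReduction.row_unique (hν : ∀ n : ℕ, ν ≠ n) (h : IsPolyReduction ν k s P A)
    {P' : Matrix (Fin 2) (Fin 2) (Polynomial ℂ)} {A' : Mat} (h' : IsPolyReduction ν k s P' A')
    (i : Fin 2) : P i = P' i ∧ ∀ j, A i j = A' i j := by
  have hsub : ∀ M j l, rowMul (P i - P' i) M j l = rowMul (P i) M j l - rowMul (P' i) M j l := by
    intro M j l
    simp only [rowMul, Pi.sub_apply, Polynomial.eval_sub]
    ring
  have hdiff : ∀ j, (fun l => rowMul (P i - P' i) (pcfW ν s) j l -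
      l ^ exps k j * (l⁻¹ * (A i j - A' i j))) =O[infty] fun l => l ^ exps k j * l⁻¹ ^ 2 := by
    intro j
    refine ((h.isBigO_sub i j).sub (h'.isBigO_sub i j)).congr_left fun l => ?_
    rw [hsub]
    ring
  have hrow : P i - P' i = 0 := by
    refine h.eq_zero hν (fun j => ?_) fun j => ?_
    · exact ((h.atZero i j).sub (h'.atZero i j)).congr_left fun l => by
        rw [hsub, polyEval_mul_apply, polyEval_mul_apply]
    · have h1 : (fun l : ℂ => l ^ exps k j * l⁻¹ ^ 2) =O[infty] fun l => l ^ exps k j * l⁻¹ := by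
        have := HasExpansion.isBigO_pow_of_le tendsto_inv_infty (show 1 ≤ 2 by norm_num)
        simp only [pow_one] at this
        exact (isBigO_refl _ _).mul this
      have h2 : (fun l : ℂ => l ^ exps k j * (l⁻¹ * (A i j - A' i j))) =O[infty]
          fun l => l ^ exps k j * l⁻¹ :=
        ((isBigO_refl (fun l : ℂ => l ^ exps k j * l⁻¹) infty).const_mul_left
          (A i j - A' i j)).congr_left fun l => by ring
      exact (((hdiff j).trans h1).add h2).congr_left fun l => by ring
  refine ⟨sub_eq_zero.1 hrow, fun j => ?_⟩
  have h1 := hdiff j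
  rw [hrow] at h1
  have h2 : (fun _ : ℂ => A i j - A' i j) =O[infty] fun l => l⁻¹ := by
    refine ((isBigO_refl (fun l : ℂ => (l ^ exps k j * l⁻¹)⁻¹) infty).mul h1).neg_left.congr' ?_ ?_
    · filter_upwards [eventually_mem_infty] with l hl
      have := ne_zero_of_mem_offAxes hl
      simp only [rowMul, Pi.zero_apply, Polynomial.eval_zero, zero_mul, add_zero, zero_sub,
        mul_neg, neg_neg]
      field_simp
    · filter_upwards [eventually_mem_infty] with l hl
      have := ne_zero_of_mem_offAxes hl
      field_simp
  exact sub_eq_zero.1 (tendsto_nhds_unique tendsto_const_nhds (h2.trans_tendsto tendsto_inv_infty))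

end

/-! ### Functions that are polynomial in the parabolic cylinder functions -/

theorem pcfSqrtTwo_eq (ν : ℝ) (s : ℂ) :
    pcfSqrtTwo ν s = Complex.exp (-(s ^ 2 / 2)) * pcfF ν ((√2 : ℝ) * s) := by
  have h2 : ((√2 : ℝ) : ℂ) ^ 2 = 2 := by
    rw [← Complex.ofReal_pow, Real.sq_sqrt (by norm_num)]; simp
  rw [pcfSqrtTwo, pcfF, ← mul_assoc, ← Complex.exp_add, mul_pow, h2]
  ring_nf
  simp

theorem sqrt_two_sq : ((√2 : ℝ) : ℂ) * (√2 : ℝ) = 2 := by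
  rw [← Complex.ofReal_mul, Real.mul_self_sqrt (by norm_num)]; simp

theorem hasDerivAt_pcfSqrtTwo_aux (ν : ℝ) (s : ℂ) : HasDerivAt (pcfSqrtTwo ν)
    (-s * pcfSqrtTwo ν s + Complex.exp (-(s ^ 2 / 2)) *
      (ν * pcfF (ν - 1) ((√2 : ℝ) * s) * (√2 : ℝ))) s := by
  have h1 : HasDerivAt (fun s : ℂ => Complex.exp (-(s ^ 2 / 2))) (Complex.exp (-(s ^ 2 / 2)) * -s)
      s := by
    have := (((hasDerivAt_id s).pow 2).div_const 2).neg.cexp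
    simpa using this
  have h2 : HasDerivAt (fun s : ℂ => pcfF ν ((√2 : ℝ) * s))
      (ν * pcfF (ν - 1) ((√2 : ℝ) * s) * (√2 : ℝ)) s :=
    (hasDerivAt_pcfF ν _).comp s (by simpa using (hasDerivAt_id s).const_mul ((√2 : ℝ) : ℂ))
  rw [show pcfSqrtTwo ν = fun s => Complex.exp (-(s ^ 2 / 2)) * pcfF ν ((√2 : ℝ) * s) from
    funext (pcfSqrtTwo_eq ν)]
  exact (h1.fun_mul h2).congr_deriv (by ring)

theorem hasDerivAt_pcfSqrtTwo (ν : ℝ) (s : ℂ) : HasDerivAt (pcfSqrtTwo ν)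
    (-s * pcfSqrtTwo ν s + (√2 : ℝ) * ν * pcfSqrtTwo (ν - 1) s) s := by
  convert hasDerivAt_pcfSqrtTwo_aux ν s using 2
  rw [pcfSqrtTwo_eq]
  push_cast
  ring

/-- The recurrence trades index ν - 2 for ν, so differentiation never leaves the pair of indices ν,
ν - 1 and `pcfAlgebra` is closed under it. -/
theorem hasDerivAt_pcfSqrtTwo_sub_one (ν : ℝ) (s : ℂ) : HasDerivAt (pcfSqrtTwo (ν - 1))
    (s * pcfSqrtTwo (ν - 1) s - (√2 : ℝ) * pcfSqrtTwo ν s) s := by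
  convert hasDerivAt_pcfSqrtTwo_aux (ν - 1) s using 1
  have h := pcfF_add_one (ν - 1) ((√2 : ℝ) * s)
  rw [sub_add_cancel] at h
  rw [pcfSqrtTwo_eq, pcfSqrtTwo_eq, h]
  push_cast
  linear_combination (-Complex.exp (-(s ^ 2 / 2)) * s * pcfF (ν - 1) ((√2 : ℝ) * s)) * sqrt_two_sq

/-- The polynomials in the parabolic cylinder functions. -/
def pcfAlgebra (ν : ℝ) : Subalgebra ℂ (ℂ → ℂ) where
  carrier := {f | ∃ Q : MvPolynomial (Fin 5) ℂ, ∀ s, f s = MvPolynomial.eval (pcfTuple ν s) Q}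
  mul_mem' := by
    rintro f g ⟨P, hP⟩ ⟨Q, hQ⟩
    exact ⟨P * Q, fun s => by simp [hP, hQ]⟩
  add_mem' := by
    rintro f g ⟨P, hP⟩ ⟨Q, hQ⟩
    exact ⟨P + Q, fun s => by simp [hP, hQ]⟩
  algebraMap_mem' c := ⟨MvPolynomial.C c, fun s => by simp⟩

section
variable {ν : ℝ}

theorem mem_pcfAlgebra {f : ℂ → ℂ} : f ∈ pcfAlgebra ν ↔
    ∃ Q : MvPolynomial (Fin 5) ℂ, ∀ s, f s = MvPolynomial.eval (pcfTuple ν s) Q := Iff.rfl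

theorem const_mem_pcfAlgebra (c : ℂ) : (fun _ => c) ∈ pcfAlgebra ν :=
  (pcfAlgebra ν).algebraMap_mem c

theorem pcfTuple_mem (i : Fin 5) : (fun s => pcfTuple ν s i) ∈ pcfAlgebra ν :=
  ⟨MvPolynomial.X i, fun s => by simp⟩

theorem const_mul_mem_pcfAlgebra {f : ℂ → ℂ} (hf : f ∈ pcfAlgebra ν) (c : ℂ) :
    (fun s => c * f s) ∈ pcfAlgebra ν :=
  (pcfAlgebra ν).mul_mem (const_mem_pcfAlgebra c) hf

theorem polynomial_mem_pcfAlgebra (p : Polynomial ℂ) : (fun s => p.eval s) ∈ pcfAlgebra ν := by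
  induction p using Polynomial.induction_on' with
  | add p q hp hq =>
    simp only [Polynomial.eval_add]
    exact (pcfAlgebra ν).add_mem hp hq
  | monomial n a =>
    simp only [Polynomial.eval_monomial]
    exact const_mul_mem_pcfAlgebra ((pcfAlgebra ν).pow_mem (pcfTuple_mem 0) n) a

theorem hasDerivAt_pcfTuple (i : Fin 5) : ∃ g ∈ pcfAlgebra ν,
    ∀ s, HasDerivAt (fun s => pcfTuple ν s i) (g s) s := by
  have h0 : (fun s => s) ∈ pcfAlgebra ν := pcfTuple_mem 0
  have h1 : (fun s => pcfSqrtTwo ν s) ∈ pcfAlgebra ν := pcfTuple_mem 1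
  have h2 : (fun s => pcfSqrtTwo (ν - 1) s) ∈ pcfAlgebra ν := pcfTuple_mem 2
  have h3 : (fun s => pcfSqrtTwo ν (-s)) ∈ pcfAlgebra ν := pcfTuple_mem 3
  have h4 : (fun s => pcfSqrtTwo (ν - 1) (-s)) ∈ pcfAlgebra ν := pcfTuple_mem 4
  have hneg : ∀ {f : ℂ → ℂ} {a s : ℂ}, HasDerivAt f a (-s) → HasDerivAt (fun s => f (-s)) (-a) s :=
    fun {f a s} hf => (hf.comp s (hasDerivAt_neg s)).congr_deriv (by ring)
  fin_cases i
  · exact ⟨_, const_mem_pcfAlgebra 1, fun s => hasDerivAt_id s⟩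
  · refine ⟨_, (pcfAlgebra ν).sub_mem (const_mul_mem_pcfAlgebra h2 ((√2 : ℝ) * ν))
      ((pcfAlgebra ν).mul_mem h0 h1), fun s => ?_⟩
    refine (hasDerivAt_pcfSqrtTwo ν s).congr_deriv ?_
    simp only [Pi.sub_apply, Pi.mul_apply]
    ring
  · refine ⟨_, (pcfAlgebra ν).sub_mem ((pcfAlgebra ν).mul_mem h0 h2)
      (const_mul_mem_pcfAlgebra h1 ((√2 : ℝ))), fun s => ?_⟩
    exact hasDerivAt_pcfSqrtTwo_sub_one ν s
  · refine ⟨_, (pcfAlgebra ν).neg_mem ((pcfAlgebra ν).add_mem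
      (const_mul_mem_pcfAlgebra h4 ((√2 : ℝ) * ν)) ((pcfAlgebra ν).mul_mem h0 h3)), fun s => ?_⟩
    refine (hneg (hasDerivAt_pcfSqrtTwo ν (-s))).congr_deriv ?_
    simp only [Pi.neg_apply, Pi.add_apply, Pi.mul_apply]
    ring
  · refine ⟨_, (pcfAlgebra ν).add_mem ((pcfAlgebra ν).mul_mem h0 h4)
      (const_mul_mem_pcfAlgebra h3 ((√2 : ℝ))), fun s => ?_⟩
    refine (hneg (hasDerivAt_pcfSqrtTwo_sub_one ν (-s))).congr_deriv ?_
    simp only [Pi.add_apply, Pi.mul_apply]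
    ring

theorem hasDerivAt_of_mem_pcfAlgebra {f : ℂ → ℂ} (hf : f ∈ pcfAlgebra ν) :
    ∃ g ∈ pcfAlgebra ν, ∀ s, HasDerivAt f (g s) s := by
  obtain ⟨Q, hQ⟩ := mem_pcfAlgebra.1 hf
  obtain rfl : f = fun s => MvPolynomial.eval (pcfTuple ν s) Q := funext hQ
  clear hf hQ
  induction Q using MvPolynomial.induction_on with
  | C a =>
    exact ⟨_, const_mem_pcfAlgebra 0, fun s => by simpa using hasDerivAt_const s a⟩
  | add p q hp hq =>
    obtain ⟨f, hf, hf'⟩ := hp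
    obtain ⟨g, hg, hg'⟩ := hq
    exact ⟨_, (pcfAlgebra ν).add_mem hf hg, fun s => by simpa using (hf' s).fun_add (hg' s)⟩
  | mul_X p i hp =>
    obtain ⟨f, hf, hf'⟩ := hp
    obtain ⟨g, hg, hg'⟩ := hasDerivAt_pcfTuple (ν := ν) i
    refine ⟨_, (pcfAlgebra ν).add_mem ((pcfAlgebra ν).mul_mem hf (pcfTuple_mem i))
      ((pcfAlgebra ν).mul_mem (mem_pcfAlgebra.2 ⟨p, fun s => rfl⟩) hg), fun s => ?_⟩
    simpa using (hf' s).fun_mul (hg' s)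

theorem differentiable_of_mem_pcfAlgebra {f : ℂ → ℂ} (hf : f ∈ pcfAlgebra ν) :
    Differentiable ℂ f := fun s =>
  let ⟨_, _, h⟩ := hasDerivAt_of_mem_pcfAlgebra hf
  (h s).differentiableAt

theorem deriv_mem_pcfAlgebra {f : ℂ → ℂ} (hf : f ∈ pcfAlgebra ν) : deriv f ∈ pcfAlgebra ν := by
  obtain ⟨g, hg, h⟩ := hasDerivAt_of_mem_pcfAlgebra hf
  rwa [show deriv f = g from funext fun s => (h s).deriv]

theorem iteratedDeriv_mem_pcfAlgebra {f : ℂ → ℂ} (hf : f ∈ pcfAlgebra ν) (n : ℕ) :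
    iteratedDeriv n f ∈ pcfAlgebra ν := by
  induction n with
  | zero => simpa using hf
  | succ n ih =>
    rw [iteratedDeriv_succ]
    exact deriv_mem_pcfAlgebra ih

/-- The expansion at infinity contributes only polynomials in s; the cylinder functions enter the
linear system through the Taylor coefficients at λ = 0. -/
theorem coeff_pcfWSeries_mem (i j : Fin 2) (n : ℕ) :
    (fun s => PowerSeries.coeff n (pcfWSeries ν s i j)) ∈ pcfAlgebra ν := by
  have h1 : ∀ (μ : ℝ) (n : ℕ), (fun s => PowerSeries.coeff n (pcfSeries μ s)) ∈ pcfAlgebra ν := by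
    intro μ n
    obtain ⟨P, hP⟩ := (isPcfSeries_pcfSeries μ).coeff n
    simpa only [hP] using polynomial_mem_pcfAlgebra P
  have h2 : ∀ (μ : ℝ) (n : ℕ), (fun s => PowerSeries.coeff n (PowerSeries.rescale Complex.I
      (pcfSeries μ (-Complex.I * s)))) ∈ pcfAlgebra ν := by
    intro μ n
    obtain ⟨P, hP⟩ := (isPcfSeries_pcfSeries μ).coeff n
    simp only [PowerSeries.coeff_rescale, hP]
    refine const_mul_mem_pcfAlgebra ?_ _
    have := polynomial_mem_pcfAlgebra (ν := ν)
      (P.comp (Polynomial.C (-Complex.I) * Polynomial.X))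
    simp only [Polynomial.eval_comp, Polynomial.eval_mul, Polynomial.eval_C, Polynomial.eval_X]
      at this
    exact this
  have h3 : ∀ {c : ℂ → PowerSeries ℂ}, (∀ n, (fun s => PowerSeries.coeff n (c s)) ∈ pcfAlgebra ν) →
      ∀ a n, (fun s => PowerSeries.coeff n (PowerSeries.X * (PowerSeries.C a * c s))) ∈
        pcfAlgebra ν := by
    intro c hc a n
    rcases n with _ | n
    · simpa using const_mem_pcfAlgebra (ν := ν) 0
    · simp only [PowerSeries.coeff_succ_X_mul, PowerSeries.coeff_C_mul]
      exact const_mul_mem_pcfAlgebra (hc n) a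
  fin_cases i <;> fin_cases j
  exacts [h2 _ n, h3 (h1 _) _ n, h3 (h2 _) _ n, h1 _ n]

/-- The entries of `pcfB` as functions of `λ + s`. -/
def pcfBEntry (ν : ℝ) (t : ℂ) : Mat :=
  !![-(modelConst ν * cis ν) * pcfSqrtTwo (ν - 1) (-t), modelConst ν * pcfSqrtTwo (ν - 1) t;
    2 ^ (-ν / 2 : ℂ) * cis ν * pcfSqrtTwo ν (-t), 2 ^ (-ν / 2 : ℂ) * pcfSqrtTwo ν t]

theorem pcfB_eq_entry (ν : ℝ) (s l : ℂ) : pcfB ν s l = pcfBEntry ν (s + l) := by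
  rw [pcfB, pcfBEntry, add_comm s l]
  simp only [pcfSqrtTwo_eq, neg_sq, mul_neg]
  push_cast
  ext i j
  fin_cases i <;> fin_cases j <;> simp <;> ring

theorem pcfBEntry_mem (i j : Fin 2) : (fun t => pcfBEntry ν t i j) ∈ pcfAlgebra ν := by
  have h1 : (fun s => pcfSqrtTwo ν s) ∈ pcfAlgebra ν := pcfTuple_mem 1
  have h2 : (fun s => pcfSqrtTwo (ν - 1) s) ∈ pcfAlgebra ν := pcfTuple_mem 2
  have h3 : (fun s => pcfSqrtTwo ν (-s)) ∈ pcfAlgebra ν := pcfTuple_mem 3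
  have h4 : (fun s => pcfSqrtTwo (ν - 1) (-s)) ∈ pcfAlgebra ν := pcfTuple_mem 4
  fin_cases i <;> fin_cases j
  exacts [const_mul_mem_pcfAlgebra h4 _, const_mul_mem_pcfAlgebra h2 _,
    const_mul_mem_pcfAlgebra h3 _, const_mul_mem_pcfAlgebra h1 _]

/-- The Taylor series at `λ = 0` of the entries of `pcfB`. -/
def pcfBSeries (ν : ℝ) (s : ℂ) (i j : Fin 2) : PowerSeries ℂ :=
  PowerSeries.mk fun k => iteratedDeriv k (fun t => pcfBEntry ν t i j) s / (k.factorial : ℂ)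

theorem hasExpansion_pcfB (ν : ℝ) (s : ℂ) (i j : Fin 2) :
    HasExpansion (𝓝 0) id (fun l => pcfB ν s l i j) (pcfBSeries ν s i j) := by
  simp only [pcfB_eq_entry]
  exact HasExpansion.taylor (f := fun t => pcfBEntry ν t i j)
    ((differentiable_of_mem_pcfAlgebra (pcfBEntry_mem i j)).analyticAt s)

theorem coeff_pcfBSeries_mem (i j : Fin 2) (n : ℕ) :
    (fun s => PowerSeries.coeff n (pcfBSeries ν s i j)) ∈ pcfAlgebra ν := by
  simp only [pcfBSeries, PowerSeries.coeff_mk, div_eq_inv_mul]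
  exact const_mul_mem_pcfAlgebra (iteratedDeriv_mem_pcfAlgebra (pcfBEntry_mem i j) n) _

end

/-- Cramer's rule for a family of linear systems. -/
theorem exists_quotient_of_linear_system {ι κ : Type*} [Fintype ι] [Fintype κ] [DecidableEq κ]
    (𝒜 : Subalgebra ℂ (ℂ → ℂ)) {M : ι → κ → ℂ → ℂ} (hM : ∀ i j, M i j ∈ 𝒜) (b : ι → ℂ)
    {r : κ → ℂ → ℂ} (hr : ∀ j, r j ∈ 𝒜) {s₀ : ℂ}
    (hinj : ∀ a : κ → ℂ, (∀ i, ∑ j, M i j s₀ * a j = 0) → a = 0) :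
    ∃ p ∈ 𝒜, ∃ q ∈ 𝒜, q s₀ ≠ 0 ∧ ∀ (s : ℂ) (a : κ → ℂ), (∀ i, ∑ j, M i j s * a j = b i) →
      (∑ j, r j s * a j) * q s = p s := by
  classical
  let φ : ℂ → (𝒜 →+* ℂ) := fun s => (Pi.evalRingHom (fun _ : ℂ => ℂ) s).comp 𝒜.subtype
  let MA : Matrix ι κ 𝒜 := Matrix.of fun i j => ⟨M i j, hM i j⟩
  let Ms : ℂ → Matrix ι κ ℂ := fun s => Matrix.of fun i j => M i j s
  have hφM : ∀ s, MA.map (φ s) = Ms s := fun s => rfl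
  -- The system may be overdetermined. A constant left inverse taken at s₀ squares it for every s,
  -- with determinant 1 at s₀.
  obtain ⟨L', hL'⟩ := LinearMap.exists_leftInverse_of_injective (Matrix.toLin' (Ms s₀)) (by
    refine LinearMap.ker_eq_bot'.2 fun a ha => hinj a fun i => ?_
    have := congrFun ha i
    simpa [Matrix.toLin'_apply, Matrix.mulVec, dotProduct, Ms] using this)
  set L : Matrix κ ι ℂ := LinearMap.toMatrix' L'
  have hL : L * Ms s₀ = 1 := by
    have := congrArg LinearMap.toMatrix' hL'
    rwa [LinearMap.toMatrix'_comp, LinearMap.toMatrix'_toLin', LinearMap.toMatrix'_id] at this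
  let LA : Matrix κ ι 𝒜 := L.map (algebraMap ℂ 𝒜)
  have hφL : ∀ s, LA.map (φ s) = L := fun s => rfl
  let N : Matrix κ κ 𝒜 := LA * MA
  have hφN : ∀ s, (φ s).mapMatrix N = L * Ms s := fun s => by
    change (LA * MA).map (φ s) = _
    rw [Matrix.map_mul, hφM, hφL]
  let rA : κ → 𝒜 := fun j => ⟨r j, hr j⟩
  let bA : κ → 𝒜 := fun j => algebraMap ℂ 𝒜 ((L.mulVec b) j)
  let pA : 𝒜 := ∑ j, rA j * ∑ j', N.adjugate j j' * bA j'
  have hdet : ∀ s, (N.det : ℂ → ℂ) s = (L * Ms s).det := fun s => by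
    change φ s N.det = _
    rw [RingHom.map_det, hφN]
  refine ⟨pA, pA.2, N.det, N.det.2, ?_, fun s a ha => ?_⟩
  · rw [hdet, hL, Matrix.det_one]
    exact one_ne_zero
  · have hadj : ∀ j j', φ s (N.adjugate j j') = (L * Ms s).adjugate j j' := fun j j' => by
      rw [← hφN, ← RingHom.map_adjugate]
      rfl
    have hp : (pA : ℂ → ℂ) s = ∑ j, r j s * ∑ j', (L * Ms s).adjugate j j' * (L.mulVec b) j' := by
      change φ s pA = _
      simp only [pA, map_sum, map_mul, hadj]
      rfl
    have hb : (Ms s).mulVec a = b := funext ha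
    have h1 : (L * Ms s).adjugate.mulVec (L.mulVec b) = (L * Ms s).det • a := by
      rw [← hb, Matrix.mulVec_mulVec, Matrix.mulVec_mulVec, Matrix.mul_assoc, Matrix.adjugate_mul,
        Matrix.smul_mulVec, Matrix.one_mulVec]
    rw [hp, hdet, Finset.sum_mul]
    refine Finset.sum_congr rfl fun j _ => ?_
    have h2 := congrFun h1 j
    simp only [Matrix.mulVec, dotProduct, Pi.smul_apply, smul_eq_mul] at h2 ⊢
    rw [h2]
    ring

section
variable {ν : ℝ} {k : ℤ} {s : ℂ} {P : Matrix (Fin 2) (Fin 2) (Polynomial ℂ)} {A : Mat} {N : ℕ}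

/-- The pair of polynomials with given coefficients. -/
def rowOfCoeffs (a : Fin 2 × Fin (N + 1) → ℂ) (r : Fin 2) : Polynomial ℂ :=
  ∑ d : Fin (N + 1), Polynomial.C (a (r, d)) * Polynomial.X ^ (d : ℕ)

theorem coeff_rowOfCoeffs (a : Fin 2 × Fin (N + 1) → ℂ) (x : Fin 2 × Fin (N + 1)) :
    (rowOfCoeffs a x.1).coeff x.2 = a x := by
  simp only [rowOfCoeffs, Polynomial.finsetSum_coeff, Polynomial.coeff_C_mul_X_pow]
  rw [Finset.sum_eq_single x.2]
  · simp
  · intro d _ hd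
    rw [if_neg fun h => hd (Fin.ext h.symm)]
  · simp

theorem rowOfCoeffs_coeff {p : Fin 2 → Polynomial ℂ} (hp : ∀ r, (p r).natDegree ≤ N) :
    rowOfCoeffs (fun x : Fin 2 × Fin (N + 1) => (p x.1).coeff x.2) = p := by
  ext1 r
  rw [rowOfCoeffs, Fin.sum_univ_eq_sum_range (fun d => Polynomial.C ((p r).coeff d) *
    Polynomial.X ^ d)]
  exact ((p r).as_sum_range_C_mul_X_pow' (Nat.lt_succ_of_le (hp r))).symm

theorem rowMul_rowOfCoeffs (a : Fin 2 × Fin (N + 1) → ℂ) (M : ℂ → Mat) (j : Fin 2) (l : ℂ) :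
    rowMul (rowOfCoeffs a) M j l = ∑ x, a x * (l ^ (x.2 : ℕ) * M l x.1 j) := by
  simp only [rowMul, rowOfCoeffs, Fintype.sum_prod_type, Fin.sum_univ_two (M := ℂ),
    Polynomial.eval_finsetSum, Polynomial.eval_mul, Polynomial.eval_C, Polynomial.eval_pow,
    Polynomial.eval_X, Finset.sum_mul, mul_assoc]

theorem HasExpansion.sum {α ι : Type*} {l : Filter α} {x : α → ℂ} (hx : Tendsto x l (𝓝 0))
    {f : ι → α → ℂ} {c : ι → PowerSeries ℂ} (S : Finset ι)
    (h : ∀ i ∈ S, HasExpansion l x (f i) (c i)) :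
    HasExpansion l x (fun t => ∑ i ∈ S, f i t) (∑ i ∈ S, c i) := by
  classical
  induction S using Finset.induction_on with
  | empty => simpa using HasExpansion.const hx 0
  | insert i S hi ih =>
    simp only [Finset.sum_insert hi]
    exact (h i (Finset.mem_insert_self _ _)).add (ih fun j hj => h j (Finset.mem_insert_of_mem hj))

theorem HasExpansion.gauge_pow {α : Type*} {l : Filter α} {x : α → ℂ} (hx : Tendsto x l (𝓝 0))
    (n : ℕ) : HasExpansion l x (fun t => x t ^ n) (PowerSeries.X ^ n) := by
  simpa using HasExpansion.polynomial hx (Polynomial.X ^ n)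

/-- The expansion at infinity of the product of a row with `pcfW`, divided by `λ ^ N`. -/
theorem hasExpansion_rowOfCoeffs_infty (hν : ∀ n : ℕ, ν ≠ n) (s : ℂ)
    (a : Fin 2 × Fin (N + 1) → ℂ) (j : Fin 2) :
    HasExpansion infty (fun l => l⁻¹)
      (fun l => l⁻¹ ^ N * rowMul (rowOfCoeffs a) (pcfW ν s) j l)
      (∑ x, PowerSeries.C (a x) * (PowerSeries.X ^ (N - x.2) * pcfWSeries ν s x.1 j)) := by
  have h1 := HasExpansion.sum tendsto_inv_infty Finset.univ fun (x : Fin 2 × Fin (N + 1)) _ =>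
    ((HasExpansion.gauge_pow tendsto_inv_infty (N - x.2)).mul tendsto_inv_infty
      (hasExpansion_pcfW hν s x.1 j)).const_mul tendsto_inv_infty (a x)
  refine h1.congr' ?_
  filter_upwards [eventually_mem_infty] with l hl
  rw [rowMul_rowOfCoeffs, Finset.mul_sum]
  refine Finset.sum_congr rfl fun x _ => ?_
  have hl := ne_zero_of_mem_offAxes hl
  have h2 : l⁻¹ ^ N = l⁻¹ ^ (N - (x.2 : ℕ)) * l⁻¹ ^ (x.2 : ℕ) := by
    rw [← pow_add, Nat.sub_add_cancel (Nat.le_of_lt_succ x.2.2)]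
  have h3 : l⁻¹ ^ (x.2 : ℕ) * l ^ (x.2 : ℕ) = 1 := by
    rw [← mul_pow, inv_mul_cancel₀ hl, one_pow]
  rw [h2]
  linear_combination (-(l⁻¹ ^ (N - (x.2 : ℕ)) * a x * pcfW ν s l x.1 j)) * h3

theorem hasExpansion_rowOfCoeffs_zero (s : ℂ) (a : Fin 2 × Fin (N + 1) → ℂ) (j : Fin 2) :
    HasExpansion (𝓝 0) id (rowMul (rowOfCoeffs a) (pcfB ν s) j)
      (∑ x, PowerSeries.C (a x) * (PowerSeries.X ^ (x.2 : ℕ) * pcfBSeries ν s x.1 j)) := by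
  have hx : Tendsto (id : ℂ → ℂ) (𝓝 0) (𝓝 0) := tendsto_id
  have h1 := HasExpansion.sum hx Finset.univ fun (x : Fin 2 × Fin (N + 1)) _ =>
    ((HasExpansion.gauge_pow hx x.2).mul hx (hasExpansion_pcfB ν s x.1 j)).const_mul hx (a x)
  exact h1.congr' (Eventually.of_forall fun l => (rowMul_rowOfCoeffs a _ j l).symm)

theorem coeff_X_pow_mul_mem {c : ℂ → PowerSeries ℂ}
    (hc : ∀ n, (fun s => PowerSeries.coeff n (c s)) ∈ pcfAlgebra ν) (m n : ℕ) :
    (fun s => PowerSeries.coeff n (PowerSeries.X ^ m * c s)) ∈ pcfAlgebra ν := by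
  simp only [PowerSeries.coeff_X_pow_mul']
  split_ifs
  · exact hc _
  · exact const_mem_pcfAlgebra 0

/-- The coefficients of the linear conditions on the first row. -/
def rowSystem (ν : ℝ) (k : ℤ) :
    (Fin 2 × Fin (k.natAbs + 1)) ⊕ (Fin 2 × Fin (k.natAbs + 1)) →
      Fin 2 × Fin (k.natAbs + 1) → ℂ → ℂ
  -- After division by λ^{|k|} column j should start at order |k| - `exps k j`: these equations
  -- prescribe the coefficients up to that order. Indices beyond the needed range are padded with
  -- zero equations.
  | .inl (j, i), x, s => if (i : ℕ) ≤ k.natAbs - exps k j then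
      PowerSeries.coeff i (PowerSeries.X ^ (k.natAbs - x.2) * pcfWSeries ν s x.1 j) else 0
  | .inr (j, i), x, s => if (i : ℕ) < exps k j then
      PowerSeries.coeff i (PowerSeries.X ^ (x.2 : ℕ) * pcfBSeries ν s x.1 j) else 0

/-- The right-hand sides of the linear conditions on the first row. -/
def rowSystemRhs (k : ℤ) : (Fin 2 × Fin (k.natAbs + 1)) ⊕ (Fin 2 × Fin (k.natAbs + 1)) → ℂ
  | .inl (j, i) => if (i : ℕ) = k.natAbs - exps k j then (1 : Mat) 0 j else 0
  | .inr _ => 0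

theorem rowSystem_mem (i : (Fin 2 × Fin (k.natAbs + 1)) ⊕ (Fin 2 × Fin (k.natAbs + 1)))
    (x : Fin 2 × Fin (k.natAbs + 1)) : rowSystem ν k i x ∈ pcfAlgebra ν := by
  rcases i with ⟨j, i⟩ | ⟨j, i⟩
  · by_cases h : (i : ℕ) ≤ k.natAbs - exps k j
    · rw [show rowSystem ν k (.inl (j, i)) x = fun s => PowerSeries.coeff i
        (PowerSeries.X ^ (k.natAbs - x.2) * pcfWSeries ν s x.1 j) from funext fun s => if_pos h]
      exact coeff_X_pow_mul_mem (coeff_pcfWSeries_mem x.1 j) _ _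
    · rw [show rowSystem ν k (.inl (j, i)) x = fun _ => 0 from funext fun s => if_neg h]
      exact const_mem_pcfAlgebra 0
  · by_cases h : (i : ℕ) < exps k j
    · rw [show rowSystem ν k (.inr (j, i)) x = fun s => PowerSeries.coeff i
        (PowerSeries.X ^ (x.2 : ℕ) * pcfBSeries ν s x.1 j) from funext fun s => if_pos h]
      exact coeff_X_pow_mul_mem (coeff_pcfBSeries_mem x.1 j) _ _
    · rw [show rowSystem ν k (.inr (j, i)) x = fun _ => 0 from funext fun s => if_neg h]
      exact const_mem_pcfAlgebra 0

theorem sum_coeff_eq (f : Fin 2 × Fin (N + 1) → PowerSeries ℂ) (a : Fin 2 × Fin (N + 1) → ℂ)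
    (n : ℕ) : ∑ x, PowerSeries.coeff n (f x) * a x =
      PowerSeries.coeff n (∑ x, PowerSeries.C (a x) * f x) := by
  simp only [map_sum, PowerSeries.coeff_C_mul]
  exact Finset.sum_congr rfl fun x _ => mul_comm _ _

theorem sum_rowSystem_inl (j : Fin 2) (i : Fin (k.natAbs + 1)) (a : Fin 2 × Fin (k.natAbs + 1) → ℂ)
    (h : (i : ℕ) ≤ k.natAbs - exps k j) : ∑ x, rowSystem ν k (.inl (j, i)) x s * a x =
      PowerSeries.coeff i (∑ x, PowerSeries.C (a x) *
        (PowerSeries.X ^ (k.natAbs - x.2) * pcfWSeries ν s x.1 j)) := by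
  rw [← sum_coeff_eq]
  exact Finset.sum_congr rfl fun x _ => congrArg (· * a x) (if_pos h)

theorem sum_rowSystem_inr (j : Fin 2) (i : Fin (k.natAbs + 1)) (a : Fin 2 × Fin (k.natAbs + 1) → ℂ)
    (h : (i : ℕ) < exps k j) : ∑ x, rowSystem ν k (.inr (j, i)) x s * a x =
      PowerSeries.coeff i (∑ x, PowerSeries.C (a x) *
        (PowerSeries.X ^ (x.2 : ℕ) * pcfBSeries ν s x.1 j)) := by
  rw [← sum_coeff_eq]
  exact Finset.sum_congr rfl fun x _ => congrArg (· * a x) (if_pos h)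

/-- The homogeneous system is injective when the problem is solvable. -/
theorem IsPolyReduction.eq_zero_of_rowSystem (hν : ∀ n : ℕ, ν ≠ n)
    (h : IsPolyReduction ν k s P A) (a : Fin 2 × Fin (k.natAbs + 1) → ℂ)
    (ha : ∀ i, ∑ x, rowSystem ν k i x s * a x = 0) : a = 0 := by
  have hp : rowOfCoeffs a = 0 := by
    refine h.eq_zero hν (fun j => ?_) fun j => ?_
    · refine (hasExpansion_rowOfCoeffs_zero s a j).isBigO_of_coeff fun i hi => ?_
      have hi' : i < k.natAbs + 1 := Nat.lt_succ_of_le (hi.le.trans (exps_le k j))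
      rw [← ha (.inr (j, ⟨i, hi'⟩)), sum_rowSystem_inr _ _ _ hi]
    -- Orders up to and including |k| - `exps k j` vanish, one more than the growth allows;
    -- multiplying back by λ^{|k|} leaves the extra factor 1/λ that `IsPolyReduction.eq_zero`
    -- requires.
    · have h1 := (hasExpansion_rowOfCoeffs_infty hν s a j).isBigO_of_coeff
        (N := k.natAbs - exps k j + 1) fun i hi => by
          have hi' : i < k.natAbs + 1 := by omega
          rw [← ha (.inl (j, ⟨i, hi'⟩)), sum_rowSystem_inl _ _ _ (Nat.le_of_lt_succ hi)]
      refine ((isBigO_refl (fun l : ℂ => l ^ k.natAbs) infty).mul h1).congr' ?_ ?_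
      all_goals filter_upwards [eventually_mem_infty] with l hl
      all_goals have hl := ne_zero_of_mem_offAxes hl
      · rw [← mul_assoc, ← mul_pow, mul_inv_cancel₀ hl, one_pow, one_mul]
      · have h2 : l ^ k.natAbs = l ^ exps k j * l ^ (k.natAbs - exps k j) := by
          rw [← pow_add, Nat.add_sub_cancel' (exps_le k j)]
        rw [h2, pow_succ, mul_assoc, ← mul_assoc (l ^ (k.natAbs - exps k j)), ← mul_pow,
          mul_inv_cancel₀ hl, one_pow, one_mul]
  ext x
  rw [← coeff_rowOfCoeffs a x, hp]
  simp

/-- By uniqueness of asymptotic series, the coefficients agree one order beyond the linear system;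
that additional coefficient is the entry of A to be computed. -/
theorem IsPolyReduction.coeff_sum (hν : ∀ n : ℕ, ν ≠ n) (h : IsPolyReduction ν k s P A)
    (j : Fin 2) {i : ℕ} (hi : i < k.natAbs - exps k j + 2) :
    PowerSeries.coeff i (∑ x : Fin 2 × Fin (k.natAbs + 1), PowerSeries.C ((P 0 x.1).coeff x.2) *
      (PowerSeries.X ^ (k.natAbs - x.2) * pcfWSeries ν s x.1 j)) =
    PowerSeries.coeff i (PowerSeries.X ^ (k.natAbs - exps k j) *
      (PowerSeries.C ((1 : Mat) 0 j) + PowerSeries.C (A 0 j) * PowerSeries.X)) := by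
  have h1 := hasExpansion_rowOfCoeffs_infty (N := k.natAbs) hν s
    (fun x => (P 0 x.1).coeff x.2) j
  rw [rowOfCoeffs_coeff fun r => h.natDegree 0 r] at h1
  have h2 : HasExpansion infty (fun l => l⁻¹)
      (fun l => l⁻¹ ^ (k.natAbs - exps k j) * ((1 : Mat) 0 j + A 0 j * l⁻¹)) _ :=
    (HasExpansion.gauge_pow tendsto_inv_infty (k.natAbs - exps k j)).mul tendsto_inv_infty
      ((HasExpansion.const tendsto_inv_infty ((1 : Mat) 0 j)).add
        ((HasExpansion.gauge tendsto_inv_infty).const_mul tendsto_inv_infty (A 0 j)))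
  have h3 := h1.sub tendsto_inv_infty h2
  have h4 := h3.coeff_eq_zero (N := k.natAbs - exps k j + 2) tendsto_inv_infty' (by
    refine ((isBigO_refl (fun l : ℂ => l⁻¹ ^ k.natAbs) infty).mul (h.isBigO_sub 0 j)).congr' ?_ ?_
    all_goals filter_upwards [eventually_mem_infty] with l hl
    all_goals
      have hl := ne_zero_of_mem_offAxes hl
      have h2 : l⁻¹ ^ k.natAbs * l ^ exps k j = l⁻¹ ^ (k.natAbs - exps k j) := by
        rw [← Nat.sub_add_cancel (exps_le k j), pow_add, Nat.add_sub_cancel, mul_assoc, ← mul_pow,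
          inv_mul_cancel₀ hl, one_pow, mul_one]
    · linear_combination (-((1 : Mat) 0 j + l⁻¹ * A 0 j)) * h2
    · rw [← mul_assoc, h2, pow_add])
  exact sub_eq_zero.1 (by rw [← map_sub]; exact h4 i hi)

theorem IsPolyReduction.sum_rowSystem (hν : ∀ n : ℕ, ν ≠ n) (h : IsPolyReduction ν k s P A)
    (i : (Fin 2 × Fin (k.natAbs + 1)) ⊕ (Fin 2 × Fin (k.natAbs + 1))) :
    ∑ x, rowSystem ν k i x s * (P 0 x.1).coeff x.2 = rowSystemRhs k i := by
  rcases i with ⟨j, i⟩ | ⟨j, i⟩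
  · by_cases hi : (i : ℕ) ≤ k.natAbs - exps k j
    · rw [sum_rowSystem_inl j i (fun x => (P 0 x.1).coeff x.2) hi, h.coeff_sum hν j (by omega),
        PowerSeries.coeff_X_pow_mul', rowSystemRhs]
      rcases hi.lt_or_eq with hi | hi
      · rw [if_neg (by omega), if_neg (by omega)]
      · rw [if_pos hi.ge, if_pos hi, hi]
        simp
    · rw [rowSystemRhs, if_neg (by omega)]
      exact Finset.sum_eq_zero fun x _ => by rw [rowSystem, if_neg hi, zero_mul]
  · by_cases hi : (i : ℕ) < exps k j
    · rw [sum_rowSystem_inr j i (fun x => (P 0 x.1).coeff x.2) hi, rowSystemRhs]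
      have h1 := hasExpansion_rowOfCoeffs_zero (ν := ν) s (N := k.natAbs)
        (fun x => (P 0 x.1).coeff x.2) j
      rw [rowOfCoeffs_coeff fun r => h.natDegree 0 r] at h1
      have h2 := h1.mono (l' := 𝓝[≠] 0) nhdsWithin_le_nhds
      refine h2.coeff_eq_zero (N := exps k j) tendsto_id ?_ i hi
      exact ((h.atZero 0 j).congr_left fun l => polyEval_mul_apply _ _ _ _ _).mono
        nhdsWithin_le_nhds
    · rw [rowSystemRhs]
      exact Finset.sum_eq_zero fun x _ => by rw [rowSystem, if_neg hi, zero_mul]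

/-- If the problem is solvable for one value of `s`, the upper right entry of the coefficient at
infinity is a quotient of polynomials in parabolic cylinder functions. -/
theorem IsPolyReduction.exists_quotient (hν : ∀ n : ℕ, ν ≠ n) (h : IsPolyReduction ν k s P A) :
    ∃ p ∈ pcfAlgebra ν, ∃ q ∈ pcfAlgebra ν, q s ≠ 0 ∧
      ∀ (s : ℂ) (P : Matrix (Fin 2) (Fin 2) (Polynomial ℂ)) (A : Mat),
        IsPolyReduction ν k s P A → A 0 1 * q s = p s := by
  obtain ⟨p, hp, q, hq, hqs, hpq⟩ := exists_quotient_of_linear_system (pcfAlgebra ν)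
    (M := rowSystem ν k) rowSystem_mem (rowSystemRhs k)
    -- The linear functional that reads A 0 1 off the polynomial coefficients: the first order not
    -- fixed by the system.
    (r := fun x s => PowerSeries.coeff (k.natAbs - exps k 1 + 1)
      (PowerSeries.X ^ (k.natAbs - x.2) * pcfWSeries ν s x.1 1))
    (fun x => coeff_X_pow_mul_mem (coeff_pcfWSeries_mem x.1 1) _ _)
    (h.eq_zero_of_rowSystem hν)
  refine ⟨p, hp, q, hq, hqs, fun s P A h => ?_⟩
  rw [← hpq s _ (h.sum_rowSystem hν), sum_coeff_eq (fun x => PowerSeries.X ^ (k.natAbs - x.2) *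
    pcfWSeries ν s x.1 1) fun x => (P 0 x.1).coeff x.2, h.coeff_sum hν 1 (by omega), add_comm _ 1,
    add_comm 1, PowerSeries.coeff_X_pow_mul', if_pos (by omega)]
  simp

end

/-! ### Special solutions as logarithmic derivatives -/

theorem eventually_nhdsNE_of_codiscrete {p : ℂ → Prop} (h : ∀ᶠ s in codiscrete ℂ, p s) (s : ℂ) :
    ∀ᶠ t in 𝓝[≠] s, p t := by
  have := mem_codiscrete.1 h s
  rwa [disjoint_principal_right, compl_compl] at this

instance : (codiscrete ℂ).NeBot := by
  refine neBot_iff.2 fun h => ?_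
  have h1 : ∀ᶠ _ in codiscrete ℂ, False := by simp [h]
  exact (eventually_nhdsNE_of_codiscrete h1 0).exists.elim fun _ h => h

theorem eventually_codiscrete_ne_zero {f : ℂ → ℂ} (hf : Differentiable ℂ f) {s : ℂ} (h : f s ≠ 0) :
    ∀ᶠ t in codiscrete ℂ, f t ≠ 0 :=
  AnalyticOnNhd.preimage_zero_mem_codiscrete (fun t _ => hf.analyticAt t) h

/-- Normal form fixes the values at poles and removable points, so agreement off a discrete set
becomes agreement near every point. -/
theorem eq_of_meromorphicNF {u g : ℂ → ℂ} (hu : MeromorphicNFOn u Set.univ) {s : ℂ}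
    (hg : MeromorphicNFAt g s) (h : ∀ᶠ t in codiscrete ℂ, u t = g t) : u =ᶠ[𝓝 s] g :=
  ((hu (Set.mem_univ s)).eventuallyEq_nhdsNE_iff_eventuallyEq_nhds hg).1
    (eventually_nhdsNE_of_codiscrete h s)

section
variable {ν : ℝ} {k : ℤ} {u p q : ℂ → ℂ}

/-- The ratio of the row normalisations. -/
def rowRatio (k : ℤ) (s : ℂ) : ℂ := (rowScale k s 0)⁻¹ * rowScale k s 1

theorem rowRatio_ne_zero (k : ℤ) (s : ℂ) : rowRatio k s ≠ 0 :=
  mul_ne_zero (inv_ne_zero (rowScale_ne_zero k s 0)) (rowScale_ne_zero k s 1)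

/-- The ratio is a constant times e^{-s²}: its logarithmic derivative cancels the term -2s in the
definition of u. -/
theorem hasDerivAt_rowRatio (k : ℤ) (s : ℂ) :
    HasDerivAt (rowRatio k) (-2 * s * rowRatio k s) s := by
  have h : rowRatio k = fun s => Complex.exp (-s ^ 2) * cis (k / 2) := by
    ext s
    change (Complex.exp (s ^ 2 / 2))⁻¹ * (Complex.exp (-(s ^ 2 / 2)) * cis (k / 2)) = _
    rw [← Complex.exp_neg, ← mul_assoc, ← Complex.exp_add]
    ring_nf
  rw [h]
  have h1 : HasDerivAt (fun s : ℂ => -s ^ 2) (-(2 * s)) s := by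
    simpa using (hasDerivAt_pow 2 s).fun_neg
  exact (h1.cexp.mul_const (cis (k / 2))).congr_deriv (by ring)

theorem logDeriv_rowRatio_mul_div {s : ℂ} (hp : DifferentiableAt ℂ p s)
    (hq : DifferentiableAt ℂ q s) (hps : p s ≠ 0) (hqs : q s ≠ 0) :
    DifferentiableAt ℂ (fun t => rowRatio k t * (p t / q t)) s ∧
      logDeriv (fun t => rowRatio k t * (p t / q t)) s =
        -2 * s + (logDeriv p s - logDeriv q s) := by
  have h1 := (hasDerivAt_rowRatio k s).differentiableAt
  have h2 : DifferentiableAt ℂ (fun t => p t / q t) s := hp.fun_div hq hqs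
  refine ⟨h1.fun_mul h2, ?_⟩
  rw [logDeriv_mul (g := fun t => p t / q t) s (rowRatio_ne_zero k s) (div_ne_zero hps hqs) h1 h2,
    logDeriv_div s hps hqs hp hq, logDeriv_apply (rowRatio k), (hasDerivAt_rowRatio k s).deriv,
    mul_div_cancel_right₀ _ (rowRatio_ne_zero k s)]

theorem IsSpecialSolution.eventually_eq (hν : ∀ n : ℕ, ν ≠ n)
    (hu : IsSpecialSolution (-(k / 2)) (ν + k / 2) u) (hp : Differentiable ℂ p)
    (hq : Differentiable ℂ q) {s₀ : ℂ} (hs₀ : q s₀ ≠ 0)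
    (hpq : ∀ s P A, q s ≠ 0 → IsPolyReduction ν k s P A → A 0 1 * q s = p s) :
    ∀ᶠ s in codiscrete ℂ, q s ≠ 0 ∧ p s ≠ 0 ∧ u s = logDeriv q s - logDeriv p s := by
  obtain ⟨Ψ, Ψ₁, h⟩ := hu.fromPsi
  have h1 : ∀ᶠ s in codiscrete ℂ, Ψ₁ s 0 1 = rowRatio k s * (p s / q s) ∧ q s ≠ 0 ∧ p s ≠ 0 := by
    filter_upwards [h, eventually_codiscrete_ne_zero hq hs₀] with s hs hqs
    obtain ⟨P, hP⟩ := exists_isPolyReduction hν hs.1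
    have h2 := hpq s P _ hqs hP
    have h0 := rowScale_ne_zero k s 0
    have h1 := rowScale_ne_zero k s 1
    simp only [Matrix.of_apply] at h2
    refine ⟨?_, hqs, fun hps => ?_⟩
    · rw [rowRatio, ← h2]
      field_simp
    · rw [hps] at h2
      exact mul_ne_zero (mul_ne_zero (mul_ne_zero h0 hs.2.1) (inv_ne_zero h1)) hqs h2
  -- A codiscrete set is open, so the equality holds near each of its points and passes to
  -- derivatives.
  have h2 := logDeriv_congr_codiscrete (h1.mono fun s hs => hs.1)
  filter_upwards [h, h1, h2] with s hs hs1 hs2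
  refine ⟨hs1.2.1, hs1.2.2, ?_⟩
  rw [hs.2.2.2, hs2, (logDeriv_rowRatio_mul_div (hp s) (hq s) hs1.2.2 hs1.2.1).2]
  ring

theorem isSpecialSolution_of_isPolyReduction (hu : MeromorphicNFOn u Set.univ)
    (hs : SolvesPIV (-(k / 2)) (ν + k / 2) u) (hp : Differentiable ℂ p)
    (hq : Differentiable ℂ q) {s₀ s₁ : ℂ} (hs₀ : q s₀ ≠ 0) (hs₁ : p s₁ ≠ 0)
    (h : ∀ s, q s ≠ 0 → ∃ P A, IsPolyReduction ν k s P A ∧ A 0 1 * q s = p s)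
    (hpq : ∀ᶠ s in codiscrete ℂ, u s = logDeriv q s - logDeriv p s) :
    IsSpecialSolution (-(k / 2)) (ν + k / 2) u := by
  -- At zeros of q the choice is arbitrary, here 0; these points form a discrete set and are
  -- ignored.
  have h' : ∀ s, ∃ P A, q s ≠ 0 → IsPolyReduction ν k s P A ∧ A 0 1 * q s = p s := fun s => by
    by_cases hqs : q s = 0
    · exact ⟨0, 0, fun h => absurd hqs h⟩
    · obtain ⟨P, A, hPA⟩ := h s hqs
      exact ⟨P, A, fun _ => hPA⟩
  choose P A hPA using h'
  refine ⟨hu, hs, fun s => psiOf ν k s (P s),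
    fun s => Matrix.of fun i j => (rowScale k s i)⁻¹ * A s i j * rowScale k s j, ?_⟩
  have hq0 := eventually_codiscrete_ne_zero hq hs₀
  have h1 : ∀ s, q s ≠ 0 → (rowScale k s 0)⁻¹ * A s 0 1 * rowScale k s 1 =
      rowRatio k s * (p s / q s) := fun s hqs => by
    rw [rowRatio, ← (hPA s hqs).2]
    field_simp
  filter_upwards [hq0, eventually_codiscrete_ne_zero hp hs₁, hpq] with s hqs hps hs2
  have h2 : (fun s => (rowScale k s 0)⁻¹ * A s 0 1 * rowScale k s 1) =ᶠ[𝓝 s]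
      fun s => rowRatio k s * (p s / q s) := by
    filter_upwards [hq.continuous.continuousAt.eventually_ne hqs] with t ht using h1 t ht
  have h3 := logDeriv_rowRatio_mul_div (k := k) (hp s) (hq s) hps hqs
  refine ⟨(hPA s hqs).1.isSpecialPsi, ?_, h3.1.congr_of_eventuallyEq h2, ?_⟩
  · simp only [Matrix.of_apply]
    rw [h1 s hqs]
    exact mul_ne_zero (rowRatio_ne_zero k s) (div_ne_zero hps hqs)
  · have h4 : logDeriv (fun s => (rowScale k s 0)⁻¹ * A s 0 1 * rowScale k s 1) s =
        logDeriv (fun t => rowRatio k t * (p t / q t)) s := by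
      rw [logDeriv_apply, logDeriv_apply, h2.deriv_eq, h1 s hqs]
    simp only [Matrix.of_apply]
    rw [hs2, h4, h3.2]
    ring

/-- The characterisation of special solutions by the solutions of the polynomial problem. -/
theorem isSpecialSolution_iff (hν : ∀ n : ℕ, ν ≠ n) (hp : Differentiable ℂ p)
    (hq : Differentiable ℂ q) {s₀ s₁ : ℂ} (hs₀ : q s₀ ≠ 0) (hs₁ : p s₁ ≠ 0)
    (h : ∀ s, q s ≠ 0 → ∃ P A, IsPolyReduction ν k s P A ∧ A 0 1 * q s = p s) :
    IsSpecialSolution (-(k / 2)) (ν + k / 2) u ↔ MeromorphicNFOn u Set.univ ∧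
      SolvesPIV (-(k / 2)) (ν + k / 2) u ∧
      ∀ᶠ s in codiscrete ℂ, u s = logDeriv q s - logDeriv p s := by
  refine ⟨fun hu => ⟨hu.meromorphic, hu.solves, ?_⟩, fun hu =>
    isSpecialSolution_of_isPolyReduction hu.1 hu.2.1 hp hq hs₀ hs₁ h hu.2.2⟩
  refine (hu.eventually_eq hν hp hq hs₀ fun s P A hqs hP => ?_).mono fun s hs => hs.2.2
  obtain ⟨P', A', hP', hA'⟩ := h s hqs
  rw [← hA', (hP.row_unique hν hP' 0).2 1]

/-- Special solutions with half-integer `b` are expressed through parabolic cylinder functions. -/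
theorem IsSpecialSolution.isRationalInPcf (hν : ∀ n : ℕ, ν ≠ n)
    (hu : IsSpecialSolution (-(k / 2)) (ν + k / 2) u) : IsRationalInPcf ν u := by
  obtain ⟨Ψ, Ψ₁, h⟩ := hu.fromPsi
  obtain ⟨s₀, hs₀⟩ := h.exists
  obtain ⟨P, hP⟩ := exists_isPolyReduction hν hs₀.1
  obtain ⟨p, hp, q, hq, hqs, hpq⟩ := hP.exists_quotient hν
  have hp' := differentiable_of_mem_pcfAlgebra hp
  have hq' := differentiable_of_mem_pcfAlgebra hq
  have h1 := hu.eventually_eq hν hp' hq' hqs fun s P A _ => hpq s P A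
  -- The numerator of q'/q - p'/p over the denominator qp.
  set f : ℂ → ℂ := deriv q * p - deriv p * q with hf
  have hfm : f ∈ pcfAlgebra ν := (pcfAlgebra ν).sub_mem
    ((pcfAlgebra ν).mul_mem (deriv_mem_pcfAlgebra hq) hp)
    ((pcfAlgebra ν).mul_mem (deriv_mem_pcfAlgebra hp) hq)
  have hgm : q * p ∈ pcfAlgebra ν := (pcfAlgebra ν).mul_mem hq hp
  obtain ⟨F, hF⟩ := mem_pcfAlgebra.1 hfm
  obtain ⟨G, hG⟩ := mem_pcfAlgebra.1 hgm
  refine ⟨F, G, ?_, fun s hs => ?_⟩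
  · obtain ⟨s, hs⟩ := h1.exists
    exact ⟨s, by rw [← hG]; exact mul_ne_zero hs.1 hs.2.1⟩
  · rw [← hG] at hs
    rw [← hF, ← hG]
    -- Where qp is nonzero the quotient is analytic, so the normal form of u gives equality at every
    -- such point, not only off a discrete set.
    have han : AnalyticAt ℂ (fun t => f t / (q * p) t) s :=
      ((differentiable_of_mem_pcfAlgebra hfm).analyticAt s).fun_div
        ((differentiable_of_mem_pcfAlgebra hgm).analyticAt s) hs
    refine (eq_of_meromorphicNF hu.meromorphic han.meromorphicNFAt ?_).eq_of_nhds
    filter_upwards [h1] with t ht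
    rw [ht.2.2, logDeriv_apply, logDeriv_apply, div_sub_div _ _ ht.1 ht.2.1, hf]
    simp only [Pi.sub_apply, Pi.mul_apply]
    ring

end

/-! ### The polynomial problem for `k = 0` and `k = 1` -/

theorem HasExpansion.inv_mul_of_X_mul {α : Type*} {l : Filter α} {x f : α → ℂ} {c : PowerSeries ℂ}
    (hx : Tendsto x l (𝓝[≠] 0)) (h : HasExpansion l x f (PowerSeries.X * c)) :
    HasExpansion l x (fun t => (x t)⁻¹ * f t) c := fun N => by
  have hne : ∀ᶠ t in l, x t ≠ 0 := hx self_mem_nhdsWithin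
  refine ((isBigO_refl (fun t => (x t)⁻¹) l).mul (h (N + 1))).congr' ?_ ?_
  all_goals filter_upwards [hne] with t ht
  · have : (PowerSeries.trunc (N + 1) (PowerSeries.X * c)).eval (x t) =
        x t * (PowerSeries.trunc N c).eval (x t) := by
      rw [eval_trunc, eval_trunc, Finset.sum_range_succ', Finset.mul_sum]
      simp only [PowerSeries.coeff_succ_X_mul, PowerSeries.coeff_zero_X_mul, zero_mul, add_zero]
      exact Finset.sum_congr rfl fun k _ => by ring
    rw [this, mul_sub, inv_mul_cancel_left₀ ht]
  · rw [pow_succ', inv_mul_cancel_left₀ ht]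

section
variable {ν : ℝ} {k : ℤ} {s : ℂ} {P : Matrix (Fin 2) (Fin 2) (Polynomial ℂ)}

theorem isPolyReduction_of_hasExpansion (hdeg : ∀ i j, (P i j).natDegree ≤ k.natAbs)
    (hzero : ∀ i j, rowMul (P i) (pcfB ν s) j =O[𝓝 0] fun l => l ^ exps k j)
    (c : Fin 2 → Fin 2 → PowerSeries ℂ)
    (h : ∀ i j, HasExpansion infty (fun l => l⁻¹)
      (fun l => (l ^ exps k j)⁻¹ * rowMul (P i) (pcfW ν s) j l) (c i j))
    (h0 : ∀ i j, PowerSeries.coeff 0 (c i j) = (1 : Mat) i j) :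
    IsPolyReduction ν k s P (Matrix.of fun i j => PowerSeries.coeff 1 (c i j)) where
  natDegree := hdeg
  atZero i j := (hzero i j).congr_left fun l => (polyEval_mul_apply _ _ _ _ _).symm
  atInfty := by
    refine ⟨Matrix.of fun i j => PowerSeries.coeff 2 (c i j), fun i j => ?_⟩
    refine ((isBigO_refl (fun l : ℂ => l ^ exps k j) infty).mul (h i j 3)).congr' ?_ ?_
    all_goals filter_upwards [eventually_mem_infty] with l hl
    · rw [polyEval_mul_apply, mul_sub, mul_inv_cancel_left₀
        (pow_ne_zero _ (ne_zero_of_mem_offAxes hl)), eval_trunc, Finset.sum_range_succ,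
        Finset.sum_range_succ, Finset.sum_range_succ, h0]
      simp only [Matrix.add_apply, Matrix.smul_apply, smul_eq_mul, Matrix.of_apply,
        Finset.range_zero, Finset.sum_empty]
      ring
    · rw [inv_pow]

theorem isBigO_one_rowMul_pcfB (p : Fin 2 → Polynomial ℂ) (j : Fin 2) :
    rowMul p (pcfB ν s) j =O[𝓝 0] fun _ => (1 : ℂ) := by
  have : Continuous (rowMul p (pcfB ν s) j) :=
    ((p 0).continuous.mul (differentiable_pcfB ν s 0 j).continuous).add
      ((p 1).continuous.mul (differentiable_pcfB ν s 1 j).continuous)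
  exact (this.tendsto 0).isBigO_one ℂ

/-- Here the model itself solves the problem: P = 1, and the entry sought is independent of s. -/
theorem exists_isPolyReduction_zero (hν : ∀ n : ℕ, ν ≠ n) (s : ℂ) : ∃ P A,
    IsPolyReduction ν 0 s P A ∧ A 0 1 = modelConst ν * 2 ^ ((ν - 1) / 2 : ℂ) := by
  have hrow : ∀ (i j : Fin 2) (M : ℂ → Mat) (l : ℂ),
      rowMul ((1 : Matrix (Fin 2) (Fin 2) (Polynomial ℂ)) i) M j l = M l i j := by
    intro i j M l
    fin_cases i <;> simp [rowMul, Matrix.one_apply]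
  have hexp : ∀ j, exps 0 j = 0 := fun j => by fin_cases j <;> rfl
  refine ⟨1, _, isPolyReduction_of_hasExpansion (fun i j => ?_) (fun i j => ?_) (pcfWSeries ν s)
    (fun i j => ?_) fun i j => ?_, ?_⟩
  · fin_cases i <;> fin_cases j <;> simp
  · simpa only [hexp, pow_zero] using isBigO_one_rowMul_pcfB _ j
  · simpa only [hexp, pow_zero, inv_one, one_mul, hrow] using hasExpansion_pcfW hν s i j
  · rw [PowerSeries.coeff_zero_eq_constantCoeff_apply, constantCoeff_pcfWSeries]
  · simp [pcfWSeries, (isPcfSeries_pcfSeries _).constantCoeff]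

/-- The rows are (1, a) and (-c, λ + e). The constants a and e make the second column vanish at λ =
0, and c cancels the constant limit of λ times the lower left entry of the model. -/
theorem exists_isPolyReduction_one (hν : ∀ n : ℕ, ν ≠ n) {s : ℂ} (hs : pcfB ν s 0 1 1 ≠ 0) :
    ∃ P A, IsPolyReduction ν 1 s P A ∧ A 0 1 = -(pcfB ν s 0 0 1 / pcfB ν s 0 1 1) := by
  obtain ⟨V, hV⟩ := PowerSeries.X_dvd_iff.2 (constantCoeff_pcfWSeries ν s 1 0)
  set a := -(pcfB ν s 0 0 1 / pcfB ν s 0 1 1) with ha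
  set c := PowerSeries.constantCoeff V
  set e := c * (pcfB ν s 0 0 1 / pcfB ν s 0 1 1) with he
  have hW := hasExpansion_pcfW hν s
  have hx := tendsto_inv_infty
  have hW10 : HasExpansion infty (fun l => l⁻¹) (fun l => l * pcfW ν s l 1 0) V := by
    have := (hV ▸ hW 1 0).inv_mul_of_X_mul tendsto_inv_infty'
    simpa only [inv_inv] using this
  have h0 := constantCoeff_pcfWSeries ν s
  let P : Matrix (Fin 2) (Fin 2) (Polynomial ℂ) :=
    !![1, Polynomial.C a; -Polynomial.C c, Polynomial.X + Polynomial.C e]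
  have hP0 : ∀ (M : ℂ → Mat) (j : Fin 2) (l : ℂ), rowMul (P 0) M j l = M l 0 j + a * M l 1 j := by
    intro M j l
    simp [rowMul, P]
  have hP1 : ∀ (M : ℂ → Mat) (j : Fin 2) (l : ℂ),
      rowMul (P 1) M j l = -c * M l 0 j + (l + e) * M l 1 j := by
    intro M j l
    simp [rowMul, P]
  refine ⟨P, _, isPolyReduction_of_hasExpansion (fun i j => ?_) (fun i j => ?_)
    ![![pcfWSeries ν s 0 0 + PowerSeries.C a * pcfWSeries ν s 1 0,
        PowerSeries.X * (pcfWSeries ν s 0 1 + PowerSeries.C a * pcfWSeries ν s 1 1)],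
      ![PowerSeries.C (-c) * pcfWSeries ν s 0 0 + PowerSeries.C e * pcfWSeries ν s 1 0 + V,
        PowerSeries.X * (PowerSeries.C (-c) * pcfWSeries ν s 0 1 +
          PowerSeries.C e * pcfWSeries ν s 1 1) + pcfWSeries ν s 1 1]]
    (fun i j => ?_) (fun i j => ?_), ?_⟩
  · fin_cases i <;> fin_cases j <;> simp [P]
  · fin_cases j
    · simpa [exps] using isBigO_one_rowMul_pcfB (P i) 0
    · have h1 : Differentiable ℂ (rowMul (P i) (pcfB ν s) 1) :=
        ((P i 0).differentiable.mul (differentiable_pcfB ν s 0 1)).add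
          ((P i 1).differentiable.mul (differentiable_pcfB ν s 1 1))
      have h2 : rowMul (P i) (pcfB ν s) 1 0 = 0 := by
        fin_cases i
        · change rowMul (P 0) (pcfB ν s) 1 0 = 0
          rw [hP0, ha]
          field_simp
          ring
        · change rowMul (P 1) (pcfB ν s) 1 0 = 0
          rw [hP1, he]
          field_simp
          ring
      have h3 := (h1 0).isBigO_sub
      simpa [exps, h2] using h3
  · fin_cases i <;> fin_cases j
    · refine ((hW 0 0).add ((hW 1 0).const_mul hx a)).congr' (Eventually.of_forall fun l => ?_)
      change _ = (l ^ 0)⁻¹ * rowMul (P 0) (pcfW ν s) 0 l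
      rw [hP0]
      ring
    · refine ((HasExpansion.gauge hx).mul hx ((hW 0 1).add ((hW 1 1).const_mul hx a))).congr'
        (Eventually.of_forall fun l => ?_)
      change _ = (l ^ 1)⁻¹ * rowMul (P 0) (pcfW ν s) 1 l
      rw [hP0, pow_one]
    · refine ((((hW 0 0).const_mul hx (-c)).add ((hW 1 0).const_mul hx e)).add hW10).congr'
        (Eventually.of_forall fun l => ?_)
      change _ = (l ^ 0)⁻¹ * rowMul (P 1) (pcfW ν s) 0 l
      rw [hP1]
      ring
    · refine (((HasExpansion.gauge hx).mul hx (((hW 0 1).const_mul hx (-c)).add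
        ((hW 1 1).const_mul hx e))).add (hW 1 1)).congr' ?_
      filter_upwards [eventually_mem_infty] with l hl
      have hl := ne_zero_of_mem_offAxes hl
      change _ = (l ^ 1)⁻¹ * rowMul (P 1) (pcfW ν s) 1 l
      rw [hP1, pow_one]
      field_simp
      ring
  · fin_cases i <;> fin_cases j <;> simp [h0, c]
  · simp [h0]

end

theorem modelConst_ne_zero {ν : ℝ} (hν : ∀ n : ℕ, ν ≠ n) : modelConst ν ≠ 0 := by
  have h : (ν : ℂ) ≠ 0 := by exact_mod_cast hν 0
  exact mul_ne_zero (mul_ne_zero (mul_ne_zero (by simp [Complex.cpow_eq_zero_iff]) (cis_ne_zero _))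
    (inv_ne_zero (pcfGamma_ne_zero hν))) h

section
variable {ν : ℝ} {u : ℂ → ℂ}

theorem isSpecialSolution_zero_iff (hν : ∀ n : ℕ, ν ≠ n) :
    IsSpecialSolution (-((0 : ℤ) / 2)) (ν + (0 : ℤ) / 2) u ↔ ∀ s, u s = 0 := by
  have hm : modelConst ν * 2 ^ ((ν - 1) / 2 : ℂ) ≠ 0 := mul_ne_zero (modelConst_ne_zero hν)
    (by simp [Complex.cpow_eq_zero_iff])
  rw [isSpecialSolution_iff hν (p := fun _ => modelConst ν * 2 ^ ((ν - 1) / 2 : ℂ))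
    (q := fun _ => 1) (differentiable_const _) (differentiable_const _) (s₀ := 0) (s₁ := 0)
    one_ne_zero hm fun s _ => by
      obtain ⟨P, A, hP, hA⟩ := exists_isPolyReduction_zero hν s
      exact ⟨P, A, hP, by rw [hA, mul_one]⟩]
  simp only [logDeriv_const, Pi.zero_apply, sub_zero]
  constructor
  · rintro ⟨h1, -, h3⟩ s
    exact (eq_of_meromorphicNF h1 (g := fun _ => 0) analyticAt_const.meromorphicNFAt h3).eq_of_nhds
  · intro h
    obtain rfl : u = fun _ => 0 := funext h
    refine ⟨fun s _ => analyticAt_const.meromorphicNFAt, fun s _ => ?_, Eventually.of_forall h⟩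
    simp

/-! ### The case `b = 1/2` -/

theorem differentiable_pcfSqrtTwo (ν : ℝ) : Differentiable ℂ (pcfSqrtTwo ν) := fun s =>
  (hasDerivAt_pcfSqrtTwo ν s).differentiableAt

theorem pcfB_zero_apply (ν : ℝ) (s : ℂ) : pcfB ν s 0 0 1 = modelConst ν * pcfSqrtTwo (ν - 1) s ∧
    pcfB ν s 0 1 1 = 2 ^ (-ν / 2 : ℂ) * pcfSqrtTwo ν s := by
  rw [pcfB_eq_entry, add_zero]
  exact ⟨rfl, rfl⟩

/-- A common zero would annihilate the second column of `pcfB` at λ = 0, whose determinant is 1. -/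
theorem pcfSqrtTwo_ne_zero_or (hν : ∀ n : ℕ, ν ≠ n) (s : ℂ) :
    pcfSqrtTwo ν s ≠ 0 ∨ pcfSqrtTwo (ν - 1) s ≠ 0 := by
  by_contra! h
  have h1 := det_pcfB hν s 0
  rw [Matrix.det_fin_two, (pcfB_zero_apply ν s).1, (pcfB_zero_apply ν s).2, h.1, h.2] at h1
  simp at h1

theorem sqrt_two_ne_zero : ((√2 : ℝ) : ℂ) ≠ 0 := fun h => by
  have := sqrt_two_sq
  rw [h] at this
  norm_num at this

theorem ofReal_ne_zero_of_forall_ne_natCast (hν : ∀ n : ℕ, ν ≠ n) : (ν : ℂ) ≠ 0 := by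
  exact_mod_cast hν 0

theorem exists_pcfSqrtTwo_ne_zero (hν : ∀ n : ℕ, ν ≠ n) : ∃ s, pcfSqrtTwo ν s ≠ 0 := by
  by_contra! h
  have h1 := (hasDerivAt_pcfSqrtTwo ν 0).deriv
  rw [show pcfSqrtTwo ν = fun _ => 0 from funext h, deriv_const, mul_zero, zero_add] at h1
  have h2 := (mul_eq_zero.1 h1.symm).resolve_left
    (mul_ne_zero sqrt_two_ne_zero (ofReal_ne_zero_of_forall_ne_natCast hν))
  exact (pcfSqrtTwo_ne_zero_or hν 0).elim (· (h 0)) (· h2)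

theorem exists_pcfSqrtTwo_sub_one_ne_zero (hν : ∀ n : ℕ, ν ≠ n) :
    ∃ s, pcfSqrtTwo (ν - 1) s ≠ 0 := by
  by_contra! h
  have h1 := (hasDerivAt_pcfSqrtTwo_sub_one ν 0).deriv
  rw [show pcfSqrtTwo (ν - 1) = fun _ => 0 from funext h, deriv_const, mul_zero, zero_sub] at h1
  have h2 := (mul_eq_zero.1 (neg_eq_zero.1 h1.symm)).resolve_left sqrt_two_ne_zero
  exact (pcfSqrtTwo_ne_zero_or hν 0).elim (· h2) (· (h 0))

/-- The logarithmic derivative of `D_ν(√2 s) / D_{ν-1}(√2 s)`. -/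
def logDerivRatio (ν : ℝ) (s : ℂ) : ℂ :=
  logDeriv (pcfSqrtTwo ν) s - logDeriv (pcfSqrtTwo (ν - 1)) s

theorem meromorphicOn_logDerivRatio (ν : ℝ) : MeromorphicOn (logDerivRatio ν) Set.univ := by
  have h : ∀ μ : ℝ, MeromorphicOn (logDeriv (pcfSqrtTwo μ)) Set.univ := fun μ s _ => by
    have := (differentiable_pcfSqrtTwo μ).analyticAt s
    exact this.deriv.meromorphicAt.div this.meromorphicAt
  exact (h ν).sub (h (ν - 1))

theorem logDerivRatio_eq {s : ℂ} (h : pcfSqrtTwo ν s ≠ 0) (h' : pcfSqrtTwo (ν - 1) s ≠ 0) :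
    logDerivRatio ν s = -2 * s + (√2 : ℝ) * (pcfSqrtTwo ν s / pcfSqrtTwo (ν - 1) s) +
      (√2 : ℝ) * ν * (pcfSqrtTwo (ν - 1) s / pcfSqrtTwo ν s) := by
  rw [logDerivRatio, logDeriv_apply, logDeriv_apply, (hasDerivAt_pcfSqrtTwo ν s).deriv,
    (hasDerivAt_pcfSqrtTwo_sub_one ν s).deriv]
  field_simp
  ring

theorem eventually_pcfSqrtTwo_ne_zero {s : ℂ} (h : pcfSqrtTwo ν s ≠ 0)
    (h' : pcfSqrtTwo (ν - 1) s ≠ 0) :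
    ∀ᶠ t in 𝓝 s, pcfSqrtTwo ν t ≠ 0 ∧ pcfSqrtTwo (ν - 1) t ≠ 0 :=
  ((differentiable_pcfSqrtTwo ν).continuous.continuousAt.eventually_ne h).and
    ((differentiable_pcfSqrtTwo (ν - 1)).continuous.continuousAt.eventually_ne h')

theorem analyticAt_logDerivRatio {s : ℂ} (h : pcfSqrtTwo ν s ≠ 0) (h' : pcfSqrtTwo (ν - 1) s ≠ 0) :
    AnalyticAt ℂ (logDerivRatio ν) s := by
  have h1 := (differentiable_pcfSqrtTwo ν).analyticAt s
  have h2 := (differentiable_pcfSqrtTwo (ν - 1)).analyticAt s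
  exact (h1.deriv.div h1 h).sub (h2.deriv.div h2 h')

/-- With u = -2s + R + T one has R' = Ru, T' = -Tu and RT = 2ν; these three relations imply the
equation by algebra. -/
theorem logDerivRatio_painleve {s : ℂ} (h : pcfSqrtTwo ν s ≠ 0) (h' : pcfSqrtTwo (ν - 1) s ≠ 0) :
    2 * logDerivRatio ν s * deriv (deriv (logDerivRatio ν)) s =
      deriv (logDerivRatio ν) s ^ 2 + 3 * logDerivRatio ν s ^ 4 + 8 * s * logDerivRatio ν s ^ 3 +
        4 * (s ^ 2 - 2 * ν) * logDerivRatio ν s ^ 2 - 4 := by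
  set R : ℂ → ℂ := fun s => (√2 : ℝ) * (pcfSqrtTwo ν s / pcfSqrtTwo (ν - 1) s) with hR
  set T : ℂ → ℂ := fun s => (√2 : ℝ) * ν * (pcfSqrtTwo (ν - 1) s / pcfSqrtTwo ν s) with hT
  have hRT : ∀ {s}, pcfSqrtTwo ν s ≠ 0 → pcfSqrtTwo (ν - 1) s ≠ 0 → R s * T s = 2 * ν := by
    intro s h h'
    simp only [hR, hT]
    field_simp
    linear_combination (ν : ℂ) * sqrt_two_sq
  have hg : ∀ {s}, pcfSqrtTwo ν s ≠ 0 → pcfSqrtTwo (ν - 1) s ≠ 0 →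
      logDerivRatio ν s = -2 * s + R s + T s := logDerivRatio_eq
  have hR' : ∀ {s}, pcfSqrtTwo ν s ≠ 0 → pcfSqrtTwo (ν - 1) s ≠ 0 →
      HasDerivAt R (R s * (-2 * s + R s + T s)) s := by
    intro s h h'
    refine (((hasDerivAt_pcfSqrtTwo ν s).fun_div (hasDerivAt_pcfSqrtTwo_sub_one ν s) h').const_mul
      ((√2 : ℝ) : ℂ)).congr_deriv ?_
    simp only [hR, hT]
    field_simp
    ring
  have hT' : ∀ {s}, pcfSqrtTwo ν s ≠ 0 → pcfSqrtTwo (ν - 1) s ≠ 0 →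
      HasDerivAt T (-(T s * (-2 * s + R s + T s))) s := by
    intro s h h'
    refine (((hasDerivAt_pcfSqrtTwo_sub_one ν s).fun_div (hasDerivAt_pcfSqrtTwo ν s) h).const_mul
      ((√2 : ℝ) * ν : ℂ)).congr_deriv ?_
    simp only [hR, hT]
    field_simp
    ring
  have hlin : ∀ s : ℂ, HasDerivAt (fun t : ℂ => -2 * t) (-2) s := fun s => by
    simpa using (hasDerivAt_id' s).const_mul (-2 : ℂ)
  -- From here only the differential relations and RT = 2ν are used.
  clear_value R T
  have hg' : ∀ {s}, pcfSqrtTwo ν s ≠ 0 → pcfSqrtTwo (ν - 1) s ≠ 0 →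
      deriv (logDerivRatio ν) s = (R s - T s) * (-2 * s + R s + T s) - 2 := by
    intro s h h'
    have h1 : logDerivRatio ν =ᶠ[𝓝 s] fun t => -2 * t + R t + T t := by
      filter_upwards [eventually_pcfSqrtTwo_ne_zero h h'] with t ht using hg ht.1 ht.2
    rw [h1.deriv_eq, (((hlin s).fun_add (hR' h h')).fun_add
      (hT' h h')).deriv]
    ring
  have hg'' : deriv (deriv (logDerivRatio ν)) s = (R s + T s) * (-2 * s + R s + T s) ^ 2 +
      (R s - T s) * ((R s - T s) * (-2 * s + R s + T s) - 2) := by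
    have h1 : deriv (logDerivRatio ν) =ᶠ[𝓝 s] fun t => (R t - T t) * (-2 * t + R t + T t) - 2 := by
      filter_upwards [eventually_pcfSqrtTwo_ne_zero h h'] with t ht using hg' ht.1 ht.2
    rw [h1.deriv_eq, ((((hR' h h').fun_sub (hT' h h')).fun_mul
      (((hlin s).fun_add (hR' h h')).fun_add (hT' h h'))).sub_const
      2).deriv]
    ring
  rw [hg'', hg' h h', hg h h']
  linear_combination -4 * (-2 * s + R s + T s) ^ 2 * hRT h h'

theorem eventually_ne_zero_and (hν : ∀ n : ℕ, ν ≠ n) :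
    ∀ᶠ s in codiscrete ℂ, pcfSqrtTwo ν s ≠ 0 ∧ pcfSqrtTwo (ν - 1) s ≠ 0 := by
  obtain ⟨_, h⟩ := exists_pcfSqrtTwo_ne_zero hν
  obtain ⟨_, h'⟩ := exists_pcfSqrtTwo_sub_one_ne_zero hν
  exact (eventually_codiscrete_ne_zero (differentiable_pcfSqrtTwo ν) h).and
    (eventually_codiscrete_ne_zero (differentiable_pcfSqrtTwo (ν - 1)) h')

theorem solvesPIV_of_eventually_eq_logDerivRatio (hν : ∀ n : ℕ, ν ≠ n)
    (hu : MeromorphicNFOn u Set.univ) (h : ∀ᶠ s in codiscrete ℂ, u s = logDerivRatio ν s) :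
    SolvesPIV (-((1 : ℤ) / 2)) (ν + (1 : ℤ) / 2) u := by
  intro s hs
  have h1 : ∀ᶠ t in 𝓝[≠] s, 2 * u t * deriv (deriv u) t =
      deriv u t ^ 2 + 3 * u t ^ 4 + 8 * t * u t ^ 3 + 4 * (t ^ 2 - 2 * ν) * u t ^ 2 - 4 := by
    filter_upwards [eventually_nhdsNE_of_codiscrete (eventually_ne_zero_and hν) s] with t ht
    have h2 := eq_of_meromorphicNF hu
      (analyticAt_logDerivRatio ht.1 ht.2).meromorphicNFAt h
    rw [h2.deriv.deriv_eq, h2.deriv_eq, h2.eq_of_nhds]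
    exact logDerivRatio_painleve ht.1 ht.2
  have c0 := hs.continuousAt
  have c1 := hs.deriv.continuousAt
  have c2 := hs.deriv.deriv.continuousAt
  -- The equation was checked where neither cylinder function vanishes; continuity carries it to any
  -- other point at which u is analytic.
  have h2 : 2 * u s * deriv (deriv u) s =
      deriv u s ^ 2 + 3 * u s ^ 4 + 8 * s * u s ^ 3 + 4 * (s ^ 2 - 2 * ν) * u s ^ 2 - 4 := by
    refine tendsto_nhds_unique_of_eventuallyEq (l := 𝓝[≠] s) (ContinuousAt.tendsto
      (f := fun t => 2 * u t * deriv (deriv u) t) (by fun_prop) |>.mono_left nhdsWithin_le_nhds)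
      (ContinuousAt.tendsto (f := fun t => deriv u t ^ 2 + 3 * u t ^ 4 + 8 * t * u t ^ 3 +
        4 * (t ^ 2 - 2 * ν) * u t ^ 2 - 4) (by fun_prop) |>.mono_left nhdsWithin_le_nhds) h1
  rw [h2]
  push_cast
  ring

theorem isSpecialSolution_one_iff (hν : ∀ n : ℕ, ν ≠ n) :
    IsSpecialSolution (-((1 : ℤ) / 2)) (ν + (1 : ℤ) / 2) u ↔ MeromorphicNFOn u Set.univ ∧
      ∀ᶠ s in codiscrete ℂ, u s = logDerivRatio ν s := by
  obtain ⟨s₀, h₀⟩ := exists_pcfSqrtTwo_ne_zero hν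
  obtain ⟨s₁, h₁⟩ := exists_pcfSqrtTwo_sub_one_ne_zero hν
  have h2 : (2 : ℂ) ^ (-ν / 2 : ℂ) ≠ 0 := by simp [Complex.cpow_eq_zero_iff]
  set m : ℂ := -(modelConst ν / 2 ^ (-ν / 2 : ℂ)) with hm
  have hm0 : m ≠ 0 := neg_ne_zero.2 (div_ne_zero (modelConst_ne_zero hν) h2)
  rw [isSpecialSolution_iff hν (p := fun s => m * pcfSqrtTwo (ν - 1) s)
    ((differentiable_pcfSqrtTwo (ν - 1)).const_mul m) (differentiable_pcfSqrtTwo ν) h₀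
    (mul_ne_zero hm0 h₁) fun s hs => by
      obtain ⟨P, A, hP, hA⟩ := exists_isPolyReduction_one hν (s := s) (by
        rw [(pcfB_zero_apply ν s).2]
        exact mul_ne_zero h2 hs)
      refine ⟨P, A, hP, ?_⟩
      rw [hA, (pcfB_zero_apply ν s).1, (pcfB_zero_apply ν s).2, hm]
      field_simp]
  simp only [logDeriv_const_mul _ _ hm0]
  exact ⟨fun h => ⟨h.1, h.2.2⟩,
    fun h => ⟨h.1, solvesPIV_of_eventually_eq_logDerivRatio hν h.1 h.2, h.2⟩⟩

theorem existsUnique_isSpecialSolution_one (hν : ∀ n : ℕ, ν ≠ n) :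
    ∃! u, IsSpecialSolution (-((1 : ℤ) / 2)) (ν + (1 : ℤ) / 2) u := by
  simp only [isSpecialSolution_one_iff hν]
  have h1 := meromorphicNFOn_toMeromorphicNFOn (logDerivRatio ν) Set.univ
  have h2 : ∀ᶠ s in codiscrete ℂ, toMeromorphicNFOn (logDerivRatio ν) Set.univ s =
      logDerivRatio ν s :=
    (toMeromorphicNFOn_eqOn_codiscrete (meromorphicOn_logDerivRatio ν)).symm
  refine ⟨_, ⟨h1, h2⟩, fun u hu => funext fun s => ?_⟩
  refine (eq_of_meromorphicNF hu.1 (h1 (Set.mem_univ s)) ?_).eq_of_nhds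
  filter_upwards [hu.2, h2] with t ht ht'
  rw [ht, ht']

theorem meromorphicOrderAt_neg_iff (hν : ∀ n : ℕ, ν ≠ n) (hu : MeromorphicNFOn u Set.univ)
    (h : ∀ᶠ s in codiscrete ℂ, u s = logDerivRatio ν s) (s : ℂ) :
    meromorphicOrderAt u s < 0 ↔ pcfSqrtTwo ν s = 0 ∨ pcfSqrtTwo (ν - 1) s = 0 := by
  rw [← not_iff_not, not_lt, not_or,
    (hu (Set.mem_univ s)).meromorphicOrderAt_nonneg_iff_analyticAt]
  refine ⟨fun hs => ?_, fun hs => ?_⟩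
  · have c0 := hs.continuousAt
    have c1 : Continuous (pcfSqrtTwo ν) := (differentiable_pcfSqrtTwo ν).continuous
    have c2 : Continuous (pcfSqrtTwo (ν - 1)) := (differentiable_pcfSqrtTwo (ν - 1)).continuous
    -- Clearing denominators gives an identity that survives at s if u is analytic there. A zero of
    -- one cylinder function would then force the other to vanish as well, since ν ≠ 0.
    have h1 : u s * (pcfSqrtTwo ν s * pcfSqrtTwo (ν - 1) s) = -2 * s * (pcfSqrtTwo ν s *
        pcfSqrtTwo (ν - 1) s) + (√2 : ℝ) * pcfSqrtTwo ν s ^ 2 +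
        (√2 : ℝ) * ν * pcfSqrtTwo (ν - 1) s ^ 2 := by
      refine tendsto_nhds_unique_of_eventuallyEq (l := 𝓝[≠] s) (ContinuousAt.tendsto
        (f := fun t => u t * (pcfSqrtTwo ν t * pcfSqrtTwo (ν - 1) t)) (by fun_prop) |>.mono_left
          nhdsWithin_le_nhds)
        (ContinuousAt.tendsto (f := fun s => -2 * s * (pcfSqrtTwo ν s *
        pcfSqrtTwo (ν - 1) s) + (√2 : ℝ) * pcfSqrtTwo ν s ^ 2 +
        (√2 : ℝ) * ν * pcfSqrtTwo (ν - 1) s ^ 2) (by fun_prop) |>.mono_left nhdsWithin_le_nhds) ?_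
      filter_upwards [eventually_nhdsNE_of_codiscrete (h.and (eventually_ne_zero_and hν)) s]
        with t ht
      have h1 := ht.2.1
      have h2 := ht.2.2
      rw [ht.1, logDerivRatio_eq h1 h2]
      field_simp
    constructor
    · intro h0
      refine (pcfSqrtTwo_ne_zero_or hν s).elim (· h0) fun h2 => ?_
      rw [h0] at h1
      have : (√2 : ℝ) * ν * pcfSqrtTwo (ν - 1) s ^ 2 = 0 := by linear_combination -h1
      exact mul_ne_zero (mul_ne_zero sqrt_two_ne_zero (ofReal_ne_zero_of_forall_ne_natCast hν))
        (pow_ne_zero 2 h2) this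
    · intro h0
      refine (pcfSqrtTwo_ne_zero_or hν s).elim (fun h2 => ?_) (· h0)
      rw [h0] at h1
      have : (√2 : ℝ) * pcfSqrtTwo ν s ^ 2 = 0 := by linear_combination -h1
      exact mul_ne_zero sqrt_two_ne_zero (pow_ne_zero 2 h2) this
  · have h1 := analyticAt_logDerivRatio hs.1 hs.2
    exact h1.congr (eq_of_meromorphicNF hu h1.meromorphicNFAt h).symm

end

end PIV

end

/-! ### The theorem, with b = k/2 and the cases k = 0 and k = 1 -/

theorem mainTheorem3 (ν : ℝ) (hν : ∀ n : ℕ, ν ≠ n) :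
    (∀ (k : ℤ) (b : ℝ), b = k / 2 → ∀ u : ℂ → ℂ,
      PIV.IsSpecialSolution ((-b : ℝ) : ℂ) ((ν + b : ℝ) : ℂ) u → PIV.IsRationalInPcf ν u) ∧
    (∀ b : ℝ, b = 0 → ∀ u : ℂ → ℂ,
      PIV.IsSpecialSolution ((-b : ℝ) : ℂ) ((ν + b : ℝ) : ℂ) u ↔ ∀ s, u s = 0) ∧
    (∀ b : ℝ, b = 1 / 2 →
      (∃! u : ℂ → ℂ, PIV.IsSpecialSolution ((-b : ℝ) : ℂ) ((ν + b : ℝ) : ℂ) u) ∧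
      ∀ u : ℂ → ℂ, PIV.IsSpecialSolution ((-b : ℝ) : ℂ) ((ν + b : ℝ) : ℂ) u →
        (∀ s, PIV.pcfSqrtTwo ν s ≠ 0 → PIV.pcfSqrtTwo (ν - 1) s ≠ 0 →
          u s = logDeriv (fun t => PIV.pcfSqrtTwo ν t / PIV.pcfSqrtTwo (ν - 1) t) s) ∧
        (∀ s, meromorphicOrderAt u s < 0 ↔
          PIV.pcfSqrtTwo ν s = 0 ∨ PIV.pcfSqrtTwo (ν - 1) s = 0)) := by
  have hcast : ∀ (k : ℤ) (b : ℝ), b = k / 2 →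
      ((-b : ℝ) : ℂ) = -(k / 2) ∧ ((ν + b : ℝ) : ℂ) = ν + k / 2 := by
    rintro k b rfl
    constructor <;> push_cast <;> ring
  refine ⟨fun k b hb u hu => ?_, fun b hb u => ?_, fun b hb => ?_⟩
  · rw [(hcast k b hb).1, (hcast k b hb).2] at hu
    exact hu.isRationalInPcf hν
  · have h := hcast 0 b (by simpa using hb)
    rw [h.1, h.2]
    exact PIV.isSpecialSolution_zero_iff hν
  · have h := hcast 1 b (by simpa using hb)
    rw [h.1, h.2]
    refine ⟨PIV.existsUnique_isSpecialSolution_one hν, fun u hu => ?_⟩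
    obtain ⟨h1, h2⟩ := (PIV.isSpecialSolution_one_iff hν).1 hu
    refine ⟨fun s hs hs' => ?_, PIV.meromorphicOrderAt_neg_iff hν h1 h2⟩
    rw [logDeriv_div s hs hs' (PIV.differentiable_pcfSqrtTwo ν s)
      (PIV.differentiable_pcfSqrtTwo (ν - 1) s)]
    exact (PIV.eq_of_meromorphicNF h1
      (PIV.analyticAt_logDerivRatio hs hs').meromorphicNFAt h2).eq_of_nhds
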